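/- Consider the Gaussian $3\times 3$ many-to-one X channel in standard form, $$y_1 = x_1 + a x_2 + b x_3 + n_1,\qquad y_2 = x_2 + n_2,\qquad y_3 = x_3 + n_3,$$ with $a,b\in\mathbb R$, noises $n_i\sim\mathcal N(0,1)$ that are i.i.d. over channel uses, and every codeword $\mathbf x_j^n$ of transmitter $j$ subject to $\|\mathbf x_j^n\|_2^2\le nP_j$, $P_j\ge 0$. There are five independent, uniformly distributed messages: $W_{11},W_{12},W_{13}$, where $W_{1j}$ is sent by transmitter $j$ to receiver 1, and $W_{22},W_{33}$, where $W_{jj}$ is sent by transmitter $j$ to receiver $j$. A vector of five nonnegative rates (in bits per channel use) is achievable if, for a sequence of codes with these rates and block length $n\to\infty$, the average error probability of each receiver tends to $0$; the capacity region is the closure of the set of achievable rate vectors, and the sum-rate capacity $S$ is the maximum over it of the sum of the five rates. In strategy $\mathcal M3$ the transmitters send only $W_{11},W_{12},W_{13}$, using Gaussian codebooks: they form a multiple access channel at receiver 1. Let $R_{\mathcal M3}$ denote the supremum of the sum-rates that this strategy achieves. Let $\rho\in(-1,1)$, $\rho\neq 0$, and suppose that $$a^2\ \ge\ \frac{(1+b^2P_3)^2}{\rho^2}\qquad\text{and}\qquad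 b^2\ \ge\ 1 .$$ Put $\eta=(1+b^2P_3)/\rho$, and let the genie-aided channel be the channel above in which receiver 1 is also given $s_1=x_1+a x_2+\eta z_1$, where $(n_1,z_1)$ is jointly Gaussian with zero means, unit variances and correlation coefficient $\rho$, i.i.d. over channel uses. For independent $x_{jG}\sim\mathcal N(0,P_j)$ let $y_{1G},s_{1G}$ be the resulting $y_1,s_1$. Then: 1. $R_{\mathcal M3}=I(x_{1G},x_{2G},x_{3G};y_{1G})$, and every rate triple $(R_{11},R_{12},R_{13})$ that strategy $\mathcal M3$ achieves gives a point $(R_{11},R_{12},R_{13},0,0)$ of the capacity region of the X channel. 2. The quantity $B=I(x_{1G},x_{2G},x_{3G};y_{1G},s_{1G})$ is a sum-rate outer bound: the capacity region of the X channel is contained in that of the genie-aided channel, and every rate vector in the latter has sum-rate at most $B$. In particular $R_{\mathcal M3}\le S\le B$. 3. The gap between this outer bound and the sum-rate of strategy $\mathcal M3$ is $$B-R_{\mathcal M3}\;=\;\frac12\log_2\!\left(\frac{1-(1+b^2P_3)^{-1}\rho^2}{1-\rho^2}\right).$$ -/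

import Mathlib

open MeasureTheory ProbabilityTheory Filter Topology
open scoped NNReal ENNReal

noncomputable section

namespace ManyToOneX

/-- The five messages of the `3 × 3` many-to-one X channel: `wij` is the message sent by
transmitter `j` to receiver `i`. -/
inductive Message
  | w11 | w12 | w13 | w22 | w33
  deriving DecidableEq

open Message

instance : Fintype Message where
  elems := {w11, w12, w13, w22, w33}
  complete := by
    intro w
    cases w <;> simp

/-- A rate vector assigns a rate (in bits per channel use) to each message. -/
abbrev RateVector : Type := Message → ℝ

/-- The sum-rate of a rate vector. -/
def sumRate (R : RateVector) : ℝ := R w11 + R w12 + R w13 + R w22 + R w33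

/-- Number of messages `⌈2 ^ (n r)⌉` of rate `r` at block length `n`. -/
def msgCount (n : ℕ) (r : ℝ) : ℕ := ⌈(2 : ℝ) ^ ((n : ℝ) * r)⌉₊

/-- What receiver 1 observes in one channel use: `output x z`, where `x = (x₁, x₂, x₃)` are the
three transmitted symbols (indexed by `0, 1, 2`) and `z` is drawn from `noise`, independently of
everything else. Receivers 2 and 3 always observe `x₂ + n₂` and `x₃ + n₃`, with standard Gaussian
`n₂`, `n₃`. -/
structure ReceiverOne (N Y : Type) [MeasurableSpace N] where
  noise : Measure N
  output : (Fin 3 → ℝ) → N → Y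

/-- The channel in standard form: `y₁ = x₁ + a x₂ + b x₃ + n₁` with `n₁ ∼ 𝒩(0, 1)`. -/
def plainReceiver (a b : ℝ) : ReceiverOne ℝ ℝ where
  noise := gaussianReal 0 1
  output x n := x 0 + a * x 1 + b * x 2 + n

/-- The law of `(n₁, z₁)`: jointly Gaussian, both of mean `0` and variance `1`, with correlation
coefficient `ρ` (here `-1 ≤ ρ ≤ 1`). -/
def correlatedNoise (ρ : ℝ) : Measure (ℝ × ℝ) :=
  ((gaussianReal 0 1).prod (gaussianReal 0 1)).map
    fun p => (p.1, ρ * p.1 + √(1 - ρ ^ 2) * p.2)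

/-- The genie-aided receiver: besides `y₁ = x₁ + a x₂ + b x₃ + n₁`, receiver 1 is given the side
information `s₁ = x₁ + a x₂ + η z₁`. -/
def genieReceiver (a b η ρ : ℝ) : ReceiverOne (ℝ × ℝ) (ℝ × ℝ) where
  noise := correlatedNoise ρ
  output x z := (x 0 + a * x 1 + b * x 2 + z.1, x 0 + a * x 1 + η * z.2)

/-- A code of block length `n` with rates `R` and power constraints `P`; `Y` is the alphabet of
receiver 1. -/
structure Code (Y : Type) [MeasurableSpace Y] (P : Fin 3 → ℝ≥0) (n : ℕ) (R : RateVector) where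
  enc1 : Fin (msgCount n (R w11)) → Fin n → ℝ
  enc2 : Fin (msgCount n (R w12)) → Fin (msgCount n (R w22)) → Fin n → ℝ
  enc3 : Fin (msgCount n (R w13)) → Fin (msgCount n (R w33)) → Fin n → ℝ
  power1 : ∀ m, ∑ t, enc1 m t ^ 2 ≤ n * P 0
  power2 : ∀ m m', ∑ t, enc2 m m' t ^ 2 ≤ n * P 1
  power3 : ∀ m m', ∑ t, enc3 m m' t ^ 2 ≤ n * P 2
  dec1 : (Fin n → Y) →
    Fin (msgCount n (R w11)) × Fin (msgCount n (R w12)) × Fin (msgCount n (R w13))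
  dec2 : (Fin n → ℝ) → Fin (msgCount n (R w22))
  dec3 : (Fin n → ℝ) → Fin (msgCount n (R w33))
  measurable_dec1 : Measurable dec1
  measurable_dec2 : Measurable dec2
  measurable_dec3 : Measurable dec3

/-- A choice of all five messages. -/
abbrev Messages (n : ℕ) (R : RateVector) : Type := (w : Message) → Fin (msgCount n (R w))

/-- Average of `f` over a finite set (uniformly distributed messages). -/
def average {ι : Type} [Fintype ι] (f : ι → ℝ) : ℝ := (∑ i, f i) / Fintype.card ι

namespace Code

variable {N Y : Type} [MeasurableSpace N] [MeasurableSpace Y] {P : Fin 3 → ℝ≥0} {n : ℕ}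
  {R : RateVector}

/-- The symbols sent by the three transmitters in channel use `t`. -/
def sent (c : Code Y P n R) (m : Messages n R) (t : Fin n) : Fin 3 → ℝ :=
  ![c.enc1 (m w11) t, c.enc2 (m w12) (m w22) t, c.enc3 (m w13) (m w33) t]

/-- Average probability of error at receiver 1, which decodes `W₁₁, W₁₂, W₁₃`. -/
def error1 (ch : ReceiverOne N Y) (c : Code Y P n R) : ℝ :=
  average fun m : Messages n R =>
    (Measure.pi fun _ : Fin n => ch.noise).real
      {z | c.dec1 (fun t => ch.output (c.sent m t) (z t)) ≠ (m w11, m w12, m w13)}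

/-- Average probability of error at receiver 2, which decodes `W₂₂` from `x₂ + n₂`. -/
def error2 (c : Code Y P n R) : ℝ :=
  average fun m : Messages n R =>
    (Measure.pi fun _ : Fin n => gaussianReal 0 1).real
      {z | c.dec2 (fun t => c.sent m t 1 + z t) ≠ m w22}

/-- Average probability of error at receiver 3, which decodes `W₃₃` from `x₃ + n₃`. -/
def error3 (c : Code Y P n R) : ℝ :=
  average fun m : Messages n R =>
    (Measure.pi fun _ : Fin n => gaussianReal 0 1).real
      {z | c.dec3 (fun t => c.sent m t 2 + z t) ≠ m w33}

end Code

/-- A rate vector is achievable if some sequence of codes has vanishing average probability of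
error at every receiver. -/
def Achievable {N Y : Type} [MeasurableSpace N] [MeasurableSpace Y] (ch : ReceiverOne N Y)
    (P : Fin 3 → ℝ≥0) (R : RateVector) : Prop :=
  (∀ w, 0 ≤ R w) ∧ ∃ c : (n : ℕ) → Code Y P n R,
    Tendsto (fun n => (c n).error1 ch) atTop (𝓝 0) ∧
    Tendsto (fun n => (c n).error2) atTop (𝓝 0) ∧
    Tendsto (fun n => (c n).error3) atTop (𝓝 0)

/-- The capacity region: the closure of the set of achievable rate vectors. -/
def capacityRegion {N Y : Type} [MeasurableSpace N] [MeasurableSpace Y] (ch : ReceiverOne N Y)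
    (P : Fin 3 → ℝ≥0) : Set RateVector :=
  closure {R | Achievable ch P R}

/-- One codebook for each transmitter, when transmitter `j` only sends a message of rate `r j`
to receiver 1. -/
abbrev Codebooks (n : ℕ) (r : Fin 3 → ℝ) : Type :=
  (j : Fin 3) → Fin (msgCount n (r j)) → Fin n → ℝ

/-- Gaussian codebooks: all symbols of all codewords are independent, those of transmitter `j`
with law `𝒩(0, Q j)`. -/
def gaussianCodebooks (Q : Fin 3 → ℝ≥0) (n : ℕ) (r : Fin 3 → ℝ) : Measure (Codebooks n r) :=
  Measure.pi fun j => Measure.pi fun _ => Measure.pi fun _ => gaussianReal 0 (Q j)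

/-- Error probability of the strategy in which all transmitters use Gaussian codebooks and form a
multiple access channel at receiver 1, averaged over codebooks and messages. An error occurs if
receiver 1, which knows the codebooks, decodes a wrong message triple, or if one of the
transmitted codewords violates its power constraint. -/
def gaussianMACError (a b : ℝ) (P Q : Fin 3 → ℝ≥0) (n : ℕ) (r : Fin 3 → ℝ)
    (dec : Codebooks n r × (Fin n → ℝ) → (j : Fin 3) → Fin (msgCount n (r j))) : ℝ :=
  average fun m : (j : Fin 3) → Fin (msgCount n (r j)) =>
    ((gaussianCodebooks Q n r).prod (Measure.pi fun _ : Fin n => (plainReceiver a b).noise)).real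
      {p | dec (p.1, fun t => (plainReceiver a b).output (fun j => p.1 j (m j) t) (p.2 t)) ≠ m ∨
        ∃ j, (n : ℝ) * P j < ∑ t, p.1 j (m j) t ^ 2}

/-- The rates `(R₁₁, R₁₂, R₁₃) = (r 0, r 1, r 2)` are achieved by strategy M3: all transmitters use
Gaussian codebooks, of powers within the power constraints, and form a multiple access channel at
receiver 1. -/
def M3Achieves (a b : ℝ) (P : Fin 3 → ℝ≥0) (r : Fin 3 → ℝ) : Prop :=
  (∀ j, 0 ≤ r j) ∧ ∃ Q : Fin 3 → ℝ≥0, (∀ j, Q j ≤ P j) ∧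
    ∃ dec : (n : ℕ) → Codebooks n r × (Fin n → ℝ) → (j : Fin 3) → Fin (msgCount n (r j)),
      (∀ n, Measurable (dec n)) ∧
      Tendsto (fun n => gaussianMACError a b P Q n r (dec n)) atTop (𝓝 0)

/-- The rate vector of the X channel when only `W₁₁, W₁₂, W₁₃` are used. -/
def macRates (r : Fin 3 → ℝ) : RateVector
  | w11 => r 0
  | w12 => r 1
  | w13 => r 2
  | w22 => 0
  | w33 => 0

/-- Mutual information, in bits, of two random variables with joint law `μ`. -/
def mutualInfo {X Y : Type} [MeasurableSpace X] [MeasurableSpace Y] (μ : Measure (X × Y)) : ℝ≥0∞ :=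
  InformationTheory.klDiv μ ((μ.map Prod.fst).prod (μ.map Prod.snd)) / ENNReal.ofReal (Real.log 2)

/-- `I(x₁, x₂, x₃ ; output of receiver 1)` for independent inputs `xⱼ ∼ 𝒩(0, Pⱼ)`. -/
def gaussianInputInfo {N Y : Type} [MeasurableSpace N] [MeasurableSpace Y] (ch : ReceiverOne N Y)
    (P : Fin 3 → ℝ≥0) : ℝ≥0∞ :=
  mutualInfo <| ((Measure.pi fun j => gaussianReal 0 (P j)).prod ch.noise).map
    fun p => (p.1, ch.output p.1 p.2)

end ManyToOneX

end

noncomputable section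

namespace ManyToOneX

open Message

/-! Write A = 1 + b²P₃, so that ηρ = A. Suppose receiver 1 of the genie-aided channel has decoded
its own messages. It then knows x₁, and (s₁ - x₁)/a = x₂ + (η/a) z₁ has noise variance at most 1
because η² ≤ a². Adding independent Gaussian noise reproduces the law of receiver 2's observation,
so W₂₂ can be decoded too. Now x₂ is known, and (y₁ - x₁ - a x₂)/b = x₃ + n₁/b has noise variance at
most 1 because b² ≥ 1, so W₃₃ follows in the same way. Receiver 1 thus recovers all five messages,
and a single-receiver converse bounds the whole sum-rate (`one_sub_errors_le`, `genie_converse`).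

That converse is a change of measure (`one_shot_converse`, `block_converse`): up to log 2, the log
of the number of messages times the probability of correct decoding is at most the average
divergence of the output laws from any fixed reference law. The reference makes y and s - y
independent Gaussians. The value of η is exactly the one for which this is the output law of
Gaussian inputs: cov(y₁, s₁ - y₁) = -b²P₃ + ηρ - 1 = 0. The average divergence then depends on the
code only through the variances of the signal parts of y₁ and of s₁ - y₁, which the power
constraints bound. The result is B = ½ log₂(v w / τ), where v = Var y₁, w = η² - ηρ = Var(s₁ - y₁),
and τ = η²(1 - ρ²) is the variance of s₁ given the inputs and n₁.

The same converse without side information gives R ≤ ½ log₂ v for strategy M3. It is met by random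
Gaussian codebooks with distance decoding (`distanceDecoder_error_le`, `m3Achieves_of_lt`): by
concavity of the logarithm, splitting the sum-rate in proportion to the received powers satisfies
every constraint of the multiple access region (`exists_m3Achieves`). Hence the gap is ½ log₂(w /
τ), and substituting η = A / ρ gives the stated expression. -/

lemma pi_eq_withDensity_prod {ι : Type*} [Fintype ι] {Ω : ι → Type*}
    [∀ i, MeasurableSpace (Ω i)] {μ ν : ∀ i, Measure (Ω i)}
    [∀ i, IsProbabilityMeasure (μ i)] [∀ i, IsProbabilityMeasure (ν i)]
    {f : ∀ i, Ω i → ℝ≥0∞} (hf : ∀ i, Measurable (f i))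
    (h : ∀ i, ν i = (μ i).withDensity (f i)) :
    Measure.pi ν = (Measure.pi μ).withDensity fun x => ∏ i, f i (x i) := by
  symm
  refine (Measure.pi_eq fun s hs => ?_).symm
  rw [withDensity_apply _ (MeasurableSet.univ_pi hs),
    ← lintegral_indicator (MeasurableSet.univ_pi hs)]
  -- The indicator of a box is the product of the coordinate indicators, so the integral over the
  -- box factorizes by independence of the coordinates.
  have hi : ∀ x : (i : ι) → Ω i, (Set.univ.pi s).indicator (fun x => ∏ i, f i (x i)) x
      = ∏ i, (s i).indicator (f i) (x i) := by
    intro x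
    classical
    by_cases hx : x ∈ Set.univ.pi s
    · rw [Set.indicator_of_mem hx]
      refine Finset.prod_congr rfl fun i _ => ?_
      rw [Set.indicator_of_mem (hx i trivial)]
    · rw [Set.indicator_of_notMem hx]
      have : ∃ i, x i ∉ s i := by simpa [Set.mem_pi] using hx
      obtain ⟨i, hxi⟩ := this
      exact (Finset.prod_eq_zero (Finset.mem_univ i) (Set.indicator_of_notMem hxi _)).symm
  simp_rw [hi]
  have hm : ∀ i, Measurable ((s i).indicator (f i)) := fun i => (hf i).indicator (hs i)
  have := lintegral_prod_eq_prod_lintegral_of_indepFun (μ := Measure.pi μ) Finset.univ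
    (fun i (x : (i : ι) → Ω i) => (s i).indicator (f i) (x i))
    (iIndepFun_pi fun i => (hm i).aemeasurable)
    (fun i => (hm i).comp (measurable_pi_apply i))
  rw [this]
  refine Finset.prod_congr rfl fun i _ => ?_
  rw [h i, withDensity_apply _ (hs i), ← lintegral_indicator (hs i)]
  exact (measurePreserving_eval μ i).lintegral_comp (hm i)

/-! ### Gaussian log-likelihood ratios and the change-of-measure converse -/

/-- The log-likelihood ratio of `𝒩(c, v)` against `𝒩(μ, w)`. -/
def gaussianLLR (c : ℝ) (v : ℝ≥0) (μ : ℝ) (w : ℝ≥0) (y : ℝ) : ℝ :=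
  1 / 2 * Real.log (w / v) - (y - c) ^ 2 / (2 * v) + (y - μ) ^ 2 / (2 * w)

@[fun_prop]
lemma measurable_gaussianLLR (c : ℝ) (v : ℝ≥0) (μ : ℝ) (w : ℝ≥0) :
    Measurable (gaussianLLR c v μ w) := by
  unfold gaussianLLR; fun_prop

lemma gaussianPDFReal_eq_mul_exp_gaussianLLR (c μ y : ℝ) {v w : ℝ≥0} (hv : v ≠ 0) (hw : w ≠ 0) :
    gaussianPDFReal c v y = gaussianPDFReal μ w y * Real.exp (gaussianLLR c v μ w y) := by
  have hv' : (0 : ℝ) < v := by exact_mod_cast pos_iff_ne_zero.2 hv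
  have hw' : (0 : ℝ) < w := by exact_mod_cast pos_iff_ne_zero.2 hw
  have h1 : Real.exp (1 / 2 * Real.log (w / v)) = √w / √v := by
    rw [← Real.sqrt_div hw'.le, Real.sqrt_eq_rpow, Real.rpow_def_of_pos (by positivity), mul_comm]
  rw [gaussianPDFReal, gaussianPDFReal, gaussianLLR, Real.exp_add, Real.exp_sub, h1,
    neg_div, neg_div, Real.exp_neg, Real.exp_neg,
    Real.sqrt_mul (by positivity) (v : ℝ), Real.sqrt_mul (by positivity) (w : ℝ)]
  have := Real.sqrt_pos.2 hv'
  have := Real.sqrt_pos.2 hw'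
  field_simp

lemma gaussianReal_eq_withDensity (c μ : ℝ) {v w : ℝ≥0} (hv : v ≠ 0) (hw : w ≠ 0) :
    gaussianReal c v = (gaussianReal μ w).withDensity
      fun y => ENNReal.ofReal (Real.exp (gaussianLLR c v μ w y)) := by
  rw [gaussianReal_of_var_ne_zero _ hv, gaussianReal_of_var_ne_zero _ hw,
    ← withDensity_mul _ (measurable_gaussianPDF _ _)
      (measurable_gaussianLLR c v μ w).exp.ennreal_ofReal]
  congr 1
  ext y
  rw [Pi.mul_apply, gaussianPDF, gaussianPDF, ← ENNReal.ofReal_mul (gaussianPDFReal_nonneg _ _ _),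
    gaussianPDFReal_eq_mul_exp_gaussianLLR c μ y hv hw]

lemma memLp_id_gaussian (c : ℝ) (v : ℝ≥0) (p : ℝ≥0) : MemLp (fun x : ℝ => x) p (gaussianReal c v) :=
  memLp_id_gaussianReal p

lemma integrable_sub_sq_gaussian (c μ : ℝ) (v : ℝ≥0) :
    Integrable (fun y => (y - μ) ^ 2) (gaussianReal c v) :=
  ((memLp_id_gaussian c v 2).sub (memLp_const μ)).integrable_sq

lemma integral_sub_sq_gaussian (c μ : ℝ) (v : ℝ≥0) :
    ∫ y, (y - μ) ^ 2 ∂gaussianReal c v = v + (c - μ) ^ 2 := by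
  have h1 : ∫ y, (y - c) ^ 2 ∂gaussianReal c v = v := by
    have h := variance_fun_id_gaussianReal (μ := c) (v := v)
    rw [variance_eq_integral (by fun_prop)] at h
    rwa [integral_id_gaussianReal] at h
  have hi : Integrable (fun y : ℝ => y) (gaussianReal c v) :=
    (memLp_id_gaussian c v 1).integrable (by norm_num)
  have h2 : ∀ y : ℝ, (y - μ) ^ 2 = (y - c) ^ 2 + (2 * (c - μ) * y + (-2 * (c - μ) * c + (c - μ) ^ 2)) := by
    intro y; ring
  have hi' : Integrable (fun y : ℝ => 2 * (c - μ) * y + (-2 * (c - μ) * c + (c - μ) ^ 2))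
      (gaussianReal c v) := (hi.const_mul _).add (integrable_const _)
  rw [integral_congr_ae (ae_of_all _ h2), integral_add (integrable_sub_sq_gaussian c c v) hi',
    integral_add (hi.const_mul _) (integrable_const _), h1, integral_const_mul,
    integral_id_gaussianReal]
  simp only [integral_const, probReal_univ, one_smul]
  ring

lemma integrable_gaussianLLR (c c' : ℝ) (v v' : ℝ≥0) (μ : ℝ) (w : ℝ≥0) :
    Integrable (gaussianLLR c v μ w) (gaussianReal c' v') := by
  unfold gaussianLLR
  exact ((integrable_const _).sub ((integrable_sub_sq_gaussian _ _ _).div_const _)).add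
    ((integrable_sub_sq_gaussian _ _ _).div_const _)

/-- A change-of-measure bound for the average probability of correct decoding. -/
lemma one_shot_converse {W Y : Type*} [Fintype W] [Nonempty W] [MeasurableSpace Y]
    {Q : Measure Y} [IsProbabilityMeasure Q] {p : W → Measure Y}
    [∀ w, IsProbabilityMeasure (p w)] {L : W → Y → ℝ} (hL : ∀ w, Measurable (L w))
    (hp : ∀ w, p w = Q.withDensity fun y => ENNReal.ofReal (Real.exp (L w y)))
    (hint : ∀ w, Integrable (L w) (p w)) {D : W → Set Y} (hD : ∀ w, MeasurableSet (D w))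
    (hdisj : Pairwise (Function.onFun Disjoint D)) :
    (∑ w, (p w).real (D w)) * Real.log (Fintype.card W)
      ≤ ∑ w, ∫ y, L w y ∂(p w) + Fintype.card W * Real.log 2 := by
  set M : ℝ := ((Fintype.card W : ℕ) : ℝ) with hM
  have hM0 : 0 < M := by simp [hM, Fintype.card_pos]
  have hM1 : 1 ≤ M := by rw [hM]; exact_mod_cast Fintype.card_pos
  have hQ : ∑ w, Q.real (D w) ≤ 1 := by
    rw [← measureReal_iUnion_fintype hdisj hD]
    exact measureReal_le_one
  have key : ∀ w, (p w).real (D w) * Real.log M - ∫ y, L w y ∂(p w) - Real.log 2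
      ≤ 1 / 2 * (Q.real (D w) * M + 1) - 1 := by
    intro w
    -- This is the Donsker–Varadhan argument with test function f = 1_D log M. Its exponential takes
    -- only the values M and 1, so its mean under Q is explicit.
    set f : Y → ℝ := (D w).indicator fun _ => Real.log M
    have hfm : Measurable f := measurable_const.indicator (hD w)
    have hfi : Integrable f (p w) := (integrable_const _).indicator (hD w)
    have hf : ∫ y, f y ∂(p w) = (p w).real (D w) * Real.log M := by
      rw [integral_indicator_const _ (hD w), smul_eq_mul]
    have hef : ∀ y, Real.exp (f y) = (D w).indicator (fun _ => M - 1) y + 1 := by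
      intro y
      by_cases hy : y ∈ D w
      · simp [f, hy, Real.exp_log hM0]
      · simp [f, hy]
    have hQe : ∫ y, Real.exp (f y) ∂Q = Q.real (D w) * (M - 1) + 1 := by
      simp_rw [hef]
      rw [integral_add ((integrable_const _).indicator (hD w)) (integrable_const _),
        integral_indicator_const _ (hD w)]
      simp
    have hQi : Integrable (fun y => Real.exp (f y)) Q := by
      simp_rw [hef]
      exact ((integrable_const _).indicator (hD w)).add (integrable_const _)
    have hlm : Measurable fun y => (Real.exp (L w y)).toNNReal := (hL w).exp.real_toNNReal
    have hpw : p w = Q.withDensity fun y => ((Real.exp (L w y)).toNNReal : ℝ≥0∞) := hp w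
    have hsm : ∀ y, (Real.exp (L w y)).toNNReal • Real.exp (f y - L w y) = Real.exp (f y) := by
      intro y
      rw [NNReal.smul_def, Real.coe_toNNReal _ (Real.exp_pos _).le, smul_eq_mul, ← Real.exp_add]
      congr 1; ring
    have hpe : ∫ y, Real.exp (f y - L w y) ∂(p w) = Q.real (D w) * (M - 1) + 1 := by
      rw [hpw, integral_withDensity_eq_integral_smul hlm, ← hQe]
      simp_rw [hsm]
    have hpi : Integrable (fun y => Real.exp (f y - L w y)) (p w) := by
      rw [hpw, integrable_withDensity_iff_integrable_smul hlm]
      simpa only [hsm] using hQi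
    have hmono : ∫ y, (f y - L w y - Real.log 2) ∂(p w)
        ≤ ∫ y, (1 / 2 * Real.exp (f y - L w y) - 1) ∂(p w) := by
      refine integral_mono ((hfi.sub (hint w)).sub (integrable_const _))
        ((hpi.const_mul _).sub (integrable_const _)) fun y => ?_
      -- Shifting by log 2 puts the factor 1/2 in front of the exponential; this is what makes the
      -- sum over w below cancel exactly.
      have h := Real.add_one_le_exp (f y - L w y - Real.log 2)
      rw [Real.exp_sub _ (Real.log 2), Real.exp_log two_pos] at h
      simp only
      linarith
    have hfL : Integrable (fun y => f y - L w y) (p w) := hfi.sub (hint w)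
    rw [integral_sub hfL (integrable_const _), integral_sub hfi (hint w),
      integral_sub (hpi.const_mul _) (integrable_const _), integral_const_mul, hpe, hf] at hmono
    simp only [integral_const, probReal_univ, one_smul] at hmono
    have : 0 ≤ Q.real (D w) := measureReal_nonneg
    linarith
  -- Since the Q-masses of the disjoint regions add up to at most 1, the right-hand sides sum to at
  -- most ½(M + M) - M = 0.
  have hsum := Finset.sum_le_sum fun w (_ : w ∈ Finset.univ) => key w
  rw [Finset.sum_sub_distrib, Finset.sum_sub_distrib, Finset.sum_sub_distrib, ← Finset.sum_mul,
    ← Finset.mul_sum, Finset.sum_add_distrib, ← Finset.sum_mul] at hsum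
  simp only [Finset.sum_const, Finset.card_univ, nsmul_eq_mul, mul_one, ← hM] at hsum
  have := mul_le_mul_of_nonneg_right hQ hM0.le
  linarith

/-- The change-of-measure bound for memoryless channels. -/
lemma block_converse {W Y : Type*} [Fintype W] [Nonempty W] [MeasurableSpace Y] {n : ℕ}
    {q : Fin n → Measure Y} [∀ t, IsProbabilityMeasure (q t)] {p : W → Fin n → Measure Y}
    [∀ w t, IsProbabilityMeasure (p w t)] {L : W → Fin n → Y → ℝ}
    (hL : ∀ w t, Measurable (L w t))
    (hp : ∀ w t, p w t = (q t).withDensity fun y => ENNReal.ofReal (Real.exp (L w t y)))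
    (hint : ∀ w t, Integrable (L w t) (p w t)) {D : W → Set (Fin n → Y)}
    (hD : ∀ w, MeasurableSet (D w)) (hdisj : Pairwise (Function.onFun Disjoint D)) :
    (∑ w, (Measure.pi (p w)).real (D w)) * Real.log (Fintype.card W)
      ≤ ∑ w, ∑ t, ∫ y, L w t y ∂(p w t) + Fintype.card W * Real.log 2 := by
  have hint' : ∀ w t, Integrable (fun y : Fin n → Y => L w t (y t)) (Measure.pi (p w)) :=
    fun w t => integrable_comp_eval (hint w t)
  have h := one_shot_converse (Q := Measure.pi q) (p := fun w => Measure.pi (p w))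
    (L := fun w y => ∑ t, L w t (y t))
    (fun w => Finset.measurable_sum _ fun t _ => (hL w t).comp (measurable_pi_apply t))
    (fun w => by
      rw [pi_eq_withDensity_prod (fun t => (hL w t).exp.ennreal_ofReal) (hp w)]
      congr 1
      ext y
      rw [Real.exp_sum, ENNReal.ofReal_prod_of_nonneg fun _ _ => (Real.exp_pos _).le])
    (fun w => integrable_finsetSum _ fun t _ => hint' w t) hD hdisj
  refine h.trans_eq ?_
  congr 1
  refine Finset.sum_congr rfl fun w _ => ?_
  rw [integral_finsetSum _ fun t _ => hint' w t]
  exact Finset.sum_congr rfl fun t _ => integral_comp_eval (hint w t).aestronglyMeasurable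

/-! ### Sums, empirical power and divergence of Gaussian vectors -/

lemma map_add_pi_gaussianReal {ι : Type*} [Fintype ι] (v w : ℝ≥0) :
    ((Measure.pi fun _ : ι => gaussianReal 0 v).prod (Measure.pi fun _ : ι => gaussianReal 0 w)).map
      (fun p => p.1 + p.2) = Measure.pi fun _ : ι => gaussianReal 0 (v + w) := by
  rw [← (measurePreserving_arrowProdEquivProdArrow ℝ ℝ ι (fun _ => gaussianReal 0 v)
    (fun _ => gaussianReal 0 w)).map_eq, Measure.map_map (by fun_prop)
    (MeasurableEquiv.measurable _)]
  have h : ((fun p : (ι → ℝ) × (ι → ℝ) => p.1 + p.2) ∘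
      (MeasurableEquiv.arrowProdEquivProdArrow ℝ ℝ ι)) = fun x i => (x i).1 + (x i).2 := rfl
  have h2 : ((gaussianReal 0 v).prod (gaussianReal 0 w)).map (fun p => p.1 + p.2)
      = gaussianReal 0 (v + w) := by
    simpa [Measure.conv] using gaussianReal_conv_gaussianReal (m₁ := 0) (m₂ := 0) (v₁ := v) (v₂ := w)
  rw [h, Measure.pi_map_pi (f := fun (_ : ι) (p : ℝ × ℝ) => p.1 + p.2) (fun i => by fun_prop)]
  simp_rw [h2]

/-- Chebyshev's inequality for the sum of the squared coordinates: a Gaussian has a fourth moment,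
so the variance of the sum grows only linearly in n. -/
lemma tendsto_pi_gaussianReal_sum_sq (v : ℝ≥0) {ε : ℝ} (hε : 0 < ε) :
    Tendsto (fun n : ℕ => (Measure.pi fun _ : Fin n => gaussianReal 0 v).real
      {x | n * ε ≤ |∑ t, x t ^ 2 - n * v|}) atTop (𝓝 0) := by
  have hsq : MemLp (fun x : ℝ => x ^ 2) 2 (gaussianReal 0 v) := by
    have h4 := memLp_id_gaussian 0 v 4
    rw [memLp_two_iff_integrable_sq (by fun_prop)]
    have := h4.integrable_norm_rpow (by norm_num) (by norm_num)
    refine this.congr (ae_of_all _ fun x => ?_)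
    simp only [ENNReal.coe_ofNat, ENNReal.toReal_ofNat]
    rw [show (4 : ℝ) = ((4 : ℕ) : ℝ) by norm_num, Real.rpow_natCast, Real.norm_eq_abs]
    rw [show |x| ^ 4 = (|x| ^ 2) ^ 2 by ring, sq_abs]
  set K := Var[fun x : ℝ => x ^ 2; gaussianReal 0 v] with hK
  have hb : ∀ n : ℕ, 0 < n → (Measure.pi fun _ : Fin n => gaussianReal 0 v).real
      {x | n * ε ≤ |∑ t, x t ^ 2 - n * v|} ≤ K / ε ^ 2 / n := by
    intro n hn
    have hn' : (0 : ℝ) < n := by exact_mod_cast hn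
    set X : (Fin n → ℝ) → ℝ := ∑ t, fun x => x t ^ 2 with hX
    have hXa : ∀ x, X x = ∑ t, x t ^ 2 := fun x => by simp [hX]
    have hmem : MemLp X 2 (Measure.pi fun _ : Fin n => gaussianReal 0 v) :=
      memLp_finsetSum' _ fun t _ =>
        hsq.comp_measurePreserving (measurePreserving_eval (fun _ : Fin n => gaussianReal 0 v) t)
    have hmean : ∫ x, X x ∂(Measure.pi fun _ : Fin n => gaussianReal 0 v) = n * v := by
      simp_rw [hXa]
      have hi : Integrable (fun y : ℝ => y ^ 2) (gaussianReal 0 v) := by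
        simpa using integrable_sub_sq_gaussian 0 0 v
      rw [integral_finsetSum _ fun t _ =>
        integrable_comp_eval (μ := fun _ : Fin n => gaussianReal 0 v) (f := fun y => y ^ 2) hi]
      have : ∀ t : Fin n, ∫ x : Fin n → ℝ, x t ^ 2 ∂(Measure.pi fun _ : Fin n => gaussianReal 0 v)
          = v := fun t => by
        rw [integral_comp_eval (μ := fun _ : Fin n => gaussianReal 0 v) (f := fun y => y ^ 2)
          hi.aestronglyMeasurable]
        simpa using integral_sub_sq_gaussian 0 0 v
      simp [this]
    have hvar : Var[X; Measure.pi fun _ : Fin n => gaussianReal 0 v] = n * K := by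
      rw [hX, variance_sum_pi (X := fun _ x => x ^ 2) fun _ => hsq]
      simp [hK]
    have h := meas_ge_le_variance_div_sq hmem (mul_pos hn' hε)
    rw [hmean, hvar] at h
    simp_rw [hXa] at h
    rw [measureReal_def]
    refine (ENNReal.toReal_mono ENNReal.ofReal_ne_top h).trans ?_
    rw [ENNReal.toReal_ofReal (div_nonneg (mul_nonneg hn'.le (variance_nonneg _ _)) (by positivity))]
    rw [hK]
    apply le_of_eq
    field_simp
  refine squeeze_zero' (Eventually.of_forall fun n => measureReal_nonneg)
    ((eventually_gt_atTop 0).mono hb) ?_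
  exact tendsto_const_nhds.div_atTop tendsto_natCast_atTop_atTop

/-- This is the Kullback–Leibler divergence, in nats, between two Gaussians. It is affine in (c -
μ)², so its average over messages depends only on a variance. -/
lemma integral_gaussianLLR (c μ : ℝ) {v w : ℝ≥0} (hv : v ≠ 0) :
    ∫ y, gaussianLLR c v μ w y ∂gaussianReal c v
      = 1 / 2 * Real.log (w / v) - 1 / 2 + (v + (c - μ) ^ 2) / (2 * w) := by
  have hv' : (v : ℝ) ≠ 0 := by exact_mod_cast hv
  have h1 := (integrable_sub_sq_gaussian c c v).div_const (2 * (v : ℝ))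
  have h2 := (integrable_sub_sq_gaussian c μ v).div_const (2 * (w : ℝ))
  have h3 : Integrable (fun y => 1 / 2 * Real.log (w / v) - (y - c) ^ 2 / (2 * (v : ℝ)))
    (gaussianReal c v) := (integrable_const _).sub h1
  unfold gaussianLLR
  rw [integral_add h3 h2, integral_sub (integrable_const _) h1, integral_div, integral_div,
    integral_sub_sq_gaussian, integral_sub_sq_gaussian]
  simp only [integral_const, probReal_univ, one_smul, sub_self]
  congr 2
  field_simp
  ring

/-! ### Averages and variances over uniform messages -/

section Average

variable {ι κ : Type} [Fintype ι] [Fintype κ]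

lemma average_add (f g : ι → ℝ) : average (fun i => f i + g i) = average f + average g := by
  simp [average, Finset.sum_add_distrib, add_div]

lemma average_sub (f g : ι → ℝ) : average (fun i => f i - g i) = average f - average g := by
  simp [average, Finset.sum_sub_distrib, sub_div]

lemma average_const_mul (k : ℝ) (f : ι → ℝ) : average (fun i => k * f i) = k * average f := by
  simp only [average, ← Finset.mul_sum, mul_div_assoc]

lemma average_const [Nonempty ι] (k : ℝ) : average (fun _ : ι => k) = k := by
  simp [average]

lemma average_mono {f g : ι → ℝ} (h : ∀ i, f i ≤ g i) : average f ≤ average g :=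
  div_le_div_of_nonneg_right (Finset.sum_le_sum fun i _ => h i) (Nat.cast_nonneg _)

lemma average_nonneg {f : ι → ℝ} (h : ∀ i, 0 ≤ f i) : 0 ≤ average f :=
  div_nonneg (Finset.sum_nonneg fun i _ => h i) (Nat.cast_nonneg _)

lemma average_sum {T : Type*} (s : Finset T) (f : T → ι → ℝ) :
    average (fun i => ∑ t ∈ s, f t i) = ∑ t ∈ s, average (f t) := by
  simp only [average]
  rw [Finset.sum_comm, Finset.sum_div]

lemma average_equiv (e : ι ≃ κ) (f : κ → ℝ) : average (fun i => f (e i)) = average f := by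
  simp only [average, Fintype.card_congr e, e.sum_comp]

lemma average_mul_prod (f : ι → ℝ) (g : κ → ℝ) :
    average (fun p : ι × κ => f p.1 * g p.2) = average f * average g := by
  simp only [average, Fintype.card_prod, Fintype.sum_prod_type, Nat.cast_mul]
  rw [div_mul_div_comm, Finset.sum_mul_sum]

lemma average_fst [Nonempty κ] (f : ι → ℝ) : average (fun p : ι × κ => f p.1) = average f := by
  simpa [average_const] using average_mul_prod f fun _ : κ => 1

lemma average_snd [Nonempty ι] (g : κ → ℝ) : average (fun p : ι × κ => g p.2) = average g := by
  simpa [average_const] using average_mul_prod (fun _ : ι => 1) g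

/-- The variance of a function of a uniformly distributed variable. -/
def averageVar (f : ι → ℝ) : ℝ := average (fun i => (f i - average f) ^ 2)

lemma averageVar_eq [Nonempty ι] (f : ι → ℝ) :
    averageVar f = average (fun i => f i ^ 2) - average f ^ 2 := by
  have h : ∀ i, (f i - average f) ^ 2 = f i ^ 2 - 2 * average f * f i + average f ^ 2 := by
    intro i; ring
  rw [averageVar, funext h, average_add, average_sub, average_const_mul, average_const]
  ring

lemma averageVar_le [Nonempty ι] (f : ι → ℝ) : averageVar f ≤ average (fun i => f i ^ 2) := by
  rw [averageVar_eq]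
  linarith [sq_nonneg (average f)]

lemma averageVar_equiv (e : ι ≃ κ) (f : κ → ℝ) : averageVar (fun i => f (e i)) = averageVar f := by
  rw [averageVar, average_equiv e f, averageVar, ← average_equiv e fun k => (f k - average f) ^ 2]

lemma averageVar_const_mul (k : ℝ) (f : ι → ℝ) :
    averageVar (fun i => k * f i) = k ^ 2 * averageVar f := by
  rw [averageVar, averageVar, ← average_const_mul]
  congr 1
  ext i
  rw [average_const_mul]
  ring

/-- Messages of different transmitters are independent, so variances add. Second moments would leave
a cross term from the means, which is why the converses centre the reference law at the mean signal.
-/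
lemma averageVar_add_prod [Nonempty ι] [Nonempty κ] (f : ι → ℝ) (g : κ → ℝ) :
    averageVar (fun p : ι × κ => f p.1 + g p.2) = averageVar f + averageVar g := by
  have h : ∀ p : ι × κ, (f p.1 + g p.2) ^ 2 = f p.1 ^ 2 + 2 * (f p.1 * g p.2) + g p.2 ^ 2 := by
    intro p; ring
  rw [averageVar_eq, averageVar_eq, averageVar_eq, funext h, average_add, average_add, average_add,
    average_const_mul, average_mul_prod, average_fst f, average_snd g,
    average_fst fun i => f i ^ 2, average_snd fun i => g i ^ 2]
  ring

end Average

/-! ### Message counts, power constraints and the converse without side information -/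

lemma msgCount_pos (n : ℕ) (r : ℝ) : 0 < msgCount n r :=
  Nat.ceil_pos.2 (Real.rpow_pos_of_pos two_pos _)

instance (n : ℕ) (r : ℝ) : NeZero (msgCount n r) := ⟨(msgCount_pos n r).ne'⟩

lemma le_log_msgCount (n : ℕ) (r : ℝ) : n * r * Real.log 2 ≤ Real.log (msgCount n r) := by
  rw [← Real.log_rpow two_pos]
  exact Real.log_le_log (Real.rpow_pos_of_pos two_pos _) (Nat.le_ceil _)

lemma msgCount_zero (n : ℕ) : msgCount n 0 = 1 := by simp [msgCount]

/-- The messages, grouped by transmitter. -/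
def messagesEquiv (n : ℕ) (R : RateVector) : Messages n R ≃
    Fin (msgCount n (R w11)) × (Fin (msgCount n (R w12)) × Fin (msgCount n (R w22))) ×
      (Fin (msgCount n (R w13)) × Fin (msgCount n (R w33))) where
  toFun m := (m w11, (m w12, m w22), (m w13, m w33))
  invFun p := fun
    | w11 => p.1
    | w12 => p.2.1.1
    | w22 => p.2.1.2
    | w13 => p.2.2.1
    | w33 => p.2.2.2
  left_inv m := by ext w; cases w <;> rfl
  right_inv p := rfl

lemma le_log_card_messages (n : ℕ) (R : RateVector) :
    n * sumRate R * Real.log 2 ≤ Real.log (Fintype.card (Messages n R)) := by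
  have h : ∀ r, (msgCount n r : ℝ) ≠ 0 := fun r => by exact_mod_cast (msgCount_pos n r).ne'
  rw [Fintype.card_congr (messagesEquiv n R)]
  simp only [Fintype.card_prod, Fintype.card_fin, Nat.cast_mul]
  rw [Real.log_mul (h _) (by simp [h]), Real.log_mul (by simp [h]) (by simp [h]),
    Real.log_mul (h _) (h _), Real.log_mul (h _) (h _)]
  have := le_log_msgCount n (R w11)
  have := le_log_msgCount n (R w12)
  have := le_log_msgCount n (R w13)
  have := le_log_msgCount n (R w22)
  have := le_log_msgCount n (R w33)
  simp only [sumRate]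
  linarith

namespace Code

variable {Y : Type} [MeasurableSpace Y] {P : Fin 3 → ℝ≥0} {n : ℕ} {R : RateVector}

/-- Independence of the messages of different transmitters bounds the variance of a linear
combination of the transmitted symbols. -/
lemma sum_averageVar_le (c : Code Y P n R) (k : Fin 3 → ℝ) :
    ∑ t, averageVar (fun m => k 0 * c.sent m t 0 + k 1 * c.sent m t 1 + k 2 * c.sent m t 2)
      ≤ n * (k 0 ^ 2 * P 0 + k 1 ^ 2 * P 1 + k 2 ^ 2 * P 2) := by
  have hsplit : ∀ t,
      averageVar (fun m => k 0 * c.sent m t 0 + k 1 * c.sent m t 1 + k 2 * c.sent m t 2)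
      ≤ k 0 ^ 2 * average (fun i => c.enc1 i t ^ 2)
        + k 1 ^ 2 * average (fun i : _ × _ => c.enc2 i.1 i.2 t ^ 2)
        + k 2 ^ 2 * average (fun i : _ × _ => c.enc3 i.1 i.2 t ^ 2) := by
    intro t
    have h1 := averageVar_equiv (messagesEquiv n R) fun p =>
      k 0 * c.enc1 p.1 t + (k 1 * c.enc2 p.2.1.1 p.2.1.2 t + k 2 * c.enc3 p.2.2.1 p.2.2.2 t)
    have h2 : (fun m : Messages n R =>
        k 0 * c.sent m t 0 + k 1 * c.sent m t 1 + k 2 * c.sent m t 2)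
        = fun m => k 0 * c.enc1 (messagesEquiv n R m).1 t
          + (k 1 * c.enc2 (messagesEquiv n R m).2.1.1 (messagesEquiv n R m).2.1.2 t
          + k 2 * c.enc3 (messagesEquiv n R m).2.2.1 (messagesEquiv n R m).2.2.2 t) := by
      ext m
      rw [← add_assoc]
      rfl
    rw [h2, h1,
      averageVar_add_prod (fun i => k 0 * c.enc1 i t) fun q : (_ × _) × (_ × _) =>
        k 1 * c.enc2 q.1.1 q.1.2 t + k 2 * c.enc3 q.2.1 q.2.2 t,
      averageVar_add_prod (fun i : _ × _ => k 1 * c.enc2 i.1 i.2 t)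
        fun i : _ × _ => k 2 * c.enc3 i.1 i.2 t, averageVar_const_mul, averageVar_const_mul,
      averageVar_const_mul, ← add_assoc]
    gcongr <;> exact averageVar_le _
  refine (Finset.sum_le_sum fun t _ => hsplit t).trans ?_
  rw [Finset.sum_add_distrib, Finset.sum_add_distrib, ← Finset.mul_sum, ← Finset.mul_sum,
    ← Finset.mul_sum, ← average_sum, ← average_sum, ← average_sum]
  have h1 := average_mono c.power1
  have h2 := average_mono fun i : _ × _ => c.power2 i.1 i.2
  have h3 := average_mono fun i : _ × _ => c.power3 i.1 i.2
  rw [average_const] at h1 h2 h3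
  calc _ ≤ k 0 ^ 2 * (n * P 0) + k 1 ^ 2 * (n * P 1) + k 2 ^ 2 * (n * (P 2 : ℝ)) := by gcongr
    _ = _ := by ring

end Code

/-- Turns block-length-n bounds into a bound on rates: divide by n and let n tend to infinity. -/
lemma le_of_forall_one_sub_mul_le {ε : ℕ → ℝ} (hε : Tendsto ε atTop (𝓝 0)) {s B K : ℝ}
    (h : ∀ n : ℕ, (1 - ε n) * (n * s) ≤ n * B + K) : s ≤ B := by
  have h1 : Tendsto (fun n => (1 - ε n) * s) atTop (𝓝 ((1 - 0) * s)) :=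
    (tendsto_const_nhds.sub hε).mul_const s
  have h2 : Tendsto (fun n : ℕ => B + K / n) atTop (𝓝 (B + 0)) :=
    tendsto_const_nhds.add (tendsto_const_nhds.div_atTop tendsto_natCast_atTop_atTop)
  rw [sub_zero, one_mul] at h1
  rw [add_zero] at h2
  refine le_of_tendsto_of_tendsto h1 h2 ((eventually_gt_atTop 0).mono fun n hn => ?_)
  have hn' : (0 : ℝ) < n := by exact_mod_cast hn
  have := h n
  have h3 : (1 - ε n) * s = (1 - ε n) * (n * s) / n := by field_simp
  have h4 : B + K / n = (n * B + K) / n := by field_simp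
  simp only [h3, h4]
  exact div_le_div_of_nonneg_right this hn'.le

/-- The power received by receiver 1. -/
def receivedPower (a b : ℝ) (P : Fin 3 → ℝ≥0) : ℝ := P 0 + a ^ 2 * P 1 + b ^ 2 * P 2

lemma receivedPower_nonneg (a b : ℝ) (P : Fin 3 → ℝ≥0) : 0 ≤ receivedPower a b P := by
  unfold receivedPower; positivity

lemma pi_gaussianReal_const_add {n : ℕ} (v : ℝ≥0) (c : Fin n → ℝ) {S : Set (Fin n → ℝ)}
    (hS : MeasurableSet S) :
    (Measure.pi fun _ : Fin n => gaussianReal 0 v).real {z | (fun t => c t + z t) ∈ S}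
      = (Measure.pi fun t => gaussianReal (c t) v).real S := by
  have h : Measure.pi (fun t => gaussianReal (c t) v)
      = (Measure.pi fun _ : Fin n => gaussianReal 0 v).map fun z t => c t + z t := by
    have h0 : ∀ t, IsProbabilityMeasure ((gaussianReal 0 v).map fun x => c t + x) := fun t =>
      Measure.isProbabilityMeasure_map (by fun_prop)
    rw [Measure.pi_map_pi (f := fun t x => c t + x) fun t => by fun_prop]
    simp [gaussianReal_map_const_add]
  rw [h, map_measureReal_apply (by fun_prop) hS]
  rfl

instance (a b : ℝ) : IsProbabilityMeasure (plainReceiver a b).noise :=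
  inferInstanceAs (IsProbabilityMeasure (gaussianReal 0 1))

/-- The outputs are compared with Gaussians of the largest admissible variance v, centred in each
channel use at the mean signal. A non-optimal reference only increases the divergence, so no entropy
maximization is needed. -/
lemma plain_converse {a b : ℝ} {P : Fin 3 → ℝ≥0} {n : ℕ} {r : Fin 3 → ℝ}
    (c : Code ℝ P n (macRates r)) :
    (1 - c.error1 (plainReceiver a b)) * (n * ((r 0 + r 1 + r 2) * Real.log 2))
      ≤ n * (1 / 2 * Real.log (1 + receivedPower a b P)) + Real.log 2 := by
  set W := Messages n (macRates r)
  set v : ℝ≥0 := ⟨1 + receivedPower a b P, by linarith [receivedPower_nonneg a b P]⟩ with hv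
  have hv1 : (v : ℝ) = 1 + receivedPower a b P := rfl
  have hv0 : v ≠ 0 := by
    intro h
    have : (v : ℝ) = 0 := by simp [h]
    linarith [receivedPower_nonneg a b P]
  have hvp : (0 : ℝ) < v := by exact_mod_cast pos_iff_ne_zero.2 hv0
  set x : W → Fin n → ℝ := fun m t => c.sent m t 0 + a * c.sent m t 1 + b * c.sent m t 2 with hx
  set μ : Fin n → ℝ := fun t => average fun m => x m t with hμ
  set D : W → Set (Fin n → ℝ) := fun m => {y | c.dec1 y = (m w11, m w12, m w13)} with hD
  have hDm : ∀ m, MeasurableSet (D m) := fun m => c.measurable_dec1 (measurableSet_singleton _)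
  -- At rate 0 there is exactly one message, so the three messages decoded by receiver 1 determine
  -- all five and the decoding regions are disjoint.
  have hsub : ∀ i j : Fin (msgCount n 0), i = j := fun i j => by
    have := msgCount_zero n
    have := i.2
    have := j.2
    ext; omega
  have hdisj : Pairwise (Function.onFun Disjoint D) := by
    intro m m' hmm
    refine Set.disjoint_left.2 fun y hy hy' => hmm ?_
    have h := hy.symm.trans hy'
    simp only [Prod.mk.injEq] at h
    funext w
    cases w
    · exact h.1
    · exact h.2.1
    · exact h.2.2
    · exact hsub _ _
    · exact hsub _ _
  have hcore := block_converse (q := fun t => gaussianReal (μ t) v)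
    (p := fun m t => gaussianReal (x m t) 1) (L := fun m t => gaussianLLR (x m t) 1 (μ t) v)
    (fun m t => measurable_gaussianLLR _ _ _ _)
    (fun m t => gaussianReal_eq_withDensity _ _ one_ne_zero hv0)
    (fun m t => integrable_gaussianLLR _ _ _ _ _ _) hDm hdisj
  have hcard : (0 : ℝ) < Fintype.card W := by exact_mod_cast Fintype.card_pos
  have herr : 1 - c.error1 (plainReceiver a b)
      = average fun m => (Measure.pi fun t => gaussianReal (x m t) 1).real (D m) := by
    rw [Code.error1, ← average_const (ι := W) 1, ← average_sub]
    congr 1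
    ext m
    have h := pi_gaussianReal_const_add 1 (x m) (hDm m)
    rw [← h, ← probReal_compl_eq_one_sub]
    · congr 1
      ext z
      simp [hD, plainReceiver, hx]
    · refine (c.measurable_dec1.comp ?_) (measurableSet_singleton _).compl
      refine measurable_pi_lambda _ fun t => ?_
      simp only [plainReceiver]
      fun_prop
  have hnn : 0 ≤ 1 - c.error1 (plainReceiver a b) := by
    rw [herr]; exact average_nonneg fun _ => measureReal_nonneg
  have hvar : ∑ t, averageVar (fun m => x m t) ≤ n * receivedPower a b P := by
    simpa [hx, receivedPower] using c.sum_averageVar_le ![1, a, b]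
  have hdiv : average (fun m => ∑ t, ∫ y, gaussianLLR (x m t) 1 (μ t) v y ∂gaussianReal (x m t) 1)
      ≤ n * (1 / 2 * Real.log v) := by
    simp_rw [integral_gaussianLLR _ _ one_ne_zero]
    rw [average_sum]
    have : ∀ t, average (fun m => 1 / 2 * Real.log (v / (1 : ℝ≥0)) - 1 / 2
        + (((1 : ℝ≥0) : ℝ) + (x m t - μ t) ^ 2) / (2 * v))
        = 1 / 2 * Real.log v - 1 / 2 + 1 / (2 * v) + 1 / (2 * v) * averageVar (fun m => x m t) := by
      intro t
      rw [averageVar, ← average_const_mul, ← average_const (ι := W) (1 / 2 * Real.log v - 1 / 2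
        + 1 / (2 * v)), ← average_add]
      congr 1
      ext m
      simp only [NNReal.coe_one, div_one, hμ]
      ring
    simp_rw [this]
    rw [Finset.sum_add_distrib, ← Finset.mul_sum]
    have h3 : 1 / (2 * (v : ℝ)) * ∑ t, averageVar (fun m => x m t)
        ≤ 1 / (2 * (v : ℝ)) * (n * receivedPower a b P) := by gcongr
    -- With total signal variance n (v - 1), the quadratic terms of the divergence add up to n/2 and
    -- cancel the constant -n/2.
    have h4 : n * (1 / (2 * (v : ℝ))) + 1 / (2 * (v : ℝ)) * (n * receivedPower a b P) = n * (1 / 2) := by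
      rw [show receivedPower a b P = v - 1 by rw [hv1]; ring]
      field_simp
      ring
    simp only [Finset.sum_const, Finset.card_univ, Fintype.card_fin, nsmul_eq_mul]
    linarith
  have hcore' : (1 - c.error1 (plainReceiver a b)) * Real.log (Fintype.card W)
      ≤ n * (1 / 2 * Real.log v) + Real.log 2 := by
    rw [herr]
    refine le_trans ?_ (add_le_add_left hdiv _)
    simp only [average]
    rw [div_mul_eq_mul_div, div_add' _ _ _ hcard.ne', div_le_div_iff_of_pos_right hcard]
    linarith
  refine le_trans (mul_le_mul_of_nonneg_left ?_ hnn) hcore'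
  have := le_log_card_messages n (macRates r)
  simp only [sumRate, macRates, add_zero] at this
  linarith

/-! ### Output law of the genie-aided receiver -/

/-- The law of `(y, y + r)` for independent `y ∼ 𝒩(μ, v)` and `r ∼ 𝒩(ν, w)`. -/
def genieReference (μ ν : ℝ) (v w : ℝ≥0) : Measure (ℝ × ℝ) :=
  ((gaussianReal μ v).prod (gaussianReal ν w)).map fun p => (p.1, p.1 + p.2)

instance (μ ν : ℝ) (v w : ℝ≥0) : IsProbabilityMeasure (genieReference μ ν v w) :=
  Measure.isProbabilityMeasure_map (by fun_prop)

instance (ρ : ℝ) : IsProbabilityMeasure (correlatedNoise ρ) :=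
  Measure.isProbabilityMeasure_map (by fun_prop)

instance (a b η ρ : ℝ) : IsProbabilityMeasure (genieReceiver a b η ρ).noise :=
  inferInstanceAs (IsProbabilityMeasure (correlatedNoise ρ))

/-- The law of the genie-aided output with signals `α` and `β`. -/
def genieLaw (η ρ α β : ℝ) : Measure (ℝ × ℝ) :=
  (correlatedNoise ρ).map fun z => (α + z.1, β + η * z.2)

instance (η ρ α β : ℝ) : IsProbabilityMeasure (genieLaw η ρ α β) :=
  Measure.isProbabilityMeasure_map (by fun_prop)

/-- The log-likelihood ratio of `genieLaw η ρ α β` against `genieReference μ ν v w`, where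
`τ = η² (1 - ρ²)`. -/
def genieLLR (η ρ α β : ℝ) (τ : ℝ≥0) (μ ν : ℝ) (v w : ℝ≥0) (p : ℝ × ℝ) : ℝ :=
  gaussianLLR α 1 μ v p.1 + gaussianLLR (β + η * ρ * (p.1 - α)) τ (p.1 + ν) w p.2

lemma measurable_genieLLR (η ρ α β : ℝ) (τ : ℝ≥0) (μ ν : ℝ) (v w : ℝ≥0) :
    Measurable (genieLLR η ρ α β τ μ ν v w) := by
  unfold genieLLR gaussianLLR; fun_prop

lemma genieLaw_eq_map (η ρ α β : ℝ) : genieLaw η ρ α β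
    = ((gaussianReal 0 1).prod (gaussianReal 0 1)).map fun p =>
      (α + p.1, β + η * (ρ * p.1 + √(1 - ρ ^ 2) * p.2)) := by
  rw [genieLaw, correlatedNoise, Measure.map_map (by fun_prop) (by fun_prop)]
  rfl

lemma map_const_add_mul_gaussianReal (c k : ℝ) {τ : ℝ≥0} (hτ : (τ : ℝ) = k ^ 2) :
    (gaussianReal 0 1).map (fun z => c + k * z) = gaussianReal c τ := by
  have h : (fun z : ℝ => c + k * z) = (fun z => c + z) ∘ fun z => k * z := rfl
  rw [h, ← Measure.map_map (by fun_prop) (by fun_prop), gaussianReal_map_const_mul,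
    gaussianReal_map_const_add]
  congr 1
  · ring
  · ext; simp [hτ]

/-- Both laws are disintegrated along the first coordinate y. Under `genieLaw`, y is 𝒩(α, 1) and the
second coordinate given y is 𝒩(β + ηρ(y - α), τ); under the reference they are 𝒩(μ, v) and 𝒩(y + ν,
w). The density is the product of the marginal and the conditional likelihood ratios. -/
lemma genieLaw_eq_withDensity {η ρ : ℝ} (hρ : ρ ^ 2 < 1) {τ : ℝ≥0} (hτ0 : τ ≠ 0)
    (hτ : (τ : ℝ) = η ^ 2 * (1 - ρ ^ 2)) (α β μ ν : ℝ) {v w : ℝ≥0} (hv : v ≠ 0) (hw : w ≠ 0) :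
    genieLaw η ρ α β = (genieReference μ ν v w).withDensity
      fun p => ENNReal.ofReal (Real.exp (genieLLR η ρ α β τ μ ν v w p)) := by
  have hgm := (measurable_genieLLR η ρ α β τ μ ν v w).exp.ennreal_ofReal
  have hk : (τ : ℝ) = (η * √(1 - ρ ^ 2)) ^ 2 := by
    rw [mul_pow, Real.sq_sqrt (by linarith), hτ]
  refine Measure.ext_of_lintegral _ fun F hF => ?_
  have e1 : ∫⁻ p, F p ∂genieLaw η ρ α β = ∫⁻ x, ∫⁻ z,
      F (α + x, β + η * (ρ * x + √(1 - ρ ^ 2) * z)) ∂gaussianReal 0 1 ∂gaussianReal 0 1 := by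
    rw [genieLaw_eq_map, lintegral_map hF (by fun_prop), lintegral_prod _ (by fun_prop)]
  -- The conditional expectation of F given that the first coordinate is y.
  set H : ℝ → ℝ≥0∞ := fun y => ∫⁻ s, F (y, s) ∂gaussianReal (β + η * ρ * (y - α)) τ with hH
  have hHz : ∀ y, H y = ∫⁻ z, F (y, β + η * ρ * (y - α) + η * √(1 - ρ ^ 2) * z)
      ∂gaussianReal 0 1 := by
    intro y
    simp only [hH]
    rw [← map_const_add_mul_gaussianReal _ _ hk, lintegral_map (by fun_prop) (by fun_prop)]
  have hHm : Measurable H := by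
    rw [funext hHz]
    refine Measurable.lintegral_prod_right' (f := fun p : ℝ × ℝ =>
      F (p.1, β + η * ρ * (p.1 - α) + η * √(1 - ρ ^ 2) * p.2)) ?_
    fun_prop
  have e2 : ∀ x, ∫⁻ z, F (α + x, β + η * (ρ * x + √(1 - ρ ^ 2) * z)) ∂gaussianReal 0 1
      = H (α + x) := by
    intro x
    rw [hHz]
    refine lintegral_congr fun z => ?_
    congr 2
    ring
  have e3 : ∫⁻ x, H (α + x) ∂gaussianReal 0 1 = ∫⁻ y, H y ∂gaussianReal α 1 := by
    have h := gaussianReal_map_const_add (μ := 0) (v := 1) α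
    rw [zero_add] at h
    rw [← h, lintegral_map hHm (by fun_prop)]
  have e4 : ∀ y, H y = ∫⁻ r, ENNReal.ofReal (Real.exp
      (gaussianLLR (β + η * ρ * (y - α)) τ (y + ν) w (y + r))) * F (y, y + r)
      ∂gaussianReal ν w := by
    intro y
    have hm := (measurable_gaussianLLR (β + η * ρ * (y - α)) τ (y + ν) w).exp.ennreal_ofReal
    simp only [hH]
    rw [gaussianReal_eq_withDensity _ (y + ν) hτ0 hw,
      lintegral_withDensity_eq_lintegral_mul _ hm (by fun_prop)]
    have h := gaussianReal_map_const_add (μ := ν) (v := w) y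
    rw [add_comm y ν, ← h, lintegral_map (by fun_prop) (by fun_prop)]
    simp [Pi.mul_apply]
  rw [e1]
  simp_rw [e2]
  rw [e3, gaussianReal_eq_withDensity α μ one_ne_zero hv, lintegral_withDensity_eq_lintegral_mul _
    (measurable_gaussianLLR α 1 μ v).exp.ennreal_ofReal hHm,
    lintegral_withDensity_eq_lintegral_mul _ hgm hF, genieReference,
    lintegral_map (by fun_prop) (by fun_prop), lintegral_prod _ (by fun_prop)]
  refine lintegral_congr fun y => ?_
  rw [Pi.mul_apply, e4, ← lintegral_const_mul]
  · refine lintegral_congr fun r => ?_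
    rw [Pi.mul_apply, genieLLR, Real.exp_add, ENNReal.ofReal_mul (Real.exp_pos _).le]
    simp only [mul_assoc]
  · have := (measurable_gaussianLLR (β + η * ρ * (y - α)) τ (y + ν) w)
    fun_prop

lemma map_linear_gaussian_prod (d e f : ℝ) {σ : ℝ≥0} (hσ : (σ : ℝ) = e ^ 2 + f ^ 2) :
    ((gaussianReal 0 1).prod (gaussianReal 0 1)).map (fun p => d + e * p.1 + f * p.2)
      = gaussianReal d σ := by
  have h1 : (fun p : ℝ × ℝ => d + e * p.1 + f * p.2)
      = (fun q : ℝ × ℝ => q.1 + q.2) ∘ Prod.map (fun x => d + e * x) (fun x => 0 + f * x) := by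
    ext p; simp
  obtain ⟨σ₁, h₁⟩ : ∃ σ : ℝ≥0, (σ : ℝ) = e ^ 2 := ⟨⟨_, sq_nonneg e⟩, rfl⟩
  obtain ⟨σ₂, h₂⟩ : ∃ σ : ℝ≥0, (σ : ℝ) = f ^ 2 := ⟨⟨_, sq_nonneg f⟩, rfl⟩
  rw [h1, ← Measure.map_map (by fun_prop) (by fun_prop),
    ← Measure.map_prod_map _ _ (by fun_prop) (by fun_prop),
    map_const_add_mul_gaussianReal d e h₁, map_const_add_mul_gaussianReal 0 f h₂]
  have h2 := gaussianReal_conv_gaussianReal (m₁ := d) (m₂ := 0) (v₁ := σ₁) (v₂ := σ₂)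
  rw [Measure.conv, add_zero] at h2
  rw [h2]
  congr 1
  ext
  rw [hσ, NNReal.coe_add, h₁, h₂]

lemma integrable_linear_sq_gaussian_prod (d e f : ℝ) :
    Integrable (fun p : ℝ × ℝ => (d + e * p.1 + f * p.2) ^ 2)
      ((gaussianReal 0 1).prod (gaussianReal 0 1)) := by
  obtain ⟨σ, hσ⟩ : ∃ σ : ℝ≥0, (σ : ℝ) = e ^ 2 + f ^ 2 := ⟨⟨_, by positivity⟩, rfl⟩
  have h := integrable_sub_sq_gaussian d 0 σ
  rw [← map_linear_gaussian_prod d e f hσ] at h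
  simpa [Function.comp_def] using h.comp_measurable (by fun_prop)

lemma integral_linear_sq_gaussian_prod (d e f : ℝ) :
    ∫ p : ℝ × ℝ, (d + e * p.1 + f * p.2) ^ 2 ∂(gaussianReal 0 1).prod (gaussianReal 0 1)
      = d ^ 2 + e ^ 2 + f ^ 2 := by
  obtain ⟨σ, hσ⟩ : ∃ σ : ℝ≥0, (σ : ℝ) = e ^ 2 + f ^ 2 := ⟨⟨_, by positivity⟩, rfl⟩
  have h := integral_sub_sq_gaussian d 0 σ
  rw [← map_linear_gaussian_prod d e f hσ, integral_map (by fun_prop) (by fun_prop)] at h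
  simp only [sub_zero] at h
  rw [h, hσ]
  ring

/-- Expressed in the two independent standard noises, every quadratic term is the square of an
affine form. The vanishing coefficients are kept so that all four have the shape `d + e * p.1 + f *
p.2` of the moment lemmas. -/
lemma genieLLR_comp (η ρ α β : ℝ) (τ : ℝ≥0) (μ ν : ℝ) (v w : ℝ≥0) (p : ℝ × ℝ) :
    genieLLR η ρ α β τ μ ν v w (α + p.1, β + η * (ρ * p.1 + √(1 - ρ ^ 2) * p.2))
      = (1 / 2 * Real.log v + 1 / 2 * Real.log (w / τ))
        - (0 + 1 * p.1 + 0 * p.2) ^ 2 / 2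
        + ((α - μ) + 1 * p.1 + 0 * p.2) ^ 2 / (2 * v)
        - (0 + 0 * p.1 + η * √(1 - ρ ^ 2) * p.2) ^ 2 / (2 * τ)
        + ((β - α - ν) + (η * ρ - 1) * p.1 + η * √(1 - ρ ^ 2) * p.2) ^ 2 / (2 * w) := by
  simp only [genieLLR, gaussianLLR, NNReal.coe_one, div_one]
  ring

lemma integrable_genieLLR (η ρ α β : ℝ) (τ : ℝ≥0) (μ ν : ℝ) (v w : ℝ≥0) :
    Integrable (genieLLR η ρ α β τ μ ν v w) (genieLaw η ρ α β) := by
  rw [genieLaw_eq_map, integrable_map_measure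
    (measurable_genieLLR _ _ _ _ _ _ _ _ _).aestronglyMeasurable (by fun_prop)]
  simp only [Function.comp_def, genieLLR_comp]
  exact ((((integrable_const _).sub ((integrable_linear_sq_gaussian_prod _ _ _).div_const _)).add
    ((integrable_linear_sq_gaussian_prod _ _ _).div_const _)).sub
    ((integrable_linear_sq_gaussian_prod _ _ _).div_const _)).add
    ((integrable_linear_sq_gaussian_prod _ _ _).div_const _)

/-- The divergence of the genie-aided output law from the reference. The signals enter only through
the deviations of α and of β - α from their reference means, which are the signal parts of y and of
s - y. -/
lemma integral_genieLLR {η ρ : ℝ} (hρ : ρ ^ 2 < 1) {τ : ℝ≥0} (hτ0 : τ ≠ 0)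
    (hτ : (τ : ℝ) = η ^ 2 * (1 - ρ ^ 2)) (α β μ ν : ℝ) {v w : ℝ≥0} (hv : v ≠ 0) (hw : w ≠ 0) :
    ∫ p, genieLLR η ρ α β τ μ ν v w p ∂genieLaw η ρ α β
      = 1 / 2 * Real.log (v * w / τ) - 1 + (1 + (α - μ) ^ 2) / (2 * v)
        + (η ^ 2 - 2 * (η * ρ) + 1 + (β - α - ν) ^ 2) / (2 * w) := by
  have hτp : (τ : ℝ) ≠ 0 := by exact_mod_cast hτ0
  have hvp : (v : ℝ) ≠ 0 := by exact_mod_cast hv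
  have hwp : (w : ℝ) ≠ 0 := by exact_mod_cast hw
  have hI := fun d e f k => (integrable_linear_sq_gaussian_prod d e f).div_const k
  have hk : (η * √(1 - ρ ^ 2)) ^ 2 = τ := by
    rw [mul_pow, Real.sq_sqrt (by linarith), hτ]
  rw [genieLaw_eq_map, integral_map (by fun_prop)
    (measurable_genieLLR _ _ _ _ _ _ _ _ _).aestronglyMeasurable]
  simp only [genieLLR_comp]
  rw [integral_add, integral_sub, integral_add, integral_sub, integral_div, integral_div,
    integral_div, integral_div, integral_linear_sq_gaussian_prod,
    integral_linear_sq_gaussian_prod, integral_linear_sq_gaussian_prod,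
    integral_linear_sq_gaussian_prod, hk]
  · rw [mul_div_assoc, Real.log_mul hvp (div_ne_zero hwp hτp)]
    simp only [integral_const, probReal_univ, one_smul]
    have h1 : (η * ρ - 1) ^ 2 + (τ : ℝ) = η ^ 2 - 2 * (η * ρ) + 1 := by rw [hτ]; ring
    rw [add_assoc ((β - α - ν) ^ 2), h1]
    field_simp
    ring
  · exact integrable_const _
  · exact hI _ _ _ _
  · exact (integrable_const _).sub (hI _ _ _ _)
  · exact hI _ _ _ _
  · exact ((integrable_const _).sub (hI _ _ _ _)).add (hI _ _ _ _)
  · exact hI _ _ _ _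
  · exact (((integrable_const _).sub (hI _ _ _ _)).add (hI _ _ _ _)).sub (hI _ _ _ _)
  · exact hI _ _ _ _

lemma map_snd_correlatedNoise {ρ : ℝ} (hρ : ρ ^ 2 < 1) :
    (correlatedNoise ρ).map Prod.snd = gaussianReal 0 1 := by
  rw [correlatedNoise, Measure.map_map (by fun_prop) (by fun_prop)]
  have h := map_linear_gaussian_prod 0 ρ (√(1 - ρ ^ 2)) (σ := 1)
    (by rw [Real.sq_sqrt (by linarith)]; simp)
  simpa [Function.comp_def] using h

lemma map_fst_correlatedNoise (ρ : ℝ) :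
    (correlatedNoise ρ).map Prod.fst = gaussianReal 0 1 := by
  rw [correlatedNoise, Measure.map_map (by fun_prop) (by fun_prop)]
  have h : (Prod.fst ∘ fun p : ℝ × ℝ => (p.1, ρ * p.1 + √(1 - ρ ^ 2) * p.2)) = Prod.fst := rfl
  rw [h, Measure.map_fst_prod]
  simp

lemma pi_real_preimage_eval {ι Z X : Type*} [Fintype ι] [MeasurableSpace Z] [MeasurableSpace X]
    {μ : Measure Z} [IsProbabilityMeasure μ] {f : Z → X} (hf : Measurable f) {S : Set (ι → X)}
    (hS : MeasurableSet S) :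
    (Measure.pi fun _ : ι => μ).real {z | (fun t => f (z t)) ∈ S}
      = (Measure.pi fun _ : ι => μ.map f).real S := by
  have h0 : IsProbabilityMeasure (μ.map f) := Measure.isProbabilityMeasure_map hf.aemeasurable
  rw [← Measure.pi_map_pi (f := fun _ : ι => f) fun _ => hf.aemeasurable,
    map_measureReal_apply (by fun_prop) hS]
  rfl

/-! ### Degrading receiver 1 to receivers 2 and 3, and the genie-aided converse -/

/-- Two independent standard Gaussian variables, used to degrade an observation. -/
def auxiliaryNoise : Measure (ℝ × ℝ) := (gaussianReal 0 1).prod (gaussianReal 0 1)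

instance : IsProbabilityMeasure auxiliaryNoise :=
  inferInstanceAs (IsProbabilityMeasure ((gaussianReal 0 1).prod (gaussianReal 0 1)))

/-- Mixing z₁ with fresh noise restores unit variance. With k = η / a this turns the side
information, after x₁ is removed, into an observation with the noise of receiver 2. -/
lemma map_degraded_snd {ρ k l : ℝ} (hρ : ρ ^ 2 < 1) (h : k ^ 2 + l ^ 2 = 1) :
    ((correlatedNoise ρ).prod auxiliaryNoise).map (fun z => k * z.1.2 + l * z.2.1)
      = gaussianReal 0 1 := by
  have h1 : (fun z : (ℝ × ℝ) × (ℝ × ℝ) => k * z.1.2 + l * z.2.1)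
      = (fun p : ℝ × ℝ => 0 + k * p.1 + l * p.2) ∘ Prod.map Prod.snd Prod.fst := by
    ext z; simp
  rw [h1, ← Measure.map_map (by fun_prop) (by fun_prop),
    ← Measure.map_prod_map _ _ (by fun_prop) (by fun_prop), map_snd_correlatedNoise hρ,
    auxiliaryNoise, Measure.map_fst_prod, measure_univ, one_smul,
    map_linear_gaussian_prod 0 k l (σ := 1) (by simp [h])]

lemma map_degraded_fst {ρ k l : ℝ} (h : k ^ 2 + l ^ 2 = 1) :
    ((correlatedNoise ρ).prod auxiliaryNoise).map (fun z => k * z.1.1 + l * z.2.2)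
      = gaussianReal 0 1 := by
  have h1 : (fun z : (ℝ × ℝ) × (ℝ × ℝ) => k * z.1.1 + l * z.2.2)
      = (fun p : ℝ × ℝ => 0 + k * p.1 + l * p.2) ∘ Prod.map Prod.fst Prod.snd := by
    ext z; simp
  rw [h1, ← Measure.map_map (by fun_prop) (by fun_prop),
    ← Measure.map_prod_map _ _ (by fun_prop) (by fun_prop), map_fst_correlatedNoise,
    auxiliaryNoise, Measure.map_snd_prod, measure_univ, one_smul,
    map_linear_gaussian_prod 0 k l (σ := 1) (by simp [h])]

namespace Code

variable {P : Fin 3 → ℝ≥0} {n : ℕ} {R : RateVector}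

/-- The part of `x₁ + a x₂ + b x₃` in the first coordinate of the genie-aided output. -/
def signal (c : Code (ℝ × ℝ) P n R) (a b : ℝ) (m : Messages n R) (t : Fin n) : ℝ :=
  c.sent m t 0 + a * c.sent m t 1 + b * c.sent m t 2

/-- The side information without its noise. -/
def genieSignal (c : Code (ℝ × ℝ) P n R) (a : ℝ) (m : Messages n R) (t : Fin n) : ℝ :=
  c.sent m t 0 + a * c.sent m t 1

/-- The observations, degraded by `auxiliaryNoise`, from which receiver 1 successively recovers
all five messages `m`. -/
def decodingRegion (c : Code (ℝ × ℝ) P n R) (a b η : ℝ) (m : Messages n R) :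
    Set (Fin n → (ℝ × ℝ) × (ℝ × ℝ)) :=
  {y | c.dec1 (fun t => (y t).1) = (m w11, m w12, m w13)} ∩
  {y | c.dec2 (fun t => ((y t).1.2 - c.enc1 (m w11) t) / a + √(1 - (η / a) ^ 2) * (y t).2.1)
    = m w22} ∩
  {y | c.dec3 (fun t => ((y t).1.1 - c.enc1 (m w11) t - a * c.enc2 (m w12) (m w22) t) / b
    + √(1 - (1 / b) ^ 2) * (y t).2.2) = m w33}

lemma measurableSet_decodingRegion (c : Code (ℝ × ℝ) P n R) (a b η : ℝ) (m : Messages n R) :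
    MeasurableSet (c.decodingRegion a b η m) := by
  refine ((?_ : MeasurableSet _).inter ?_).inter ?_
  · exact (c.measurable_dec1.comp (by fun_prop)) (measurableSet_singleton _)
  · exact (c.measurable_dec2.comp (by fun_prop)) (measurableSet_singleton _)
  · exact (c.measurable_dec3.comp (by fun_prop)) (measurableSet_singleton _)

lemma disjoint_decodingRegion (c : Code (ℝ × ℝ) P n R) (a b η : ℝ) :
    Pairwise (Function.onFun Disjoint (c.decodingRegion a b η)) := by
  intro m m' hmm
  refine Set.disjoint_left.2 ?_
  rintro y ⟨⟨h1, h2⟩, h3⟩ ⟨⟨h1', h2'⟩, h3'⟩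
  simp only [Set.mem_ofPred_eq] at h1 h2 h3 h1' h2' h3'
  have h := h1.symm.trans h1'
  simp only [Prod.mk.injEq] at h
  obtain ⟨e11, e12, e13⟩ := h
  -- Decoding is successive: only after W₁₁ is known to agree do both tests for W₂₂ use the same
  -- codeword, and likewise for W₃₃ once W₁₂ and W₂₂ agree.
  rw [← e11] at h2' h3'
  have e22 := h2.symm.trans h2'
  rw [← e12, ← e22] at h3'
  have e33 := h3.symm.trans h3'
  apply hmm
  funext w
  cases w <;> assumption

/-- The law of the degraded observations when `m` is sent. -/
def observationLaw (c : Code (ℝ × ℝ) P n R) (a b η ρ : ℝ) (m : Messages n R) (t : Fin n) :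
    Measure ((ℝ × ℝ) × (ℝ × ℝ)) :=
  (genieLaw η ρ (c.signal a b m t) (c.genieSignal a m t)).prod auxiliaryNoise

instance (c : Code (ℝ × ℝ) P n R) (a b η ρ : ℝ) (m : Messages n R) (t : Fin n) :
    IsProbabilityMeasure (c.observationLaw a b η ρ m t) := by
  unfold observationLaw; infer_instance

/-- A union bound over the three decoding steps. Each step needs only the marginal law of its own
degraded noise, so the correlation between n₁ and z₁ plays no role. -/
lemma one_sub_errors_le (c : Code (ℝ × ℝ) P n R) {a b η ρ : ℝ} (hρ : ρ ^ 2 < 1) (ha0 : a ≠ 0)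
    (ha : η ^ 2 ≤ a ^ 2) (hb : 1 ≤ b ^ 2) (m : Messages n R) :
    1 - ((Measure.pi fun _ : Fin n => (genieReceiver a b η ρ).noise).real
        {z | c.dec1 (fun t => (genieReceiver a b η ρ).output (c.sent m t) (z t))
          ≠ (m w11, m w12, m w13)}
      + (Measure.pi fun _ : Fin n => gaussianReal 0 1).real
        {z | c.dec2 (fun t => c.sent m t 1 + z t) ≠ m w22}
      + (Measure.pi fun _ : Fin n => gaussianReal 0 1).real
        {z | c.dec3 (fun t => c.sent m t 2 + z t) ≠ m w33})
      ≤ (Measure.pi (c.observationLaw a b η ρ m)).real (c.decodingRegion a b η m) := by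
  have hb0 : b ≠ 0 := by rintro rfl; norm_num at hb
  set N : Measure ((ℝ × ℝ) × (ℝ × ℝ)) := (correlatedNoise ρ).prod auxiliaryNoise with hN
  set F : Fin n → (ℝ × ℝ) × (ℝ × ℝ) → (ℝ × ℝ) × (ℝ × ℝ) := fun t z =>
    ((c.signal a b m t + z.1.1, c.genieSignal a m t + η * z.1.2), z.2) with hF
  have hFm : ∀ t, Measurable (F t) := fun t => by simp only [hF]; fun_prop
  have hlaw : ∀ t, N.map (F t) = c.observationLaw a b η ρ m t := by
    intro t
    have : F t = Prod.map (fun z : ℝ × ℝ =>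
        (c.signal a b m t + z.1, c.genieSignal a m t + η * z.2)) id := rfl
    rw [this, hN, ← Measure.map_prod_map _ _ (by fun_prop) (by fun_prop), Measure.map_id]
    rfl
  have hpi : Measure.pi (c.observationLaw a b η ρ m)
      = (Measure.pi fun _ : Fin n => N).map fun z t => F t (z t) := by
    have h0 : ∀ t, IsProbabilityMeasure (N.map (F t)) := fun t =>
      Measure.isProbabilityMeasure_map (hFm t).aemeasurable
    rw [Measure.pi_map_pi (f := F) fun t => (hFm t).aemeasurable]
    simp_rw [hlaw]
  set E1 : Set (Fin n → ℝ × ℝ) :=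
    {z | c.dec1 (fun t => (genieReceiver a b η ρ).output (c.sent m t) (z t))
      ≠ (m w11, m w12, m w13)} with hE1
  set E2 : Set (Fin n → ℝ) := {z | c.dec2 (fun t => c.sent m t 1 + z t) ≠ m w22} with hE2
  set E3 : Set (Fin n → ℝ) := {z | c.dec3 (fun t => c.sent m t 2 + z t) ≠ m w33} with hE3
  have mE1 : MeasurableSet E1 := by
    refine (c.measurable_dec1.comp ?_) (measurableSet_singleton _).compl
    simp only [genieReceiver]
    fun_prop
  have mE2 : MeasurableSet E2 :=
    (c.measurable_dec2.comp (by fun_prop)) (measurableSet_singleton _).compl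
  have mE3 : MeasurableSet E3 :=
    (c.measurable_dec3.comp (by fun_prop)) (measurableSet_singleton _).compl
  have h1 : (Measure.pi fun _ : Fin n => N).real {z | (fun t => (z t).1) ∈ E1}
      = (Measure.pi fun _ : Fin n => (genieReceiver a b η ρ).noise).real E1 := by
    rw [pi_real_preimage_eval measurable_fst mE1, hN, Measure.map_fst_prod, measure_univ, one_smul]
    rfl
  have h2 : (Measure.pi fun _ : Fin n => N).real
      {z | (fun t => η / a * (z t).1.2 + √(1 - (η / a) ^ 2) * (z t).2.1) ∈ E2}
      = (Measure.pi fun _ : Fin n => gaussianReal 0 1).real E2 := by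
    have hle : (η / a) ^ 2 ≤ 1 := by
      rw [div_pow]; exact div_le_one_of_le₀ ha (sq_nonneg a)
    rw [pi_real_preimage_eval (f := fun z : (ℝ × ℝ) × (ℝ × ℝ) =>
      η / a * z.1.2 + √(1 - (η / a) ^ 2) * z.2.1) (by fun_prop) mE2, hN, map_degraded_snd hρ]
    rw [Real.sq_sqrt (by linarith)]; ring
  have h3 : (Measure.pi fun _ : Fin n => N).real
      {z | (fun t => 1 / b * (z t).1.1 + √(1 - (1 / b) ^ 2) * (z t).2.2) ∈ E3}
      = (Measure.pi fun _ : Fin n => gaussianReal 0 1).real E3 := by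
    have hle : (1 / b) ^ 2 ≤ 1 := by
      rw [div_pow, one_pow]; exact div_le_one_of_le₀ hb (sq_nonneg b)
    rw [pi_real_preimage_eval (f := fun z : (ℝ × ℝ) × (ℝ × ℝ) =>
      1 / b * z.1.1 + √(1 - (1 / b) ^ 2) * z.2.2) (by fun_prop) mE3, hN, map_degraded_fst]
    rw [Real.sq_sqrt (by linarith)]; ring
  have hD := c.measurableSet_decodingRegion a b η m
  have hmF : Measurable fun (z : Fin n → (ℝ × ℝ) × (ℝ × ℝ)) t => F t (z t) := by fun_prop
  rw [hpi, map_measureReal_apply hmF hD, ← h1, ← h2, ← h3]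
  have hcompl := probReal_compl_eq_one_sub (μ := Measure.pi fun _ : Fin n => N) (hmF hD)
  -- If none of the three errors occurs, removing the true codewords leaves exactly the inputs on
  -- which the decoders of receivers 2 and 3 succeed.
  have hsub : ((fun (z : Fin n → (ℝ × ℝ) × (ℝ × ℝ)) t => F t (z t)) ⁻¹'
      c.decodingRegion a b η m)ᶜ ⊆ ({z | (fun t => (z t).1) ∈ E1} ∪
      {z | (fun t => η / a * (z t).1.2 + √(1 - (η / a) ^ 2) * (z t).2.1) ∈ E2}) ∪
      {z | (fun t => 1 / b * (z t).1.1 + √(1 - (1 / b) ^ 2) * (z t).2.2) ∈ E3} := by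
    intro z hz
    by_contra hcon
    simp only [Set.mem_union, not_or] at hcon
    obtain ⟨⟨g1, g2⟩, g3⟩ := hcon
    apply hz
    simp only [Set.mem_ofPred_eq, hE1, hE2, hE3, not_not] at g1 g2 g3
    refine ⟨⟨?_, ?_⟩, ?_⟩
    · exact g1
    · refine Eq.trans (congrArg c.dec2 (funext fun t => ?_)) g2
      simp only [hF, genieSignal, sent, Matrix.cons_val_zero, Matrix.cons_val_one]
      field_simp
      ring
    · refine Eq.trans (congrArg c.dec3 (funext fun t => ?_)) g3
      simp only [hF, signal, sent, Matrix.cons_val_zero, Matrix.cons_val_one, Matrix.cons_val]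
      field_simp
      ring
  have hle := (measureReal_mono (μ := Measure.pi fun _ : Fin n => N) hsub).trans
    ((measureReal_union_le _ _).trans (add_le_add_left (measureReal_union_le _ _) _))
  linarith

/-- A block-length-`n` outer bound on the sum-rate for the genie-aided channel: after decoding its
own messages, receiver 1 can degrade its observations into those of receivers 2 and 3. -/
lemma genie_converse (c : Code (ℝ × ℝ) P n R) (hR : 0 ≤ sumRate R) {a b η ρ : ℝ}
    (hρ : ρ ^ 2 < 1) (hη : η * ρ = 1 + b ^ 2 * P 2) (ha : η ^ 2 ≤ a ^ 2) (hb : 1 ≤ b ^ 2)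
    {τ v w : ℝ≥0} (hτ0 : τ ≠ 0) (hv0 : v ≠ 0) (hw0 : w ≠ 0) (hτ : (τ : ℝ) = η ^ 2 * (1 - ρ ^ 2))
    (hv : (v : ℝ) = 1 + receivedPower a b P) (hw : (w : ℝ) = η ^ 2 - η * ρ) :
    (1 - (c.error1 (genieReceiver a b η ρ) + c.error2 + c.error3))
        * (n * (sumRate R * Real.log 2))
      ≤ n * (1 / 2 * Real.log (v * w / τ)) + Real.log 2 := by
  have hη0 : η ≠ 0 := by
    rintro rfl
    rw [zero_mul] at hη
    have : 0 ≤ b ^ 2 * (P 2 : ℝ) := by positivity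
    linarith
  have ha0 : a ≠ 0 := by
    rintro rfl
    have : 0 < η ^ 2 := by positivity
    norm_num at ha
    exact hη0 ha
  set W := Messages n R
  set μ : Fin n → ℝ := fun t => average fun m => c.signal a b m t with hμ
  -- The mean of the signal part of s - y, which is -b x₃.
  set ν : Fin n → ℝ := fun t => average fun m => c.genieSignal a m t - c.signal a b m t with hν
  have hmeas := fun m t => measurable_genieLLR η ρ (c.signal a b m t) (c.genieSignal a m t) τ
    (μ t) (ν t) v w
  have hcore := block_converse
    (q := fun t => (genieReference (μ t) (ν t) v w).prod auxiliaryNoise)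
    (p := fun m : W => c.observationLaw a b η ρ m)
    (L := fun m t y => genieLLR η ρ (c.signal a b m t) (c.genieSignal a m t) τ (μ t) (ν t) v w y.1)
    (fun m t => (hmeas m t).comp measurable_fst)
    (fun m t => by
      rw [observationLaw, genieLaw_eq_withDensity hρ hτ0 hτ _ _ (μ t) (ν t) hv0 hw0,
        prod_withDensity_left (hmeas m t).exp.ennreal_ofReal])
    (fun m t => (integrable_genieLLR η ρ _ _ τ (μ t) (ν t) v w).comp_fst auxiliaryNoise)
    (c.measurableSet_decodingRegion a b η) (c.disjoint_decodingRegion a b η)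
  have hint : ∀ m t, ∫ y, genieLLR η ρ (c.signal a b m t) (c.genieSignal a m t) τ (μ t) (ν t) v w
      y.1 ∂c.observationLaw a b η ρ m t = 1 / 2 * Real.log (v * w / τ) - 1
        + (1 + (c.signal a b m t - μ t) ^ 2) / (2 * v) + (η ^ 2 - 2 * (η * ρ) + 1
        + (c.genieSignal a m t - c.signal a b m t - ν t) ^ 2) / (2 * w) := by
    intro m t
    rw [← integral_genieLLR hρ hτ0 hτ _ _ _ _ hv0 hw0, observationLaw]
    rw [integral_fun_fst (μ := genieLaw η ρ (c.signal a b m t) (c.genieSignal a m t))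
      (ν := auxiliaryNoise)]
    simp
  have hcard : (0 : ℝ) < Fintype.card W := by exact_mod_cast Fintype.card_pos
  have herr : 1 - (c.error1 (genieReceiver a b η ρ) + c.error2 + c.error3)
      ≤ average fun m => (Measure.pi (c.observationLaw a b η ρ m)).real
        (c.decodingRegion a b η m) := by
    rw [Code.error1, Code.error2, Code.error3, ← average_const (ι := W) 1, ← average_add,
      ← average_add, ← average_sub]
    exact average_mono fun m => c.one_sub_errors_le hρ ha0 ha hb m
  have hvar1 : ∑ t, averageVar (fun m => c.signal a b m t) ≤ n * receivedPower a b P := by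
    simpa [signal, receivedPower] using c.sum_averageVar_le ![1, a, b]
  have hvar2 : ∑ t, averageVar (fun m => c.genieSignal a m t - c.signal a b m t)
      ≤ n * (b ^ 2 * P 2) := by
    -- The difference s - y contains only x₃, so its signal variance is limited by P₃ alone.
    simpa [signal, genieSignal] using c.sum_averageVar_le ![0, 0, -b]
  have hdiv : average (fun m => ∑ t, ∫ y, genieLLR η ρ (c.signal a b m t) (c.genieSignal a m t) τ
      (μ t) (ν t) v w y.1 ∂c.observationLaw a b η ρ m t) ≤ n * (1 / 2 * Real.log (v * w / τ)) := by
    have hvp : (0 : ℝ) < v := by exact_mod_cast pos_iff_ne_zero.2 hv0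
    have hwp : (0 : ℝ) < w := by exact_mod_cast pos_iff_ne_zero.2 hw0
    simp_rw [hint]
    rw [average_sum]
    have : ∀ t, average (fun m => 1 / 2 * Real.log (v * w / τ) - 1
        + (1 + (c.signal a b m t - μ t) ^ 2) / (2 * v) + (η ^ 2 - 2 * (η * ρ) + 1
        + (c.genieSignal a m t - c.signal a b m t - ν t) ^ 2) / (2 * w))
        = (1 / 2 * Real.log (v * w / τ) - 1 + 1 / (2 * v)
          + (η ^ 2 - 2 * (η * ρ) + 1) / (2 * w))
          + 1 / (2 * v) * averageVar (fun m => c.signal a b m t)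
          + 1 / (2 * w) * averageVar (fun m => c.genieSignal a m t - c.signal a b m t) := by
      intro t
      rw [averageVar, averageVar, ← average_const_mul, ← average_const_mul,
        ← average_const (ι := W) (1 / 2 * Real.log (v * w / τ) - 1 + 1 / (2 * v)
          + (η ^ 2 - 2 * (η * ρ) + 1) / (2 * w)), ← average_add, ← average_add]
      congr 1
      ext m
      simp only [hμ, hν]
      ring
    simp_rw [this]
    rw [Finset.sum_add_distrib, Finset.sum_add_distrib, ← Finset.mul_sum, ← Finset.mul_sum]
    have h3 : 1 / (2 * (v : ℝ)) * ∑ t, averageVar (fun m => c.signal a b m t)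
        ≤ 1 / (2 * (v : ℝ)) * (n * (v - 1)) := by
      rw [show (v : ℝ) - 1 = receivedPower a b P by rw [hv]; ring]; gcongr
    have h4 : 1 / (2 * (w : ℝ)) *
        ∑ t, averageVar (fun m => c.genieSignal a m t - c.signal a b m t)
        ≤ 1 / (2 * (w : ℝ)) * (n * (w - (η ^ 2 - 2 * (η * ρ) + 1))) := by
      have : (w : ℝ) - (η ^ 2 - 2 * (η * ρ) + 1) = b ^ 2 * P 2 := by rw [hw]; linarith
      rw [this]; gcongr
    have h5 : n * (1 / (2 * (v : ℝ))) + 1 / (2 * (v : ℝ)) * (n * (v - 1)) = n * (1 / 2) := by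
      field_simp
      ring
    -- The noise variance of s - y is η² - 2ηρ + 1, and ηρ = 1 + b²P₃ makes noise plus signal
    -- variance equal to w. Each coordinate thus contributes n/2, and together they cancel the
    -- constant -n.
    have h6 : n * ((η ^ 2 - 2 * (η * ρ) + 1) / (2 * (w : ℝ)))
        + 1 / (2 * (w : ℝ)) * (n * (w - (η ^ 2 - 2 * (η * ρ) + 1))) = n * (1 / 2) := by
      field_simp
      ring
    simp only [Finset.sum_const, Finset.card_univ, Fintype.card_fin, nsmul_eq_mul]
    linarith
  have hnR : 0 ≤ n * (sumRate R * Real.log 2) :=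
    mul_nonneg (Nat.cast_nonneg _) (mul_nonneg hR (Real.log_nonneg one_le_two))
  refine (mul_le_mul_of_nonneg_right herr hnR).trans ?_
  have hcard2 := le_log_card_messages n R
  rw [mul_assoc] at hcard2
  refine (mul_le_mul_of_nonneg_left hcard2
    (average_nonneg fun _ => measureReal_nonneg)).trans ?_
  refine le_trans ?_ (add_le_add_left hdiv _)
  simp only [average]
  rw [div_mul_eq_mul_div, div_add' _ _ _ hcard.ne', div_le_div_iff_of_pos_right hcard]
  linarith

end Code

/-! ### Mutual information for Gaussian inputs -/

/-- When the reference q is the true output law, the conditional likelihood ratio is the density of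
the joint law against the product of its marginals. Mutual information is then the mean
log-likelihood ratio. -/
lemma mutualInfo_map_eq {X N Y : Type} [MeasurableSpace X] [MeasurableSpace N]
    [MeasurableSpace Y] {μ : Measure X} {κ : Measure N} [IsProbabilityMeasure μ]
    [IsProbabilityMeasure κ] {q : Measure Y} [IsProbabilityMeasure q] {out : X → N → Y}
    (hout : Measurable fun p : X × N => out p.1 p.2) {L : X → Y → ℝ}
    (hL : Measurable fun p : X × Y => L p.1 p.2)
    (hdens : ∀ x, κ.map (out x) = q.withDensity fun y => ENNReal.ofReal (Real.exp (L x y)))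
    (hq : (μ.prod κ).map (fun p => out p.1 p.2) = q)
    (hint : Integrable (fun p : X × N => L p.1 (out p.1 p.2)) (μ.prod κ)) :
    mutualInfo ((μ.prod κ).map fun p => (p.1, out p.1 p.2))
      = ENNReal.ofReal ((∫ p, L p.1 (out p.1 p.2) ∂μ.prod κ) / Real.log 2) := by
  set J := (μ.prod κ).map fun p => (p.1, out p.1 p.2) with hJ
  have hpair : Measurable fun p : X × N => (p.1, out p.1 p.2) := measurable_fst.prodMk hout
  have hJp : IsProbabilityMeasure J := Measure.isProbabilityMeasure_map hpair.aemeasurable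
  have h1 : J.map Prod.fst = μ := by
    rw [hJ, Measure.map_map measurable_fst hpair]
    have : (Prod.fst ∘ fun p : X × N => (p.1, out p.1 p.2)) = Prod.fst := rfl
    rw [this, Measure.map_fst_prod, measure_univ, one_smul]
  have h2 : J.map Prod.snd = q := by
    rw [hJ, Measure.map_map measurable_snd hpair]
    exact hq
  have hoc : ∀ x, Measurable (out x) := fun x => hout.comp measurable_prodMk_left
  have hLm : Measurable fun p : X × Y => ENNReal.ofReal (Real.exp (L p.1 p.2)) :=
    hL.exp.ennreal_ofReal
  have hJd : J = (μ.prod q).withDensity fun p => ENNReal.ofReal (Real.exp (L p.1 p.2)) := by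
    refine Measure.ext_of_lintegral _ fun F hF => ?_
    have hFp : Measurable fun p : X × N => F (p.1, out p.1 p.2) := hF.comp hpair
    rw [hJ, lintegral_map hF hpair, lintegral_prod _ hFp.aemeasurable,
      lintegral_withDensity_eq_lintegral_mul _ hLm hF,
      lintegral_prod _ (hLm.mul hF).aemeasurable]
    refine lintegral_congr fun x => ?_
    have hFx : Measurable fun y => F (x, y) := hF.comp measurable_prodMk_left
    have hLx : Measurable fun y => ENNReal.ofReal (Real.exp (L x y)) :=
      hLm.comp measurable_prodMk_left
    have := lintegral_map (μ := κ) hFx (hoc x)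
    rw [← this, hdens x, lintegral_withDensity_eq_lintegral_mul _ hLx hFx]
    rfl
  have hac : J ≪ μ.prod q := by rw [hJd]; exact withDensity_absolutelyContinuous _ _
  have hllr : llr J (μ.prod q) =ᵐ[J] fun p => L p.1 p.2 := by
    have h := Measure.rnDeriv_withDensity (μ.prod q) hLm
    rw [← hJd] at h
    filter_upwards [hac.ae_le h] with p hp
    rw [llr, hp, ENNReal.toReal_ofReal (Real.exp_pos _).le, Real.log_exp]
  have hLJ : Integrable (fun p : X × Y => L p.1 p.2) J :=
    (integrable_map_measure hL.aestronglyMeasurable hpair.aemeasurable).2 hint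
  rw [mutualInfo, h1, h2, InformationTheory.klDiv_of_ac_of_integrable hac (hLJ.congr hllr.symm),
    integral_congr_ae hllr, hJ, integral_map hpair.aemeasurable hL.aestronglyMeasurable, ← hJ,
    ENNReal.ofReal_div_of_pos (Real.log_pos one_lt_two)]
  simp

lemma map_add_prod {X Z E : Type*} [MeasurableSpace X] [MeasurableSpace Z] [AddMonoid E]
    [MeasurableSpace E] [MeasurableAdd₂ E] {μ : Measure X} {κ : Measure Z} [SFinite μ] [SFinite κ]
    {f : X → E} {g : Z → E} (hf : Measurable f) (hg : Measurable g) :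
    (μ.prod κ).map (fun p => f p.1 + g p.2) = (μ.map f).conv (κ.map g) := by
  rw [Measure.conv, Measure.map_prod_map _ _ hf hg, Measure.map_map (by fun_prop) (by fun_prop)]
  rfl

/-- The target is a general additive monoid so that the lemma serves both single symbols and whole
codewords. -/
lemma map_sum_pi_fin_three {Ω : Fin 3 → Type*} {E : Type*} [∀ j, MeasurableSpace (Ω j)]
    [AddCommMonoid E] [MeasurableSpace E] [MeasurableAdd₂ E] {μ : ∀ j, Measure (Ω j)}
    [∀ j, IsProbabilityMeasure (μ j)] {f : ∀ j, Ω j → E} (hf : ∀ j, Measurable (f j)) :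
    (Measure.pi μ).map (fun x => f 0 (x 0) + f 1 (x 1) + f 2 (x 2))
      = (((μ 0).map (f 0)).conv ((μ 1).map (f 1))).conv ((μ 2).map (f 2)) := by
  have hi : iIndepFun (fun i (x : ∀ j, Ω j) => f i (x i)) (Measure.pi μ) :=
    iIndepFun_pi fun j => (hf j).aemeasurable
  have hm : ∀ j, Measurable fun x : ∀ j, Ω j => f j (x j) := fun j =>
    (hf j).comp (measurable_pi_apply j)
  have hmap : ∀ j, (Measure.pi μ).map (fun x => f j (x j)) = (μ j).map (f j) := by
    intro j
    have : (fun x : ∀ j, Ω j => f j (x j)) = f j ∘ Function.eval j := rfl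
    rw [this, ← Measure.map_map (hf j) (measurable_pi_apply j),
      (measurePreserving_eval μ j).map_eq]
  have h01 := hi.indepFun (show (0 : Fin 3) ≠ 1 by decide)
  have h012 := hi.indepFun_add_left hm 0 1 2 (by decide) (by decide)
  have e1 := h012.map_add_eq_map_conv_map ((hm 0).add (hm 1)) (hm 2)
  have e2 := h01.map_add_eq_map_conv_map (hm 0) (hm 1)
  rw [e2, hmap, hmap, hmap] at e1
  exact e1

lemma map_linear_pi_gaussian {P : Fin 3 → ℝ≥0} (c : Fin 3 → ℝ) {σ : ℝ≥0}
    (hσ : (σ : ℝ) = c 0 ^ 2 * P 0 + c 1 ^ 2 * P 1 + c 2 ^ 2 * P 2) :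
    (Measure.pi fun j => gaussianReal 0 (P j)).map (fun x => c 0 * x 0 + c 1 * x 1 + c 2 * x 2)
      = gaussianReal 0 σ := by
  rw [map_sum_pi_fin_three (μ := fun j => gaussianReal 0 (P j)) (f := fun j x => c j * x)
    fun j => by fun_prop]
  simp only [gaussianReal_map_const_mul, mul_zero, gaussianReal_conv_gaussianReal, add_zero]
  congr 1
  ext
  simp [hσ]

lemma map_linear_inputs_noise {P : Fin 3 → ℝ≥0} (c : Fin 3 → ℝ) (d e : ℝ) {σ : ℝ≥0}
    (hσ : (σ : ℝ) = c 0 ^ 2 * P 0 + c 1 ^ 2 * P 1 + c 2 ^ 2 * P 2 + d ^ 2 + e ^ 2) :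
    ((Measure.pi fun j => gaussianReal 0 (P j)).prod
      ((gaussianReal 0 1).prod (gaussianReal 0 1))).map
      (fun p => (c 0 * p.1 0 + c 1 * p.1 1 + c 2 * p.1 2) + (0 + d * p.2.1 + e * p.2.2))
      = gaussianReal 0 σ := by
  obtain ⟨σ₁, h₁⟩ : ∃ σ₁ : ℝ≥0, (σ₁ : ℝ) = c 0 ^ 2 * P 0 + c 1 ^ 2 * P 1 + c 2 ^ 2 * P 2 :=
    ⟨⟨_, by positivity⟩, rfl⟩
  obtain ⟨σ₂, h₂⟩ : ∃ σ₂ : ℝ≥0, (σ₂ : ℝ) = d ^ 2 + e ^ 2 := ⟨⟨_, by positivity⟩, rfl⟩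
  rw [map_add_prod (f := fun x : Fin 3 → ℝ => c 0 * x 0 + c 1 * x 1 + c 2 * x 2)
    (g := fun z : ℝ × ℝ => 0 + d * z.1 + e * z.2) (by fun_prop) (by fun_prop),
    map_linear_pi_gaussian c h₁, map_linear_gaussian_prod 0 d e h₂,
    gaussianReal_conv_gaussianReal, add_zero]
  congr 1
  ext
  rw [NNReal.coe_add, h₁, h₂, hσ]
  ring

section Law

variable {Ω : Type*} [MeasurableSpace Ω] {μ : Measure Ω} {f : Ω → ℝ} {σ : ℝ≥0}

lemma integrable_sq_of_map_eq (hf : Measurable f) (h : μ.map f = gaussianReal 0 σ) :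
    Integrable (fun x => f x ^ 2) μ := by
  have h1 := integrable_sub_sq_gaussian 0 0 σ
  rw [← h] at h1
  simpa [Function.comp_def] using h1.comp_measurable hf

lemma integral_sq_of_map_eq (hf : Measurable f) (h : μ.map f = gaussianReal 0 σ) :
    ∫ x, f x ^ 2 ∂μ = σ := by
  have h1 := integral_sub_sq_gaussian 0 0 σ
  rw [← h, integral_map hf.aemeasurable (by fun_prop)] at h1
  simpa using h1

lemma variance_of_map_eq (hf : Measurable f) (h : μ.map f = gaussianReal 0 σ) :
    Var[f; μ] = σ := by
  have h1 := variance_map (X := id) (μ := μ) (Y := f) (by fun_prop) hf.aemeasurable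
  rw [h, variance_id_gaussianReal] at h1
  exact h1.symm

lemma memLp_two_of_map_eq (hf : Measurable f) (h : μ.map f = gaussianReal 0 σ) :
    MemLp f 2 μ := by
  rw [memLp_two_iff_integrable_sq hf.aestronglyMeasurable]
  exact integrable_sq_of_map_eq hf h

end Law

/-- The input symbols and the two components of the noise, for Gaussian inputs. -/
def inputsNoise (P : Fin 3 → ℝ≥0) : Measure ((Fin 3 → ℝ) × (ℝ × ℝ)) :=
  (Measure.pi fun j => gaussianReal 0 (P j)).prod ((gaussianReal 0 1).prod (gaussianReal 0 1))

instance (P : Fin 3 → ℝ≥0) : IsProbabilityMeasure (inputsNoise P) := by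
  unfold inputsNoise; infer_instance

/-- A linear combination of the input symbols and the two components of the noise. -/
def inputsNoiseForm (c : Fin 3 → ℝ) (d e : ℝ) (p : (Fin 3 → ℝ) × (ℝ × ℝ)) : ℝ :=
  (c 0 * p.1 0 + c 1 * p.1 1 + c 2 * p.1 2) + (0 + d * p.2.1 + e * p.2.2)

@[fun_prop]
lemma measurable_inputsNoiseForm (c : Fin 3 → ℝ) (d e : ℝ) :
    Measurable (inputsNoiseForm c d e) := by
  unfold inputsNoiseForm; fun_prop

lemma hasGaussianLaw_inputsNoiseForm (P : Fin 3 → ℝ≥0) (c c' : Fin 3 → ℝ) (d e d' e' : ℝ) :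
    HasGaussianLaw (fun p => (inputsNoiseForm c d e p, inputsNoiseForm c' d' e' p))
      (inputsNoise P) := by
  have hpi : IsGaussian (Measure.pi fun j => gaussianReal 0 (P j)) := by
    have hi : iIndepFun (fun (j : Fin 3) (x : Fin 3 → ℝ) => x j)
        (Measure.pi fun j => gaussianReal 0 (P j)) :=
      iIndepFun_pi (μ := fun j => gaussianReal 0 (P j)) (X := fun _ (x : ℝ) => x)
        fun _ => aemeasurable_id
    have hj : ∀ j : Fin 3, HasGaussianLaw (fun x : Fin 3 → ℝ => x j)
        (Measure.pi fun j => gaussianReal 0 (P j)) := fun j =>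
      ⟨by
        have : Measure.map (fun x : Fin 3 → ℝ => x j) (Measure.pi fun j => gaussianReal 0 (P j))
          = gaussianReal 0 (P j) :=
          (measurePreserving_eval (fun j : Fin 3 => gaussianReal 0 (P j)) j).map_eq
        rw [this]
        infer_instance⟩
    have h := (hi.hasGaussianLaw hj).isGaussian_map
    rwa [Measure.map_id'] at h
  have hG : IsGaussian (inputsNoise P) := by
    unfold inputsNoise; infer_instance
  let T : ((Fin 3 → ℝ) × (ℝ × ℝ)) →ₗ[ℝ] ℝ × ℝ :=
    { toFun := fun p => (inputsNoiseForm c d e p, inputsNoiseForm c' d' e' p)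
      map_add' := fun p q => by
        ext <;> simp only [inputsNoiseForm, Prod.fst_add, Prod.snd_add, Pi.add_apply] <;> ring
      map_smul' := fun k p => by
        ext <;> simp only [inputsNoiseForm, Prod.smul_fst, Prod.smul_snd, Pi.smul_apply,
          smul_eq_mul, RingHom.id_apply] <;> ring }
  have h := (IsGaussian.hasGaussianLaw_id (μ := inputsNoise P)).map_of_measurable
    (LinearMap.toContinuousLinearMap T) (LinearMap.toContinuousLinearMap T).measurable
  exact h

/-- Jointly Gaussian uncorrelated variables are independent. The hypothesis `horth` says that the
covariance of the two forms vanishes. -/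
lemma map_pair_inputsNoiseForm {P : Fin 3 → ℝ≥0} {c c' : Fin 3 → ℝ} {d e d' e' : ℝ} {σ σ' : ℝ≥0}
    (h : (σ : ℝ) = c 0 ^ 2 * P 0 + c 1 ^ 2 * P 1 + c 2 ^ 2 * P 2 + d ^ 2 + e ^ 2)
    (h' : (σ' : ℝ) = c' 0 ^ 2 * P 0 + c' 1 ^ 2 * P 1 + c' 2 ^ 2 * P 2 + d' ^ 2 + e' ^ 2)
    (horth : c 0 * c' 0 * P 0 + c 1 * c' 1 * P 1 + c 2 * c' 2 * P 2 + d * d' + e * e' = 0) :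
    (inputsNoise P).map (fun p => (inputsNoiseForm c d e p, inputsNoiseForm c' d' e' p))
      = (gaussianReal 0 σ).prod (gaussianReal 0 σ') := by
  have l := map_linear_inputs_noise c d e h
  have l' := map_linear_inputs_noise c' d' e' h'
  -- The covariance is read off from the variance of the sum of the two forms, which `horth` makes
  -- equal to the sum of the variances.
  have ls := map_linear_inputs_noise (P := P) (fun j => c j + c' j) (d + d') (e + e')
    (σ := σ + σ') (by rw [NNReal.coe_add, h, h']; linear_combination -2 * horth)
  change (inputsNoise P).map (inputsNoiseForm c d e) = _ at l
  change (inputsNoise P).map (inputsNoiseForm c' d' e') = _ at l'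
  change (inputsNoise P).map (inputsNoiseForm (fun j => c j + c' j) (d + d') (e + e')) = _ at ls
  have hadd : inputsNoiseForm (fun j => c j + c' j) (d + d') (e + e')
      = inputsNoiseForm c d e + inputsNoiseForm c' d' e' := by
    ext p
    simp only [inputsNoiseForm, Pi.add_apply]
    ring
  have v := variance_of_map_eq (by fun_prop) l
  have v' := variance_of_map_eq (by fun_prop) l'
  have vs := variance_of_map_eq (by fun_prop) ls
  rw [hadd, variance_add (memLp_two_of_map_eq (by fun_prop) l)
    (memLp_two_of_map_eq (by fun_prop) l'), v, v', NNReal.coe_add] at vs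
  have hcov : cov[inputsNoiseForm c d e, inputsNoiseForm c' d' e'; inputsNoise P] = 0 := by
    linarith
  have hind := (hasGaussianLaw_inputsNoiseForm P c c' d e d' e').indepFun_of_covariance_eq_zero
    hcov
  rw [(indepFun_iff_map_prod_eq_prod_map_map (by fun_prop) (by fun_prop)).1 hind, l, l']

/-- The output law is 𝒩(0, v). The two quadratic terms of the log-likelihood ratio are normalized
squares of mean 1/2 with opposite signs, so only ½ log v survives. -/
lemma gaussianInputInfo_plainReceiver (a b : ℝ) (P : Fin 3 → ℝ≥0) :
    gaussianInputInfo (plainReceiver a b) P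
      = ENNReal.ofReal (1 / 2 * Real.log (1 + receivedPower a b P) / Real.log 2) := by
  obtain ⟨v, hv⟩ : ∃ v : ℝ≥0, (v : ℝ) = 1 + receivedPower a b P :=
    ⟨⟨_, by linarith [receivedPower_nonneg a b P]⟩, rfl⟩
  have hv0 : v ≠ 0 := by
    rintro rfl
    rw [NNReal.coe_zero] at hv
    linarith [receivedPower_nonneg a b P]
  have hvp : (v : ℝ) ≠ 0 := by exact_mod_cast hv0
  obtain ⟨σ, hσ⟩ : ∃ σ : ℝ≥0, (σ : ℝ) = receivedPower a b P :=
    ⟨⟨_, receivedPower_nonneg a b P⟩, rfl⟩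
  set Ω := (Measure.pi fun j => gaussianReal 0 (P j)).prod (gaussianReal 0 1) with hΩ
  have hy : Ω.map (fun p => (1 * p.1 0 + a * p.1 1 + b * p.1 2) + p.2) = gaussianReal 0 v := by
    have h := map_linear_pi_gaussian (P := P) ![1, a, b] (σ := σ)
      (by simp [hσ, receivedPower])
    simp only [Matrix.cons_val_zero, Matrix.cons_val_one, Matrix.cons_val] at h
    rw [hΩ, map_add_prod (f := fun x : Fin 3 → ℝ => 1 * x 0 + a * x 1 + b * x 2)
      (g := fun z : ℝ => z) (by fun_prop) (by fun_prop), h, Measure.map_id',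
      gaussianReal_conv_gaussianReal, add_zero]
    congr 1
    ext
    rw [NNReal.coe_add, hσ, hv, NNReal.coe_one, add_comm]
  have hn : Ω.map (fun p => p.2) = gaussianReal 0 1 := by
    change Ω.map Prod.snd = _
    rw [hΩ, Measure.map_snd_prod, measure_univ, one_smul]
  have hI1 := integrable_sq_of_map_eq (by fun_prop) hy
  have hI2 := integrable_sq_of_map_eq (by fun_prop) hn
  have hE1 := integral_sq_of_map_eq (by fun_prop) hy
  have hE2 := integral_sq_of_map_eq (by fun_prop) hn
  have hfun : ∀ p : (Fin 3 → ℝ) × ℝ,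
      gaussianLLR (p.1 0 + a * p.1 1 + b * p.1 2) 1 0 v ((plainReceiver a b).output p.1 p.2)
      = 1 / 2 * Real.log v - p.2 ^ 2 / 2
        + ((1 * p.1 0 + a * p.1 1 + b * p.1 2) + p.2) ^ 2 / (2 * v) := by
    intro p
    simp only [gaussianLLR, plainReceiver, NNReal.coe_one, div_one]
    ring
  have hIc : Integrable (fun p : (Fin 3 → ℝ) × ℝ => 1 / 2 * Real.log v - p.2 ^ 2 / 2) Ω :=
    (integrable_const _).sub (hI2.div_const _)
  have hint : ∫ p, gaussianLLR (p.1 0 + a * p.1 1 + b * p.1 2) 1 0 v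
      ((plainReceiver a b).output p.1 p.2) ∂Ω = 1 / 2 * Real.log v := by
    simp_rw [hfun]
    rw [integral_add hIc (hI1.div_const _), integral_sub (integrable_const _) (hI2.div_const _),
      integral_div, integral_div, hE1, hE2]
    simp only [integral_const, probReal_univ, one_smul, NNReal.coe_one]
    field_simp
    ring
  rw [← hv, ← hint]
  refine mutualInfo_map_eq (κ := (plainReceiver a b).noise) (out := (plainReceiver a b).output)
    (q := gaussianReal 0 v)
    (L := fun x y => gaussianLLR (x 0 + a * x 1 + b * x 2) 1 0 v y) ?_ ?_ ?_ ?_ ?_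
  · simp only [plainReceiver]; fun_prop
  · unfold gaussianLLR; fun_prop
  · intro x
    rw [← gaussianReal_eq_withDensity _ _ one_ne_zero hv0]
    have h := gaussianReal_map_const_add (μ := 0) (v := 1) (x 0 + a * x 1 + b * x 2)
    rw [zero_add] at h
    exact h
  · rw [← hy]
    simp [plainReceiver, hΩ]
  · simp_rw [hfun]
    exact hIc.add (hI1.div_const _)

/-- By the choice of η, y and r = s - y are independent, so the output law is the reference used in
the converse. The squares of n, y, z and r, each divided by twice its variance, have mean 1/2 and
cancel in pairs. -/
lemma gaussianInputInfo_genieReceiver {a b η ρ : ℝ} {P : Fin 3 → ℝ≥0}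
    (hρ : ρ ^ 2 < 1) (hη : η * ρ = 1 + b ^ 2 * P 2)
    {τ v w : ℝ≥0} (hτ0 : τ ≠ 0) (hv0 : v ≠ 0) (hw0 : w ≠ 0) (hτ : (τ : ℝ) = η ^ 2 * (1 - ρ ^ 2))
    (hv : (v : ℝ) = 1 + receivedPower a b P) (hw : (w : ℝ) = η ^ 2 - η * ρ) :
    gaussianInputInfo (genieReceiver a b η ρ) P
      = ENNReal.ofReal (1 / 2 * Real.log (v * w / τ) / Real.log 2) := by
  have hτp : (τ : ℝ) ≠ 0 := by exact_mod_cast hτ0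
  have hvp : (v : ℝ) ≠ 0 := by exact_mod_cast hv0
  have hwp : (w : ℝ) ≠ 0 := by exact_mod_cast hw0
  have hk : (η * √(1 - ρ ^ 2)) ^ 2 = τ := by
    rw [mul_pow, Real.sq_sqrt (by linarith), hτ]
  set y := inputsNoiseForm ![1, a, b] 1 0 with hy
  set r := inputsNoiseForm ![0, 0, -b] (η * ρ - 1) (η * √(1 - ρ ^ 2)) with hr
  set n := inputsNoiseForm 0 1 0 with hn
  set z := inputsNoiseForm 0 0 (η * √(1 - ρ ^ 2)) with hz
  have sv : (v : ℝ) = (![1, a, b] : Fin 3 → ℝ) 0 ^ 2 * P 0 + (![1, a, b] : Fin 3 → ℝ) 1 ^ 2 * P 1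
      + (![1, a, b] : Fin 3 → ℝ) 2 ^ 2 * P 2 + 1 ^ 2 + 0 ^ 2 := by
    simp [hv, receivedPower]
    ring
  have sw : (w : ℝ) = (![0, 0, -b] : Fin 3 → ℝ) 0 ^ 2 * P 0
      + (![0, 0, -b] : Fin 3 → ℝ) 1 ^ 2 * P 1 + (![0, 0, -b] : Fin 3 → ℝ) 2 ^ 2 * P 2
      + (η * ρ - 1) ^ 2 + (η * √(1 - ρ ^ 2)) ^ 2 := by
    rw [hk, hw, hτ]
    simp
    linear_combination hη
  have ly : (inputsNoise P).map y = gaussianReal 0 v := map_linear_inputs_noise ![1, a, b] 1 0 sv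
  have lr : (inputsNoise P).map r = gaussianReal 0 w := map_linear_inputs_noise ![0, 0, -b] (η * ρ - 1) (η * √(1 - ρ ^ 2)) sw
  have ln : (inputsNoise P).map n = gaussianReal 0 1 :=
    map_linear_inputs_noise 0 1 0 (by simp)
  have lz : (inputsNoise P).map z = gaussianReal 0 τ :=
    map_linear_inputs_noise 0 0 (η * √(1 - ρ ^ 2)) (by rw [hk]; simp)
  have lyr : (inputsNoise P).map (fun p => (y p, r p))
      = (gaussianReal 0 v).prod (gaussianReal 0 w) := by
    -- Orthogonality is the identity -b²P₃ + ηρ - 1 = 0, which is the defining property of η.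
    refine map_pair_inputsNoiseForm (c := ![1, a, b]) (c' := ![0, 0, -b]) (d := 1) (e := 0)
      (d' := η * ρ - 1) (e' := η * √(1 - ρ ^ 2)) sv sw ?_
    simp
    linear_combination hη
  have my : Measurable y := measurable_inputsNoiseForm _ _ _
  have mr : Measurable r := measurable_inputsNoiseForm _ _ _
  have mn : Measurable n := measurable_inputsNoiseForm _ _ _
  have mz : Measurable z := measurable_inputsNoiseForm _ _ _
  set T : (Fin 3 → ℝ) × (ℝ × ℝ) → (Fin 3 → ℝ) × (ℝ × ℝ) := fun p =>
    (p.1, (p.2.1, ρ * p.2.1 + √(1 - ρ ^ 2) * p.2.2)) with hT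
  have mT : Measurable T := by fun_prop
  have hmap : (Measure.pi fun j => gaussianReal 0 (P j)).prod (genieReceiver a b η ρ).noise
      = (inputsNoise P).map T := by
    have : T = Prod.map id fun q : ℝ × ℝ => (q.1, ρ * q.1 + √(1 - ρ ^ 2) * q.2) := rfl
    rw [this, inputsNoise, ← Measure.map_prod_map _ _ (by fun_prop) (by fun_prop), Measure.map_id]
    rfl
  have hfun : ∀ p : (Fin 3 → ℝ) × (ℝ × ℝ),
      genieLLR η ρ ((T p).1 0 + a * (T p).1 1 + b * (T p).1 2) ((T p).1 0 + a * (T p).1 1)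
        τ 0 0 v w ((genieReceiver a b η ρ).output (T p).1 (T p).2)
      = (1 / 2 * Real.log v + 1 / 2 * Real.log (w / τ)) - n p ^ 2 / 2 + y p ^ 2 / (2 * v)
        - z p ^ 2 / (2 * τ) + r p ^ 2 / (2 * w) := by
    intro p
    simp only [hT, genieReceiver]
    rw [genieLLR_comp]
    simp only [hn, hy, hz, hr, inputsNoiseForm, Matrix.cons_val_zero, Matrix.cons_val_one,
      Matrix.cons_val, Pi.zero_apply]
    ring
  have iy := (integrable_sq_of_map_eq my ly).div_const (2 * (v : ℝ))
  have ir := (integrable_sq_of_map_eq mr lr).div_const (2 * (w : ℝ))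
  have i_n := (integrable_sq_of_map_eq mn ln).div_const 2
  have iz := (integrable_sq_of_map_eq mz lz).div_const (2 * (τ : ℝ))
  have i1 : Integrable (fun p => (1 / 2 * Real.log v + 1 / 2 * Real.log (w / τ)) - n p ^ 2 / 2)
    (inputsNoise P) := (integrable_const _).sub i_n
  have i2 : Integrable (fun p => (1 / 2 * Real.log v + 1 / 2 * Real.log (w / τ)) - n p ^ 2 / 2
    + y p ^ 2 / (2 * v)) (inputsNoise P) := i1.add iy
  have i3 : Integrable (fun p => (1 / 2 * Real.log v + 1 / 2 * Real.log (w / τ)) - n p ^ 2 / 2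
    + y p ^ 2 / (2 * v) - z p ^ 2 / (2 * τ)) (inputsNoise P) := i2.sub iz
  have mout : Measurable fun p : (Fin 3 → ℝ) × (ℝ × ℝ) =>
      (genieReceiver a b η ρ).output p.1 p.2 := by
    simp only [genieReceiver]; fun_prop
  have mL : Measurable fun p : (Fin 3 → ℝ) × (ℝ × ℝ) =>
      genieLLR η ρ (p.1 0 + a * p.1 1 + b * p.1 2) (p.1 0 + a * p.1 1) τ 0 0 v w p.2 := by
    unfold genieLLR gaussianLLR; fun_prop
  have mcomp : Measurable fun p : (Fin 3 → ℝ) × (ℝ × ℝ) =>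
      genieLLR η ρ (p.1 0 + a * p.1 1 + b * p.1 2) (p.1 0 + a * p.1 1) τ 0 0 v w
        ((genieReceiver a b η ρ).output p.1 p.2) := by
    simp only [genieReceiver]
    unfold genieLLR gaussianLLR
    fun_prop
  have hint : ∫ p, genieLLR η ρ (p.1 0 + a * p.1 1 + b * p.1 2) (p.1 0 + a * p.1 1) τ 0 0 v w
      ((genieReceiver a b η ρ).output p.1 p.2)
      ∂(Measure.pi fun j => gaussianReal 0 (P j)).prod (genieReceiver a b η ρ).noise
      = 1 / 2 * Real.log (v * w / τ) := by
    rw [hmap, integral_map mT.aemeasurable mcomp.aestronglyMeasurable]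
    refine (integral_congr_ae (ae_of_all _ hfun)).trans ?_
    rw [integral_add i3 ir, integral_sub i2 iz, integral_add i1 iy,
      integral_sub (integrable_const _) i_n, integral_div, integral_div, integral_div,
      integral_div, integral_sq_of_map_eq my ly, integral_sq_of_map_eq mr lr,
      integral_sq_of_map_eq mn ln, integral_sq_of_map_eq mz lz, mul_div_assoc (v : ℝ),
      Real.log_mul hvp (div_ne_zero hwp hτp)]
    simp only [integral_const, probReal_univ, one_smul, NNReal.coe_one]
    field_simp
    ring
  rw [← hint]
  refine mutualInfo_map_eq (κ := (genieReceiver a b η ρ).noise)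
    (out := (genieReceiver a b η ρ).output) (q := genieReference 0 0 v w)
    (L := fun x p => genieLLR η ρ (x 0 + a * x 1 + b * x 2) (x 0 + a * x 1) τ 0 0 v w p)
    mout mL ?_ ?_ ?_
  · intro x
    rw [← genieLaw_eq_withDensity hρ hτ0 hτ _ _ _ _ hv0 hw0]
    rfl
  · rw [hmap, Measure.map_map mout mT, genieReference, ← lyr,
      Measure.map_map (by fun_prop) (by fun_prop)]
    congr 1
    ext p
    · simp only [hT, Function.comp_apply, genieReceiver, hy, inputsNoiseForm,
        Matrix.cons_val_zero, Matrix.cons_val_one, Matrix.cons_val]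
      ring
    · simp only [hT, Function.comp_apply, genieReceiver, hy, hr, inputsNoiseForm,
        Matrix.cons_val_zero, Matrix.cons_val_one, Matrix.cons_val]
      ring
  · rw [hmap, integrable_map_measure mcomp.aestronglyMeasurable mT.aemeasurable]
    exact (i3.add ir).congr (ae_of_all _ fun p => (hfun p).symm)

/-! ### Random Gaussian codebooks -/

/-- The law of a vector of `n` independent centered Gaussian variables of variance `v`. -/
abbrev gaussianVector (n : ℕ) (v : ℝ≥0) : Measure (Fin n → ℝ) :=
  Measure.pi fun _ => gaussianReal 0 v

lemma gaussianVector_conv (n : ℕ) (v w : ℝ≥0) :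
    (gaussianVector n v).conv (gaussianVector n w) = gaussianVector n (v + w) :=
  map_add_pi_gaussianReal v w

lemma map_smul_gaussianVector (n : ℕ) (k : ℝ) {v w : ℝ≥0} (hw : (w : ℝ) = k ^ 2 * v) :
    (gaussianVector n v).map (fun x => k • x) = gaussianVector n w := by
  have h : (gaussianReal 0 v).map (fun x => k * x) = gaussianReal 0 w := by
    rw [gaussianReal_map_const_mul, mul_zero]
    congr 1
    ext
    simp [hw]
  have h0 : ∀ t : Fin n, SigmaFinite ((gaussianReal 0 v).map fun x => k * x) := fun t => by
    rw [h]; infer_instance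
  have := Measure.pi_map_pi (μ := fun _ : Fin n => gaussianReal 0 v) (f := fun _ x => k * x)
    fun t => by fun_prop
  simp_rw [h] at this
  exact this

section Codebook

variable {M n : ℕ} {v w : ℝ≥0}

/-- The codebook of a single transmitter. -/
abbrev gaussianCodebook (M n : ℕ) (v : ℝ≥0) : Measure (Fin M → Fin n → ℝ) :=
  Measure.pi fun _ => gaussianVector n v

lemma map_eval_gaussianCodebook (k : ℝ) (hw : (w : ℝ) = k ^ 2 * v) (i : Fin M) :
    (gaussianCodebook M n v).map (fun q => k • q i) = gaussianVector n w := by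
  have h : (gaussianCodebook M n v).map (fun q : Fin M → Fin n → ℝ => q i) = gaussianVector n v :=
    (measurePreserving_eval (fun _ : Fin M => gaussianVector n v) i).map_eq
  rw [← map_smul_gaussianVector n k hw, ← h, Measure.map_map (by fun_prop) (by fun_prop)]
  rfl

lemma map_eval_pair_gaussianCodebook (k : ℝ) (hw : (w : ℝ) = k ^ 2 * v) {i i' : Fin M}
    (h : i = i' → k = 0) :
    (gaussianCodebook M n v).map (fun q => (k • q i, k • q i'))
      = (gaussianVector n w).prod (gaussianVector n w) := by
  have hind : IndepFun (fun q : Fin M → Fin n → ℝ => k • q i) (fun q => k • q i')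
      (gaussianCodebook M n v) := by
    by_cases hi : i = i'
    · simp only [h hi, zero_smul]
      exact indepFun_const_left 0 _
    · have := iIndepFun_pi (μ := fun _ : Fin M => gaussianVector n v)
        (X := fun _ (x : Fin n → ℝ) => k • x) fun _ => (measurable_id.const_smul k).aemeasurable
      exact this.indepFun hi
  have hm : ∀ i, Measurable fun q : Fin M → Fin n → ℝ => k • q i := fun i =>
    (measurable_pi_apply i).const_smul k
  rw [(indepFun_iff_map_prod_eq_prod_map_map (hm i).aemeasurable (hm i').aemeasurable).1 hind,
    map_eval_gaussianCodebook k hw, map_eval_gaussianCodebook k hw]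

end Codebook

lemma map_add_fst_prod {X Y : Type*} [AddMonoid X] [MeasurableSpace X] [MeasurableAdd₂ X]
    [MeasurableSpace Y] (μ κ : Measure X) (ξ : Measure Y) [SFinite μ] [SFinite κ] [SFinite ξ] :
    ((μ.prod ξ).prod κ).map (fun q => (q.1.1 + q.2, q.1.2)) = (μ.conv κ).prod ξ := by
  refine Measure.ext_of_lintegral _ fun F hF => ?_
  rw [lintegral_map hF (by fun_prop), lintegral_prod _ (by fun_prop),
    lintegral_prod _ (by fun_prop), lintegral_prod _ hF.aemeasurable, Measure.conv,
    lintegral_map hF.lintegral_prod_right' (by fun_prop), lintegral_prod]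
  · refine lintegral_congr fun x => ?_
    exact lintegral_lintegral_swap (by fun_prop)
  · exact (hF.lintegral_prod_right'.comp (by fun_prop)).aemeasurable

section Codebooks

variable {Q : Fin 3 → ℝ≥0} {n : ℕ} {r : Fin 3 → ℝ}

instance : IsProbabilityMeasure (gaussianCodebooks Q n r) := by
  unfold gaussianCodebooks; infer_instance

/-- A linear combination of the codewords of the three transmitters for the messages `m`. -/
def superposition (k : Fin 3 → ℝ) (m : (j : Fin 3) → Fin (msgCount n (r j)))
    (p : Codebooks n r) : Fin n → ℝ :=
  k 0 • p 0 (m 0) + k 1 • p 1 (m 1) + k 2 • p 2 (m 2)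

@[fun_prop]
lemma measurable_superposition (k : Fin 3 → ℝ) (m : (j : Fin 3) → Fin (msgCount n (r j))) :
    Measurable (superposition k m) := by
  unfold superposition; fun_prop

lemma exists_scaled_powers (k : Fin 3 → ℝ) (Q : Fin 3 → ℝ≥0) {σ : ℝ≥0}
    (hσ : (σ : ℝ) = k 0 ^ 2 * Q 0 + k 1 ^ 2 * Q 1 + k 2 ^ 2 * Q 2) :
    ∃ w : Fin 3 → ℝ≥0, (∀ j, (w j : ℝ) = k j ^ 2 * Q j) ∧ σ = w 0 + w 1 + w 2 := by
  have h : ∀ j, ∃ w : ℝ≥0, (w : ℝ) = k j ^ 2 * Q j := fun j => ⟨⟨_, by positivity⟩, rfl⟩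
  choose w hw using h
  refine ⟨w, hw, ?_⟩
  ext
  rw [hσ, NNReal.coe_add, NNReal.coe_add, hw, hw, hw]

lemma map_sum_gaussianVector (w : Fin 3 → ℝ≥0) :
    (Measure.pi fun j => gaussianVector n (w j)).map (fun x => x 0 + x 1 + x 2)
      = gaussianVector n (w 0 + w 1 + w 2) := by
  rw [map_sum_pi_fin_three (μ := fun j => gaussianVector n (w j)) (f := fun _ x => x)
    fun _ => measurable_id]
  simp only [Measure.map_id', gaussianVector_conv]

lemma map_superposition (k : Fin 3 → ℝ) {σ : ℝ≥0}
    (hσ : (σ : ℝ) = k 0 ^ 2 * Q 0 + k 1 ^ 2 * Q 1 + k 2 ^ 2 * Q 2)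
    (m : (j : Fin 3) → Fin (msgCount n (r j))) :
    (gaussianCodebooks Q n r).map (superposition k m) = gaussianVector n σ := by
  obtain ⟨w, hw, rfl⟩ := exists_scaled_powers k Q hσ
  have h := map_sum_pi_fin_three (μ := fun j => gaussianCodebook (msgCount n (r j)) n (Q j))
    (f := fun j q => k j • q (m j)) fun j => by fun_prop
  simp only [map_eval_gaussianCodebook _ (hw _), gaussianVector_conv] at h
  exact h

lemma map_superposition_pair (k : Fin 3 → ℝ) {σ : ℝ≥0}
    (hσ : (σ : ℝ) = k 0 ^ 2 * Q 0 + k 1 ^ 2 * Q 1 + k 2 ^ 2 * Q 2)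
    {m m' : (j : Fin 3) → Fin (msgCount n (r j))} (hm : ∀ j, m j = m' j → k j = 0) :
    (gaussianCodebooks Q n r).map (fun p => (superposition k m p, superposition k m' p))
      = (gaussianVector n σ).prod (gaussianVector n σ) := by
  obtain ⟨w, hw, rfl⟩ := exists_scaled_powers k Q hσ
  have h1 : (gaussianCodebooks Q n r).map
      (fun p (j : Fin 3) => (k j • p j (m j), k j • p j (m' j)))
      = Measure.pi fun j => (gaussianVector n (w j)).prod (gaussianVector n (w j)) := by
    have h0 : ∀ j, SigmaFinite ((gaussianCodebook (msgCount n (r j)) n (Q j)).map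
        fun q => (k j • q (m j), k j • q (m' j))) := fun j => by
      rw [map_eval_pair_gaussianCodebook (k j) (hw j) (hm j)]; infer_instance
    have h := Measure.pi_map_pi (μ := fun j => gaussianCodebook (msgCount n (r j)) n (Q j))
      (f := fun j q => (k j • q (m j), k j • q (m' j))) fun j => by fun_prop
    rw [show (fun j => (gaussianCodebook (msgCount n (r j)) n (Q j)).map
        fun q => (k j • q (m j), k j • q (m' j)))
      = fun j => (gaussianVector n (w j)).prod (gaussianVector n (w j)) from
      funext fun j => map_eval_pair_gaussianCodebook (k j) (hw j) (hm j)] at h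
    exact h
  have h2 : (fun p : Codebooks n r => (superposition k m p, superposition k m' p))
      = (Prod.map (fun x : Fin 3 → Fin n → ℝ => x 0 + x 1 + x 2)
          (fun x : Fin 3 → Fin n → ℝ => x 0 + x 1 + x 2) ∘
        MeasurableEquiv.arrowProdEquivProdArrow (Fin n → ℝ) (Fin n → ℝ) (Fin 3)) ∘
        fun p (j : Fin 3) => (k j • p j (m j), k j • p j (m' j)) := rfl
  rw [h2, ← Measure.map_map ?_ (by fun_prop), h1, ← Measure.map_map (by fun_prop)
    (MeasurableEquiv.measurable _),
    (measurePreserving_arrowProdEquivProdArrow (Fin n → ℝ) (Fin n → ℝ) (Fin 3)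
      (fun j => gaussianVector n (w j)) (fun j => gaussianVector n (w j))).map_eq,
    ← Measure.map_prod_map _ _ (by fun_prop) (by fun_prop), map_sum_gaussianVector]
  exact Measurable.comp (by fun_prop) (MeasurableEquiv.measurable _)

lemma map_superposition_add_noise (k : Fin 3 → ℝ) {σ : ℝ≥0}
    (hσ : (σ : ℝ) = k 0 ^ 2 * Q 0 + k 1 ^ 2 * Q 1 + k 2 ^ 2 * Q 2)
    (m : (j : Fin 3) → Fin (msgCount n (r j))) :
    ((gaussianCodebooks Q n r).prod (gaussianVector n 1)).map
      (fun p => superposition k m p.1 + p.2) = gaussianVector n (σ + 1) := by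
  rw [map_add_prod (f := superposition k m) (g := fun z => z) (by fun_prop) (by fun_prop),
    map_superposition k hσ, Measure.map_id', gaussianVector_conv]

lemma map_superposition_pair_add_noise (k : Fin 3 → ℝ) {σ : ℝ≥0}
    (hσ : (σ : ℝ) = k 0 ^ 2 * Q 0 + k 1 ^ 2 * Q 1 + k 2 ^ 2 * Q 2)
    {m m' : (j : Fin 3) → Fin (msgCount n (r j))} (hm : ∀ j, m j = m' j → k j = 0) :
    ((gaussianCodebooks Q n r).prod (gaussianVector n 1)).map
      (fun p => (superposition k m p.1 + p.2, superposition k m' p.1))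
      = (gaussianVector n (σ + 1)).prod (gaussianVector n σ) := by
  have h : (fun p : Codebooks n r × (Fin n → ℝ) =>
      (superposition k m p.1 + p.2, superposition k m' p.1))
      = (fun q : ((Fin n → ℝ) × (Fin n → ℝ)) × (Fin n → ℝ) => (q.1.1 + q.2, q.1.2)) ∘
        Prod.map (fun p => (superposition k m p, superposition k m' p)) (fun z => z) := rfl
  rw [h, ← Measure.map_map (by fun_prop) (by fun_prop),
    ← Measure.map_prod_map _ _ (by fun_prop) (by fun_prop), map_superposition_pair k hσ hm,
    Measure.map_id', map_add_fst_prod, gaussianVector_conv]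

end Codebooks

/-! ### Distance decoding -/

/-- An independent Gaussian vector is unlikely to be close to a given vector. -/
lemma gaussianVector_close_le (n : ℕ) {σ : ℝ≥0} (hσ : σ ≠ 0) (ε : ℝ) (u : Fin n → ℝ) :
    gaussianVector n σ {x | ∑ t, (x t - u t) ^ 2 ≤ n * (1 + ε) ∧ n * (σ * (1 - ε)) ≤ ∑ t, x t ^ 2}
      ≤ ENNReal.ofReal (Real.exp (n * ε - n * (1 / 2 * Real.log σ))) := by
  set E : Set (Fin n → ℝ) :=
    {x | ∑ t, (x t - u t) ^ 2 ≤ n * (1 + ε) ∧ n * (σ * (1 - ε)) ≤ ∑ t, x t ^ 2} with hE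
  have hσp : (0 : ℝ) < σ := by exact_mod_cast pos_iff_ne_zero.2 hσ
  have hEm : MeasurableSet E := by
    have hA : MeasurableSet {x : Fin n → ℝ | ∑ t, (x t - u t) ^ 2 ≤ n * (1 + ε)} :=
      measurableSet_le (by fun_prop) (by fun_prop)
    have hB : MeasurableSet {x : Fin n → ℝ | n * (σ * (1 - ε)) ≤ ∑ t, x t ^ 2} :=
      measurableSet_le (by fun_prop) (by fun_prop)
    exact hA.inter hB
  have hd := pi_eq_withDensity_prod (μ := fun _ : Fin n => gaussianReal 0 σ)
    (ν := fun t => gaussianReal (u t) 1)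
    (fun t => (measurable_gaussianLLR (u t) 1 0 σ).exp.ennreal_ofReal)
    (fun t => gaussianReal_eq_withDensity (u t) 0 one_ne_zero hσ)
  -- On the event, the density of 𝒩(u, 1) against 𝒩(0, σ) is at least exp(n · ½ log σ - nε). As 𝒩(u,
  -- 1) has total mass 1, the event has small mass under 𝒩(0, σ).
  have h1 : (Measure.pi fun t => gaussianReal (u t) 1) E ≤ 1 := prob_le_one
  rw [hd, withDensity_apply _ hEm] at h1
  set K : ℝ := n * (1 / 2 * Real.log σ) - n * ε with hK
  have h2 : ENNReal.ofReal (Real.exp K) * gaussianVector n σ E ≤ 1 := by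
    refine le_trans ?_ h1
    rw [← setLIntegral_const]
    refine setLIntegral_mono' hEm fun x hx => ?_
    rw [← ENNReal.ofReal_prod_of_nonneg fun _ _ => (Real.exp_pos _).le, ← Real.exp_sum]
    refine ENNReal.ofReal_le_ofReal (Real.exp_le_exp.2 ?_)
    simp only [gaussianLLR, NNReal.coe_one, div_one, sub_zero, mul_one]
    rw [Finset.sum_add_distrib, Finset.sum_sub_distrib, ← Finset.sum_div, ← Finset.sum_div]
    simp only [Finset.sum_const, Finset.card_univ, Fintype.card_fin, nsmul_eq_mul]
    have h3 : n * (1 - ε) / 2 ≤ (∑ t, x t ^ 2) / (2 * σ) := by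
      rw [div_le_div_iff₀ two_pos (by positivity)]
      have := hx.2
      nlinarith
    have h4 := hx.1
    rw [hK]
    linarith
  rw [show n * ε - n * (1 / 2 * Real.log σ) = -K by rw [hK]; ring, Real.exp_neg,
    ENNReal.ofReal_inv_of_pos (Real.exp_pos _)]
  rw [mul_comm] at h2
  exact ENNReal.le_inv_iff_mul_le.2 h2

lemma prod_gaussianVector_close_le (n : ℕ) {σ : ℝ≥0} (hσ : σ ≠ 0) (ε : ℝ)
    (ξ : Measure (Fin n → ℝ)) [IsProbabilityMeasure ξ] :
    ((gaussianVector n σ).prod ξ).real {p | ∑ t, (p.1 t - p.2 t) ^ 2 ≤ n * (1 + ε) ∧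
      n * (σ * (1 - ε)) ≤ ∑ t, p.1 t ^ 2} ≤ Real.exp (n * ε - n * (1 / 2 * Real.log σ)) := by
  have hm : MeasurableSet {p : (Fin n → ℝ) × (Fin n → ℝ) |
      ∑ t, (p.1 t - p.2 t) ^ 2 ≤ n * (1 + ε) ∧ n * (σ * (1 - ε)) ≤ ∑ t, p.1 t ^ 2} := by
    have hA : MeasurableSet {p : (Fin n → ℝ) × (Fin n → ℝ) |
        ∑ t, (p.1 t - p.2 t) ^ 2 ≤ n * (1 + ε)} := measurableSet_le (by fun_prop) (by fun_prop)
    have hB : MeasurableSet {p : (Fin n → ℝ) × (Fin n → ℝ) |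
        n * (σ * (1 - ε)) ≤ ∑ t, p.1 t ^ 2} := measurableSet_le (by fun_prop) (by fun_prop)
    exact hA.inter hB
  rw [measureReal_def]
  refine ENNReal.toReal_le_of_le_ofReal (Real.exp_pos _).le ?_
  -- Fixing the second vector reduces to the bound for a deterministic u, which is uniform in u.
  rw [Measure.prod_apply_symm hm]
  calc _ ≤ ∫⁻ _, ENNReal.ofReal (Real.exp (n * ε - n * (1 / 2 * Real.log σ))) ∂ξ :=
        lintegral_mono fun u => gaussianVector_close_le n hσ ε u
    _ = _ := by simp

/-- The decoder makes an arbitrary choice among the candidates, but it depends only on the outcomes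
of finitely many measurable tests, so any such choice is measurable. -/
lemma measurable_comp_finite_tests {Ω W V : Type*} [MeasurableSpace Ω] [Finite W]
    [MeasurableSpace V] {C : W → Set Ω} (hC : ∀ w, MeasurableSet (C w)) (g : Set W → V) :
    Measurable fun ω => g {w | ω ∈ C w} := by
  intro B _
  have h : (fun ω => g {w | ω ∈ C w}) ⁻¹' B
      = ⋃ (S : Set W) (_ : g S ∈ B), ⋂ w, {ω | ω ∈ C w ↔ w ∈ S} := by
    ext ω
    simp only [Set.mem_preimage, Set.mem_iUnion, Set.mem_iInter, Set.mem_ofPred_eq, exists_prop]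
    constructor
    · exact fun hω => ⟨_, hω, fun w => Iff.rfl⟩
    · rintro ⟨S, hS, hw⟩
      have : {w | ω ∈ C w} = S := Set.ext hw
      rwa [this]
  rw [h]
  refine MeasurableSet.iUnion fun S => MeasurableSet.iUnion fun _ => MeasurableSet.iInter fun w => ?_
  by_cases hw : w ∈ S
  · have : {ω | ω ∈ C w ↔ w ∈ S} = C w := by ext; simp [hw]
    rw [this]
    exact hC w
  · have : {ω | ω ∈ C w ↔ w ∈ S} = (C w)ᶜ := by ext; simp [hw]
    rw [this]
    exact (hC w).compl

section Decoder

variable {n : ℕ} {r : Fin 3 → ℝ}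

/-- The received vectors, with the codebooks, that are within the radius `√(n (1 + ε))` of the
superposition of the codewords for `m`. -/
def closeTo (a b ε : ℝ) (m : (j : Fin 3) → Fin (msgCount n (r j))) :
    Set (Codebooks n r × (Fin n → ℝ)) :=
  {p | ∑ t, (p.2 t - superposition ![1, a, b] m p.1 t) ^ 2 ≤ n * (1 + ε)}

lemma measurableSet_closeTo (a b ε : ℝ) (m : (j : Fin 3) → Fin (msgCount n (r j))) :
    MeasurableSet (closeTo a b ε m) := by
  refine measurableSet_le ?_ measurable_const
  unfold superposition
  fun_prop

open Classical in
/-- Some element of a set of message triples, if there is one. -/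
def someMember (S : Set ((j : Fin 3) → Fin (msgCount n (r j)))) :
    (j : Fin 3) → Fin (msgCount n (r j)) :=
  if h : S.Nonempty then h.some else fun _ => 0

/-- The decoder which chooses some message triple that passes the distance test. -/
def distanceDecoder (a b ε : ℝ) (p : Codebooks n r × (Fin n → ℝ)) :
    (j : Fin 3) → Fin (msgCount n (r j)) :=
  someMember {m | p ∈ closeTo a b ε m}

lemma measurable_distanceDecoder (a b ε : ℝ) :
    Measurable (distanceDecoder (n := n) (r := r) a b ε) :=
  measurable_comp_finite_tests (measurableSet_closeTo a b ε) someMember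

lemma mem_closeTo_distanceDecoder {a b ε : ℝ} {p : Codebooks n r × (Fin n → ℝ)}
    {m : (j : Fin 3) → Fin (msgCount n (r j))} (h : p ∈ closeTo a b ε m) :
    p ∈ closeTo a b ε (distanceDecoder a b ε p) := by
  have hne : {m | p ∈ closeTo a b ε m}.Nonempty := ⟨m, h⟩
  have : distanceDecoder a b ε p = hne.some := by
    rw [distanceDecoder, someMember, dif_pos hne]
  rw [this]
  exact hne.some_mem

/-- The channel coefficients, restricted to the transmitters in `S`. -/
def restrictedGain (a b : ℝ) (S : Finset (Fin 3)) (j : Fin 3) : ℝ :=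
  if j ∈ S then (![1, a, b] : Fin 3 → ℝ) j else 0

/-- The power received from the transmitters in `S`. -/
def partialPower (a b : ℝ) (Q : Fin 3 → ℝ≥0) (S : Finset (Fin 3)) : ℝ≥0 :=
  ⟨∑ j ∈ S, (![1, a, b] : Fin 3 → ℝ) j ^ 2 * Q j, Finset.sum_nonneg fun j _ => by positivity⟩

lemma coe_partialPower (a b : ℝ) (Q : Fin 3 → ℝ≥0) (S : Finset (Fin 3)) :
    (partialPower a b Q S : ℝ) = ∑ j ∈ S, (![1, a, b] : Fin 3 → ℝ) j ^ 2 * Q j := rfl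

lemma partialPower_eq (a b : ℝ) (Q : Fin 3 → ℝ≥0) (S : Finset (Fin 3)) :
    (partialPower a b Q S : ℝ) = restrictedGain a b S 0 ^ 2 * Q 0 + restrictedGain a b S 1 ^ 2 * Q 1
      + restrictedGain a b S 2 ^ 2 * Q 2 := by
  have h : (∑ j ∈ S, (![1, a, b] : Fin 3 → ℝ) j ^ 2 * Q j)
      = ∑ j, restrictedGain a b S j ^ 2 * (Q j : ℝ) := by
    rw [← Finset.sum_filter_add_sum_filter_not Finset.univ (· ∈ S)]
    rw [Finset.sum_eq_zero (s := Finset.univ.filter (· ∉ S)), add_zero, Finset.filter_univ_mem]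
    · exact Finset.sum_congr rfl fun j hj => by simp [restrictedGain, hj]
    · intro j hj
      have := (Finset.mem_filter.1 hj).2
      simp [restrictedGain, this]
  rw [coe_partialPower, h, Fin.sum_univ_three]

/-- The transmitters whose messages differ. -/
def differing (m m' : (j : Fin 3) → Fin (msgCount n (r j))) : Finset (Fin 3) :=
  Finset.univ.filter fun j => m j ≠ m' j

/-- Codewords of transmitters whose messages agree cancel. Only the transmitters in `differing m m'`
matter when m' competes with m, and on these the codewords are independent. -/
lemma superposition_sub_eq (a b : ℝ) (m m' : (j : Fin 3) → Fin (msgCount n (r j)))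
    (p : Codebooks n r) :
    superposition ![1, a, b] m p - superposition ![1, a, b] m' p
      = superposition (restrictedGain a b (differing m m')) m p
        - superposition (restrictedGain a b (differing m m')) m' p := by
  have h : ∀ j, (![1, a, b] : Fin 3 → ℝ) j • p j (m j) - (![1, a, b] : Fin 3 → ℝ) j • p j (m' j)
      = restrictedGain a b (differing m m') j • p j (m j)
        - restrictedGain a b (differing m m') j • p j (m' j) := by
    intro j
    by_cases hj : m j = m' j
    · rw [hj, sub_self, sub_self]
    · simp [restrictedGain, differing, hj]
  simp only [superposition]
  have h0 := h 0
  have h1 := h 1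
  have h2 := h 2
  ext t
  have h0 := congrFun h0 t
  have h1 := congrFun h1 t
  have h2 := congrFun h2 t
  simp only [Pi.add_apply, Pi.sub_apply] at *
  linarith

/-- The probability that the empirical power of a Gaussian vector is atypical. -/
def atypicalProb (n : ℕ) (v : ℝ≥0) (ε : ℝ) : ℝ :=
  (gaussianVector n v).real {x | n * ε ≤ |∑ t, x t ^ 2 - n * v|}

/-- A union bound over four kinds of events: atypical noise, atypical power of the signal of some
set of transmitters plus noise, a wrong triple close to the received vector, and a violated power
constraint. The typicality of received powers supplies the second condition of
`gaussianVector_close_le`. -/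
lemma distanceDecoder_error_le (a b : ℝ) (P Q : Fin 3 → ℝ≥0) (ε : ℝ)
    (m : (j : Fin 3) → Fin (msgCount n (r j))) :
    ((gaussianCodebooks Q n r).prod (Measure.pi fun _ : Fin n => (plainReceiver a b).noise)).real
      {p | distanceDecoder a b ε
          (p.1, fun t => (plainReceiver a b).output (fun j => p.1 j (m j) t) (p.2 t)) ≠ m ∨
        ∃ j, (n : ℝ) * P j < ∑ t, p.1 j (m j) t ^ 2}
    ≤ atypicalProb n 1 ε
      + ∑ S : Finset (Fin 3), atypicalProb n (partialPower a b Q S + 1)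
          ((partialPower a b Q S + 1) * ε)
      + ∑ m' ∈ Finset.univ.erase m, Real.exp (n * ε
          - n * (1 / 2 * Real.log (partialPower a b Q (differing m m') + 1)))
      + ∑ j, (gaussianVector n (Q j)).real {x | (n : ℝ) * P j < ∑ t, x t ^ 2} := by
  set Ω := (gaussianCodebooks Q n r).prod (gaussianVector n 1) with hΩ
  change Ω.real _ ≤ _
  -- What remains of the received vector after the codewords of the transmitters outside S are
  -- removed.
  set V : Finset (Fin 3) → Codebooks n r × (Fin n → ℝ) → Fin n → ℝ := fun S p =>
    superposition (restrictedGain a b S) m p.1 + p.2 with hV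
  set A : Set (Codebooks n r × (Fin n → ℝ)) := {p | n * ε ≤ |∑ t, p.2 t ^ 2 - n * (1 : ℝ≥0)|}
    with hA
  set B : Finset (Fin 3) → Set (Codebooks n r × (Fin n → ℝ)) := fun S =>
    {p | n * ((partialPower a b Q S + 1) * ε)
      ≤ |∑ t, V S p t ^ 2 - n * ((partialPower a b Q S + 1 : ℝ≥0) : ℝ)|} with hB
  set F : ((j : Fin 3) → Fin (msgCount n (r j))) → Set (Codebooks n r × (Fin n → ℝ)) := fun m' =>
    {p | ∑ t, (V (differing m m') p t
        - superposition (restrictedGain a b (differing m m')) m' p.1 t) ^ 2 ≤ n * (1 + ε) ∧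
      n * (((partialPower a b Q (differing m m') + 1 : ℝ≥0) : ℝ) * (1 - ε))
        ≤ ∑ t, V (differing m m') p t ^ 2} with hF
  set G : Fin 3 → Set (Codebooks n r × (Fin n → ℝ)) := fun j =>
    {p | (n : ℝ) * P j < ∑ t, p.1 j (m j) t ^ 2} with hG
  have hsub : {p : Codebooks n r × (Fin n → ℝ) | distanceDecoder a b ε
          (p.1, fun t => (plainReceiver a b).output (fun j => p.1 j (m j) t) (p.2 t)) ≠ m ∨
        ∃ j, (n : ℝ) * P j < ∑ t, p.1 j (m j) t ^ 2}
      ⊆ ((A ∪ ⋃ S, B S) ∪ ⋃ m' ∈ Finset.univ.erase m, F m') ∪ ⋃ j, G j := by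
    intro p hp
    by_contra hcon
    simp only [Set.mem_union, Set.mem_iUnion, not_or, not_exists] at hcon
    obtain ⟨⟨⟨hpA, hpB⟩, hpF⟩, hpG⟩ := hcon
    rcases hp with hp | ⟨j, hj⟩
    swap
    · exact hpG j hj
    set y : Fin n → ℝ := fun t =>
      (plainReceiver a b).output (fun j => p.1 j (m j) t) (p.2 t) with hy
    have hys : ∀ t, y t = superposition ![1, a, b] m p.1 t + p.2 t := by
      intro t
      simp [hy, plainReceiver, superposition]
    have hclose : (p.1, y) ∈ closeTo a b ε m := by
      simp only [closeTo, Set.mem_ofPred_eq, hys, add_sub_cancel_left]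
      simp only [hA, Set.mem_ofPred_eq, not_le, NNReal.coe_one] at hpA
      have := (abs_lt.1 hpA).2
      linarith
    have hdec := mem_closeTo_distanceDecoder hclose
    set m' := distanceDecoder a b ε (p.1, y) with hm'
    refine hpF m' (Finset.mem_erase.2 ⟨hp, Finset.mem_univ _⟩) ⟨?_, ?_⟩
    · simp only [closeTo, Set.mem_ofPred_eq] at hdec
      refine le_of_eq_of_le (Finset.sum_congr rfl fun t _ => ?_) hdec
      have h := congrFun (superposition_sub_eq a b m m' p.1) t
      simp only [Pi.sub_apply] at h
      simp only [hV, hys, Pi.add_apply]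
      congr 1
      linarith
    · have h := hpB (differing m m')
      simp only [hB, Set.mem_ofPred_eq, not_le] at h
      have h1 := (abs_lt.1 h).1
      rw [NNReal.coe_add, NNReal.coe_one] at h1 ⊢
      linarith
  have mA : MeasurableSet {x : Fin n → ℝ | n * ε ≤ |∑ t, x t ^ 2 - n * (1 : ℝ≥0)|} :=
    measurableSet_le (by fun_prop) (by fun_prop)
  have pA : Ω.real A = atypicalProb n 1 ε := by
    have h : Ω.map Prod.snd = gaussianVector n 1 := by
      rw [hΩ, Measure.map_snd_prod, measure_univ, one_smul]
    rw [atypicalProb, ← h, map_measureReal_apply measurable_snd mA]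
    rfl
  have pB : ∀ S, Ω.real (B S) = atypicalProb n (partialPower a b Q S + 1)
      ((partialPower a b Q S + 1) * ε) := by
    intro S
    have h := map_superposition_add_noise (Q := Q) (restrictedGain a b S) (partialPower_eq a b Q S) m
    rw [atypicalProb, ← h, map_measureReal_apply (by fun_prop)
      (measurableSet_le (by fun_prop) (by fun_prop))]
    rfl
  have pF : ∀ m', Ω.real (F m') ≤ Real.exp (n * ε
      - n * (1 / 2 * Real.log (partialPower a b Q (differing m m') + 1))) := by
    intro m'
    have h := map_superposition_pair_add_noise (Q := Q) (restrictedGain a b (differing m m'))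
      (partialPower_eq a b Q (differing m m')) (m := m) (m' := m')
      (fun j hj => by simp [restrictedGain, differing, hj])
    have hb := prod_gaussianVector_close_le n
      (σ := partialPower a b Q (differing m m') + 1) (by positivity) ε
      (gaussianVector n (partialPower a b Q (differing m m')))
    have hm : MeasurableSet {p : (Fin n → ℝ) × (Fin n → ℝ) |
        ∑ t, (p.1 t - p.2 t) ^ 2 ≤ n * (1 + ε) ∧
        n * (((partialPower a b Q (differing m m') + 1 : ℝ≥0) : ℝ) * (1 - ε))
          ≤ ∑ t, p.1 t ^ 2} := by
      have h1 : MeasurableSet {p : (Fin n → ℝ) × (Fin n → ℝ) |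
        ∑ t, (p.1 t - p.2 t) ^ 2 ≤ n * (1 + ε)} := measurableSet_le (by fun_prop) (by fun_prop)
      have h2 : MeasurableSet {p : (Fin n → ℝ) × (Fin n → ℝ) |
          n * (((partialPower a b Q (differing m m') + 1 : ℝ≥0) : ℝ) * (1 - ε))
            ≤ ∑ t, p.1 t ^ 2} := measurableSet_le (by fun_prop) (by fun_prop)
      exact h1.inter h2
    rw [← h, map_measureReal_apply (by fun_prop) hm, NNReal.coe_add, NNReal.coe_one] at hb
    refine le_trans (le_of_eq ?_) hb
    simp only [hF, hV, NNReal.coe_add, NNReal.coe_one]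
    rfl
  have pG : ∀ j, Ω.real (G j)
      = (gaussianVector n (Q j)).real {x | (n : ℝ) * P j < ∑ t, x t ^ 2} := by
    intro j
    have h1 : Ω.map Prod.fst = gaussianCodebooks Q n r := by
      rw [hΩ, Measure.map_fst_prod, measure_univ, one_smul]
    have h2 : (gaussianCodebooks Q n r).map (fun p => p j)
        = gaussianCodebook (msgCount n (r j)) n (Q j) :=
      (measurePreserving_eval (fun j => gaussianCodebook (msgCount n (r j)) n (Q j)) j).map_eq
    have h3 : (gaussianCodebook (msgCount n (r j)) n (Q j)).map (fun q => q (m j))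
        = gaussianVector n (Q j) :=
      (measurePreserving_eval (fun _ => gaussianVector n (Q j)) (m j)).map_eq
    rw [← h3, ← h2, ← h1, Measure.map_map (by fun_prop) (by fun_prop),
      Measure.map_map (by fun_prop) (by fun_prop), map_measureReal_apply (by fun_prop)
      (measurableSet_lt (by fun_prop) (by fun_prop))]
    rfl
  refine (measureReal_mono hsub).trans ((measureReal_union_le _ _).trans ?_)
  refine add_le_add ((measureReal_union_le _ _).trans (add_le_add
    ((measureReal_union_le _ _).trans (add_le_add pA.le ?_)) ?_)) ?_
  · exact (measureReal_iUnion_fintype_le _).trans (Finset.sum_le_sum fun S _ => (pB S).le)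
  · exact (measureReal_biUnion_finset_le _ _).trans (Finset.sum_le_sum fun m' _ => pF m')
  · exact (measureReal_iUnion_fintype_le _).trans (Finset.sum_le_sum fun j _ => (pG j).le)

end Decoder

/-! ### Error exponents and achievability of the mutual information -/

lemma tendsto_atypicalProb (v : ℝ≥0) {ε : ℝ} (hε : 0 < ε) :
    Tendsto (fun n => atypicalProb n v ε) atTop (𝓝 0) :=
  tendsto_pi_gaussianReal_sum_sq v hε

/-- Strictly smaller codebook power leaves room for the law of large numbers. A codebook of power 0
is almost surely zero and never violates the constraint, which covers P = 0. -/
lemma tendsto_powerViolation {P Q : ℝ≥0} (h : Q < P ∨ Q = 0) :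
    Tendsto (fun n : ℕ => (gaussianVector n Q).real {x | (n : ℝ) * P < ∑ t, x t ^ 2})
      atTop (𝓝 0) := by
  rcases h with h | rfl
  · have hpos : (0 : ℝ) < P - Q := sub_pos.2 (by exact_mod_cast h)
    refine squeeze_zero (fun n => measureReal_nonneg) (fun n => measureReal_mono ?_)
      (tendsto_atypicalProb Q hpos)
    intro x hx
    have hx : (n : ℝ) * P < ∑ t, x t ^ 2 := hx
    have : n * ((P : ℝ) - Q) ≤ |∑ t, x t ^ 2 - n * Q| := le_trans (by linarith) (le_abs_self _)
    exact this
  · refine tendsto_const_nhds.congr fun n => ?_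
    have h0 : ∀ᵐ x ∂gaussianVector n 0, ∀ t, x t = 0 := by
      rw [ae_all_iff]
      intro t
      refine (measurePreserving_eval (fun _ : Fin n => gaussianReal 0 0) t).quasiMeasurePreserving.ae
        (p := fun y => y = 0) ?_
      rw [gaussianReal_zero_var, ae_dirac_eq]
      simp
    have hz : gaussianVector n 0 {x | (n : ℝ) * P < ∑ t, x t ^ 2} = 0 := by
      refine measure_mono_null (t := {x | ¬ ∀ t, x t = 0}) (fun x hx hx0 => ?_) h0
      have hx : (n : ℝ) * P < ∑ t, x t ^ 2 := hx
      simp only [hx0, ne_eq, OfNat.ofNat_ne_zero, not_false_eq_true, zero_pow,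
        Finset.sum_const_zero] at hx
      have : (0 : ℝ) ≤ n * P := by positivity
      linarith
    simp [measureReal_def, hz]

/-- The hypothesis `hs` bounds the error exponent for a set of differing transmitters below by a sum
over its members. The bound on each term then factorizes over transmitters, and the sum over all
triples becomes a product; m itself contributes the 1 that is subtracted. -/
lemma sum_competing_messages_le {n : ℕ} {r : Fin 3 → ℝ} (a b : ℝ) (Q : Fin 3 → ℝ≥0) (ε : ℝ)
    {s : Fin 3 → ℝ} {θ : ℝ}
    (hs : ∀ S : Finset (Fin 3), ∑ j ∈ S, s j ≤ 1 / 2 * Real.log (partialPower a b Q S + 1))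
    (hθ : ∀ j, ((msgCount n (r j) : ℝ) - 1) * Real.exp (-(n * s j)) ≤ θ)
    (m : (j : Fin 3) → Fin (msgCount n (r j))) :
    ∑ m' ∈ Finset.univ.erase m, Real.exp (n * ε
      - n * (1 / 2 * Real.log (partialPower a b Q (differing m m') + 1)))
      ≤ Real.exp (n * ε) * ((1 + θ) ^ 3 - 1) := by
  have h1 : ∀ m' : (j : Fin 3) → Fin (msgCount n (r j)), Real.exp (n * ε
      - n * (1 / 2 * Real.log (partialPower a b Q (differing m m') + 1)))
      ≤ Real.exp (n * ε) * ∏ j, (if m' j = m j then 1 else Real.exp (-(n * s j))) := by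
    intro m'
    have h2 : ∏ j, (if m' j = m j then 1 else Real.exp (-(n * s j)))
        = Real.exp (-(n * ∑ j ∈ differing m m', s j)) := by
      rw [Finset.mul_sum, ← Finset.sum_neg_distrib, Real.exp_sum, differing, Finset.prod_filter]
      refine Finset.prod_congr rfl fun j _ => ?_
      by_cases hj : m' j = m j
      · simp [hj]
      · simp [hj, Ne.symm hj]
    rw [h2, ← Real.exp_add]
    refine Real.exp_le_exp.2 ?_
    have := mul_le_mul_of_nonneg_left (hs (differing m m')) (Nat.cast_nonneg (α := ℝ) n)
    linarith
  refine (Finset.sum_le_sum fun m' _ => h1 m').trans ?_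
  rw [← Finset.mul_sum]
  refine mul_le_mul_of_nonneg_left ?_ (Real.exp_pos _).le
  have h3 : ∑ m' : (j : Fin 3) → Fin (msgCount n (r j)),
      ∏ j, (if m' j = m j then 1 else Real.exp (-(n * s j)))
      = ∏ j, (1 + ((msgCount n (r j) : ℝ) - 1) * Real.exp (-(n * s j))) := by
    have h4 : ∀ j, ∑ i : Fin (msgCount n (r j)), (if i = m j then 1 else Real.exp (-(n * s j)))
        = 1 + ((msgCount n (r j) : ℝ) - 1) * Real.exp (-(n * s j)) := by
      intro j
      rw [← Finset.add_sum_erase _ _ (Finset.mem_univ (m j))]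
      simp only [if_true]
      congr 1
      rw [Finset.sum_congr rfl fun i hi => if_neg (Finset.ne_of_mem_erase hi), Finset.sum_const,
        Finset.card_erase_of_mem (Finset.mem_univ _), Finset.card_univ, Fintype.card_fin,
        nsmul_eq_mul, Nat.cast_sub (msgCount_pos n (r j)), Nat.cast_one]
    simp_rw [← h4]
    rw [Finset.prod_univ_sum, Fintype.piFinset_univ]
  have h5 := Finset.add_sum_erase Finset.univ (fun m' : (j : Fin 3) → Fin (msgCount n (r j)) =>
    ∏ j, (if m' j = m j then 1 else Real.exp (-(n * s j)))) (Finset.mem_univ m)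
  simp only [if_true, Finset.prod_const_one] at h5
  have h6 : ∏ j, (1 + ((msgCount n (r j) : ℝ) - 1) * Real.exp (-(n * s j))) ≤ (1 + θ) ^ 3 := by
    have : ∏ _j : Fin 3, (1 + θ) = (1 + θ) ^ 3 := by simp
    rw [← this]
    refine Finset.prod_le_prod (fun j _ => ?_) fun j _ => by linarith [hθ j]
    have : (1 : ℝ) ≤ msgCount n (r j) := by exact_mod_cast msgCount_pos n (r j)
    have := mul_nonneg (sub_nonneg.2 this) (Real.exp_pos (-(n * s j))).le
    linarith
  linarith

/-- Rate 0 is a separate case because it has a single message and hence no competitor. No strict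
rate margin is then needed, which matters for transmitters of zero received power. -/
lemma msgCount_sub_one_mul_exp_le {n : ℕ} {r s κ : ℝ} (h : r = 0 ∨ κ ≤ s - r * Real.log 2) :
    ((msgCount n r : ℝ) - 1) * Real.exp (-(n * s)) ≤ Real.exp (-(n * κ)) := by
  rcases h with rfl | h
  · rw [msgCount_zero]
    simp only [Nat.cast_one, sub_self, zero_mul]
    positivity
  · have h1 : (msgCount n r : ℝ) - 1 ≤ Real.exp (n * (r * Real.log 2)) := by
      have h2 := Nat.ceil_lt_add_one (Real.rpow_nonneg (zero_le_two (α := ℝ)) (n * r))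
      rw [Real.rpow_def_of_pos two_pos] at h2
      rw [msgCount, Real.rpow_def_of_pos two_pos,
        show n * (r * Real.log 2) = Real.log 2 * (n * r) by ring]
      linarith
    refine (mul_le_mul_of_nonneg_right h1 (Real.exp_pos _).le).trans ?_
    rw [← Real.exp_add]
    refine Real.exp_le_exp.2 ?_
    have := mul_le_mul_of_nonneg_left h (Nat.cast_nonneg (α := ℝ) n)
    linarith

/-- Gaussian codebooks achieve the rates in the interior of the capacity region of the multiple
access channel; `s` are rates in nats on its boundary. -/
lemma m3Achieves_of_lt {a b : ℝ} {P Q : Fin 3 → ℝ≥0} {r s : Fin 3 → ℝ} (hr : ∀ j, 0 ≤ r j)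
    (hQP : ∀ j, Q j ≤ P j) (hQ : ∀ j, Q j < P j ∨ Q j = 0)
    (hs : ∀ S : Finset (Fin 3), ∑ j ∈ S, s j ≤ 1 / 2 * Real.log (partialPower a b Q S + 1))
    (hrs : ∀ j, r j = 0 ∨ r j * Real.log 2 < s j) : M3Achieves a b P r := by
  obtain ⟨κ, hκ, hκs⟩ : ∃ κ > 0, ∀ j, r j = 0 ∨ κ ≤ s j - r j * Real.log 2 := by
    obtain ⟨i, -, hi⟩ := Finset.exists_min_image (Finset.univ : Finset (Fin 3))
      (fun j => if r j = 0 then 1 else s j - r j * Real.log 2) ⟨0, Finset.mem_univ _⟩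
    refine ⟨if r i = 0 then 1 else s i - r i * Real.log 2, ?_, fun j => ?_⟩
    · split_ifs with h
      · exact one_pos
      · linarith [(hrs i).resolve_left h]
    · by_cases h : r j = 0
      · exact Or.inl h
      · refine Or.inr ((hi j (Finset.mem_univ _)).trans_eq (if_neg h))
  -- Half of the rate margin pays for the loss exp(nε) of the distance test; the other half still
  -- decays exponentially.
  set ε := κ / 2 with hε
  have hε0 : 0 < ε := by positivity
  refine ⟨hr, Q, hQP, fun n => distanceDecoder a b ε, fun n => measurable_distanceDecoder a b ε, ?_⟩
  have hbound : ∀ n, gaussianMACError a b P Q n r (distanceDecoder a b ε) ≤ atypicalProb n 1 ε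
      + ∑ S : Finset (Fin 3), atypicalProb n (partialPower a b Q S + 1)
          ((partialPower a b Q S + 1) * ε)
      + Real.exp (n * ε) * ((1 + Real.exp (-(n * κ))) ^ 3 - 1)
      + ∑ j, (gaussianVector n (Q j)).real {x | (n : ℝ) * P j < ∑ t, x t ^ 2} := by
    intro n
    rw [gaussianMACError]
    refine (average_mono fun m => (distanceDecoder_error_le a b P Q ε m).trans
      (add_le_add_left (add_le_add_right (sum_competing_messages_le a b Q ε hs
        (fun j => msgCount_sub_one_mul_exp_le (hκs j)) m) _) _)).trans_eq ?_
    exact average_const _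
  have hT : Tendsto (fun n : ℕ => Real.exp (n * ε) * ((1 + Real.exp (-(n * κ))) ^ 3 - 1))
      atTop (𝓝 0) := by
    have hlim : Tendsto (fun n : ℕ => 7 * Real.exp (-(n * ε))) atTop (𝓝 (7 * 0)) := by
      refine Tendsto.const_mul 7 (Real.tendsto_exp_neg_atTop_nhds_zero.comp ?_)
      exact tendsto_natCast_atTop_atTop.atTop_mul_const hε0
    rw [mul_zero] at hlim
    refine squeeze_zero (fun n => ?_) (fun n => ?_) hlim
    · have h1 : (0 : ℝ) ≤ Real.exp (-(n * κ)) := (Real.exp_pos _).le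
      have h2 : (1 : ℝ) ≤ (1 + Real.exp (-(n * κ))) ^ 3 := one_le_pow₀ (by linarith)
      exact mul_nonneg (Real.exp_pos _).le (by linarith)
    · set θ := Real.exp (-(n * κ)) with hθ
      have h1 : 0 ≤ θ := (Real.exp_pos _).le
      have h2 : θ ≤ 1 := Real.exp_le_one_iff.2 (by
        have : 0 ≤ (n : ℝ) * κ := by positivity
        linarith)
      -- The constant is 7 = 2³ - 1, by convexity of the cube on [0, 1].
      have h3 : (1 + θ) ^ 3 - 1 ≤ 7 * θ := by
        nlinarith [mul_nonneg h1 (sub_nonneg.2 h2), mul_nonneg (mul_nonneg h1 h1) (sub_nonneg.2 h2)]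
      have h4 : Real.exp (n * ε) * θ = Real.exp (-(n * ε)) := by
        rw [hθ, ← Real.exp_add]
        congr 1
        rw [hε]; ring
      calc Real.exp (n * ε) * ((1 + θ) ^ 3 - 1) ≤ Real.exp (n * ε) * (7 * θ) := by gcongr
        _ = 7 * Real.exp (-(n * ε)) := by rw [← h4]; ring
  have hlim := (((tendsto_atypicalProb 1 hε0).add (tendsto_finsetSum Finset.univ
    fun S (_ : S ∈ (Finset.univ : Finset (Finset (Fin 3)))) =>
      tendsto_atypicalProb (partialPower a b Q S + 1)
        (ε := (partialPower a b Q S + 1) * ε) (by positivity))).add hT).add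
    (tendsto_finsetSum Finset.univ fun j (_ : j ∈ (Finset.univ : Finset (Fin 3))) =>
      tendsto_powerViolation (hQ j))
  simp only [Finset.sum_const_zero, add_zero] at hlim
  exact squeeze_zero (fun n => average_nonneg fun m => measureReal_nonneg) hbound hlim

/-- Concavity of the logarithm, in the form of Bernoulli's inequality. -/
lemma mul_log_one_add_le {x l : ℝ} (hx : 0 ≤ x) (h0 : 0 ≤ l) (h1 : l ≤ 1) :
    l * Real.log (1 + x) ≤ Real.log (1 + l * x) := by
  rw [← Real.log_rpow (by linarith)]
  exact Real.log_le_log (Real.rpow_pos_of_pos (by linarith) _)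
    (rpow_one_add_le_one_add_mul_self (by linarith) h0 h1)

/-- Strategy M3 achieves sum-rates arbitrarily close to the mutual information. -/
lemma exists_m3Achieves (a b : ℝ) (P : Fin 3 → ℝ≥0) {θ : ℝ} (h0 : 0 < θ) (h1 : θ < 1) :
    ∃ r, M3Achieves a b P r ∧
      r 0 + r 1 + r 2 = θ ^ 2 * (1 / 2 * Real.log (1 + receivedPower a b P) / Real.log 2) := by
  have hlog2 := Real.log_pos one_lt_two
  set p := receivedPower a b P with hp
  have hp0 : 0 ≤ p := receivedPower_nonneg a b P
  set C := 1 / 2 * Real.log (1 + p) with hC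
  have hC0 : 0 ≤ C := mul_nonneg (by norm_num) (Real.log_nonneg (by linarith))
  set k : Fin 3 → ℝ := ![1, a, b] with hk
  set g : Fin 3 → ℝ := fun j => k j ^ 2 * P j with hg
  have hg0 : ∀ j, 0 ≤ g j := fun j => by positivity
  have hgp : g 0 + g 1 + g 2 = p := by simp [hg, hk, hp, receivedPower]
  -- The sum-rate C is split in proportion to the received powers. The factor θ here matches the
  -- reduction of the powers to θP; a second factor θ below makes the rates strictly smaller than s.
  set s : Fin 3 → ℝ := fun j => θ * (g j / p) * C with hs
  have hs0 : ∀ j, 0 ≤ s j := fun j => by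
    have := hg0 j
    positivity
  obtain ⟨Θ, hΘ⟩ : ∃ Θ : ℝ≥0, (Θ : ℝ) = θ := ⟨⟨θ, h0.le⟩, rfl⟩
  have hΘ1 : Θ < 1 := by rw [← NNReal.coe_lt_coe, hΘ]; exact_mod_cast h1
  have hQle : ∀ j, Θ * P j ≤ P j := fun j => mul_le_of_le_one_left' hΘ1.le
  refine ⟨fun j => θ * s j / Real.log 2, m3Achieves_of_lt (Q := fun j => Θ * P j) (s := s)
    (fun j => div_nonneg (mul_nonneg h0.le (hs0 j)) hlog2.le) hQle (fun j => ?_) (fun S => ?_)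
    (fun j => ?_), ?_⟩
  · rcases eq_or_ne (P j) 0 with h | h
    · right; simp [h]
    · left
      exact mul_lt_of_lt_one_left (pos_iff_ne_zero.2 h) hΘ1
  · have hsum : ∑ j ∈ S, s j = θ * ((∑ j ∈ S, g j) / p) * C := by
      rw [hs, ← Finset.sum_mul, ← Finset.mul_sum, ← Finset.sum_div]
    have hpart : (partialPower a b (fun j => Θ * P j) S : ℝ) = θ * ∑ j ∈ S, g j := by
      rw [coe_partialPower, Finset.mul_sum]
      refine Finset.sum_congr rfl fun j _ => ?_
      rw [NNReal.coe_mul, hΘ]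
      simp only [hg]
      ring
    have hSle : ∑ j ∈ S, g j ≤ p := by
      rw [← hgp, ← Fin.sum_univ_three]
      exact Finset.sum_le_sum_of_subset_of_nonneg (Finset.subset_univ _) fun j _ _ => hg0 j
    have hS0 : 0 ≤ ∑ j ∈ S, g j := Finset.sum_nonneg fun j _ => hg0 j
    have hq1 : (∑ j ∈ S, g j) / p ≤ 1 := div_le_one_of_le₀ hSle hp0
    have hq0 : 0 ≤ (∑ j ∈ S, g j) / p := div_nonneg hS0 hp0
    -- If p = 0, division by zero gives 0, and the partial sum is 0 as well.
    have hlp : θ * ((∑ j ∈ S, g j) / p) * p = θ * ∑ j ∈ S, g j := by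
      rcases eq_or_ne p 0 with h | h
      · have : ∑ j ∈ S, g j = 0 := le_antisymm (h ▸ hSle) hS0
        simp [this]
      · field_simp
    -- Concavity with weight θ times the power fraction of S yields the multiple access constraint
    -- for S.
    have hcon := mul_log_one_add_le hp0 (mul_nonneg h0.le hq0) (mul_le_one₀ h1.le hq0 hq1)
    rw [hlp] at hcon
    rw [hsum, hpart, hC, add_comm _ (1 : ℝ)]
    linarith
  · rcases (hs0 j).eq_or_lt with h | h
    · left; simp [← h]
    · right
      rw [div_mul_cancel₀ _ hlog2.ne']
      exact mul_lt_of_lt_one_left h h1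
  · have hone : (g 0 + g 1 + g 2) / p * C = C := by
      rcases eq_or_ne p 0 with h | h
      · simp [hC, h]
      · rw [hgp, div_self h, one_mul]
    simp only [hs]
    linear_combination θ ^ 2 / Real.log 2 * hone

/-! ### From random codebooks to codes for the X channel -/

section Derandomization

variable {n : ℕ} {r : Fin 3 → ℝ}

/-- Replace a codeword that violates the power constraint by zero. -/
def limitPower (p : ℝ≥0) (x : Fin n → ℝ) : Fin n → ℝ :=
  if ∑ t, x t ^ 2 ≤ n * p then x else 0

lemma sum_limitPower_sq_le (p : ℝ≥0) (x : Fin n → ℝ) :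
    ∑ t, limitPower p x t ^ 2 ≤ n * p := by
  unfold limitPower
  split_ifs with h
  · exact h
  · simp; positivity

/-- The code for the X channel given by codebooks of the multiple access channel. -/
def macCode (P : Fin 3 → ℝ≥0) (ω : Codebooks n r)
    {dec : (Fin n → ℝ) → (j : Fin 3) → Fin (msgCount n (r j))} (hdec : Measurable dec) :
    Code ℝ P n (macRates r) where
  enc1 i := limitPower (P 0) (ω 0 i)
  enc2 i _ := limitPower (P 1) (ω 1 i)
  enc3 i _ := limitPower (P 2) (ω 2 i)
  power1 _ := sum_limitPower_sq_le _ _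
  power2 _ _ := sum_limitPower_sq_le _ _
  power3 _ _ := sum_limitPower_sq_le _ _
  dec1 y := (dec y 0, dec y 1, dec y 2)
  dec2 _ := (0 : Fin (msgCount n 0))
  dec3 _ := (0 : Fin (msgCount n 0))
  measurable_dec1 := ((measurable_pi_apply 0).comp hdec).prodMk
    (((measurable_pi_apply 1).comp hdec).prodMk ((measurable_pi_apply 2).comp hdec))
  measurable_dec2 := measurable_const
  measurable_dec3 := measurable_const

instance (n : ℕ) : Subsingleton (Fin (msgCount n 0)) := by
  rw [msgCount_zero]; infer_instance

/-- The messages of the X channel of which only those for receiver 1 are used. -/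
def macMessagesEquiv (n : ℕ) (r : Fin 3 → ℝ) :
    Messages n (macRates r) ≃ ((j : Fin 3) → Fin (msgCount n (r j))) where
  toFun M := fun
    | 0 => M w11
    | 1 => M w12
    | 2 => M w13
  invFun m := fun
    | w11 => m 0
    | w12 => m 1
    | w13 => m 2
    | w22 => (0 : Fin (msgCount n 0))
    | w33 => (0 : Fin (msgCount n 0))
  left_inv M := by
    funext w
    cases w
    · rfl
    · rfl
    · rfl
    · exact Subsingleton.elim (α := Fin (msgCount n 0)) _ _
    · exact Subsingleton.elim (α := Fin (msgCount n 0)) _ _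
  right_inv m := by
    funext j
    fin_cases j <;> rfl

variable (P : Fin 3 → ℝ≥0) (ω : Codebooks n r)
    {dec : (Fin n → ℝ) → (j : Fin 3) → Fin (msgCount n (r j))} (hdec : Measurable dec)

lemma error2_macCode : (macCode P ω hdec).error2 = 0 := by
  have h : ∀ M : Messages n (macRates r), (Measure.pi fun _ : Fin n => gaussianReal 0 1).real
      {z | (macCode P ω hdec).dec2 (fun t => (macCode P ω hdec).sent M t 1 + z t) ≠ M w22} = 0 := by
    intro M
    convert measureReal_empty
    refine Set.eq_empty_of_forall_notMem fun z hz => hz ?_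
    exact Subsingleton.elim (α := Fin (msgCount n 0)) _ _
  simp only [Code.error2, h]
  exact average_const _

lemma error3_macCode : (macCode P ω hdec).error3 = 0 := by
  have h : ∀ M : Messages n (macRates r), (Measure.pi fun _ : Fin n => gaussianReal 0 1).real
      {z | (macCode P ω hdec).dec3 (fun t => (macCode P ω hdec).sent M t 2 + z t) ≠ M w33} = 0 := by
    intro M
    convert measureReal_empty
    refine Set.eq_empty_of_forall_notMem fun z hz => hz ?_
    exact Subsingleton.elim (α := Fin (msgCount n 0)) _ _
  simp only [Code.error3, h]
  exact average_const _

/-- Power violations already count as errors of the random strategy, so zeroing the offending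
codewords costs nothing: outside that event `limitPower` leaves the transmitted codewords unchanged.
-/
lemma error1_macCode_le (a b : ℝ) : (macCode P ω hdec).error1 (plainReceiver a b) ≤
    average fun m : (j : Fin 3) → Fin (msgCount n (r j)) =>
      (Measure.pi fun _ : Fin n => (plainReceiver a b).noise).real
        {z | dec (fun t => (plainReceiver a b).output (fun j => ω j (m j) t) (z t)) ≠ m ∨
          ∃ j, (n : ℝ) * P j < ∑ t, ω j (m j) t ^ 2} := by
  rw [← average_equiv (macMessagesEquiv n r)]
  refine average_mono fun M => measureReal_mono fun z hz => ?_
  set m := macMessagesEquiv n r M with hm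
  by_contra hcon
  simp only [Set.mem_ofPred_eq, not_or, not_not, not_exists, not_lt] at hcon
  obtain ⟨h1, h2⟩ := hcon
  have h3 : ∀ t, (plainReceiver a b).output ((macCode P ω hdec).sent M t) (z t)
      = (plainReceiver a b).output (fun j => ω j (m j) t) (z t) := by
    intro t
    have e0 : limitPower (P 0) (ω 0 (m 0)) = ω 0 (m 0) := if_pos (h2 0)
    have e1 : limitPower (P 1) (ω 1 (m 1)) = ω 1 (m 1) := if_pos (h2 1)
    have e2 : limitPower (P 2) (ω 2 (m 2)) = ω 2 (m 2) := if_pos (h2 2)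
    have : (macCode P ω hdec).sent M t = ![limitPower (P 0) (ω 0 (m 0)) t,
      limitPower (P 1) (ω 1 (m 1)) t, limitPower (P 2) (ω 2 (m 2)) t] := rfl
    rw [this, e0, e1, e2]
    rfl
  refine hz ?_
  simp only [h3]
  change (_, _, _) = (m 0, m 1, m 2)
  simp only [h1]

end Derandomization

/-- Some realization of the Gaussian codebooks is as good as their average. -/
lemma exists_error1_le (a b : ℝ) (P Q : Fin 3 → ℝ≥0) {n : ℕ} {r : Fin 3 → ℝ}
    {dec : Codebooks n r × (Fin n → ℝ) → (j : Fin 3) → Fin (msgCount n (r j))}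
    (hdec : Measurable dec) : ∃ c : Code ℝ P n (macRates r),
      c.error1 (plainReceiver a b) ≤ gaussianMACError a b P Q n r dec ∧
      c.error2 = 0 ∧ c.error3 = 0 := by
  set S : ((j : Fin 3) → Fin (msgCount n (r j))) → Set (Codebooks n r × (Fin n → ℝ)) := fun m =>
    {p | dec (p.1, fun t => (plainReceiver a b).output (fun j => p.1 j (m j) t) (p.2 t)) ≠ m ∨
        ∃ j, (n : ℝ) * P j < ∑ t, p.1 j (m j) t ^ 2} with hS
  set μ := gaussianCodebooks Q n r
  set ν := Measure.pi fun _ : Fin n => (plainReceiver a b).noise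
  have hSm : ∀ m, MeasurableSet (S m) := by
    intro m
    have h1 : Measurable fun p : Codebooks n r × (Fin n → ℝ) =>
        dec (p.1, fun t => (plainReceiver a b).output (fun j => p.1 j (m j) t) (p.2 t)) := by
      refine hdec.comp ?_
      unfold plainReceiver
      fun_prop
    have h2 : {p : Codebooks n r × (Fin n → ℝ) | ∃ j, (n : ℝ) * P j < ∑ t, p.1 j (m j) t ^ 2}
        = ⋃ j, {p | (n : ℝ) * P j < ∑ t, p.1 j (m j) t ^ 2} := by
      ext p; simp
    have h3 : MeasurableSet {p : Codebooks n r × (Fin n → ℝ) |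
        ∃ j, (n : ℝ) * P j < ∑ t, p.1 j (m j) t ^ 2} := by
      rw [h2]
      exact MeasurableSet.iUnion fun j => measurableSet_lt measurable_const (by fun_prop)
    exact (h1 (measurableSet_singleton m).compl).union h3
  have hint : ∀ m, Integrable (fun ω => ν.real (Prod.mk ω ⁻¹' S m)) μ := fun m =>
    Measure.integrable_measure_prodMk_left (hSm m) (measure_ne_top _ _)
  -- By Fubini, the error of the strategy is the mean over codebooks of the error of a fixed
  -- codebook, so some codebook does no worse than the mean.
  have hE : gaussianMACError a b P Q n r dec
      = ∫ ω, average (fun m => ν.real (Prod.mk ω ⁻¹' S m)) ∂μ := by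
    simp only [average]
    rw [integral_div, integral_finsetSum _ fun m _ => hint m]
    unfold gaussianMACError average
    congr 1
    refine Finset.sum_congr rfl fun m _ => ?_
    change (μ.prod ν).real (S m) = _
    rw [measureReal_def, Measure.prod_apply (hSm m), ← integral_toReal
      (measurable_measure_prodMk_left (hSm m)).aemeasurable (ae_of_all _ fun _ => measure_lt_top _ _)]
    rfl
  have hI : Integrable (fun ω => average (fun m => ν.real (Prod.mk ω ⁻¹' S m))) μ := by
    unfold average
    exact (integrable_finsetSum _ fun m _ => hint m).div_const _
  obtain ⟨ω, hω⟩ := exists_le_integral hI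
  have hω' : Measurable fun y => dec (ω, y) := hdec.comp measurable_prodMk_left
  exact ⟨macCode P ω hω', (error1_macCode_le P ω hω' a b).trans (hE ▸ hω),
    error2_macCode P ω hω', error3_macCode P ω hω'⟩

lemma macRates_achievable {a b : ℝ} {P : Fin 3 → ℝ≥0} {r : Fin 3 → ℝ}
    (h : M3Achieves a b P r) : Achievable (plainReceiver a b) P (macRates r) := by
  obtain ⟨hr, Q, -, dec, hdec, hlim⟩ := h
  choose c h1 h2 h3 using fun n => exists_error1_le a b P Q (hdec n)
  refine ⟨fun w => ?_, c, squeeze_zero (fun n => average_nonneg fun _ => measureReal_nonneg) h1 hlim,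
    ?_, ?_⟩
  · cases w
    exacts [hr 0, hr 1, hr 2, le_rfl, le_rfl]
  · simp only [h2, tendsto_const_nhds]
  · simp only [h3, tendsto_const_nhds]

lemma sumRate_macRates (r : Fin 3 → ℝ) : sumRate (macRates r) = r 0 + r 1 + r 2 := by
  simp [sumRate, macRates]

/-! ### Sum-rate bounds and the capacity regions -/

/-- Derandomization turns the strategy into deterministic codes that satisfy the power constraints,
and to these the converse applies. -/
lemma m3Achieves_sum_le {a b : ℝ} {P : Fin 3 → ℝ≥0} {r : Fin 3 → ℝ} (h : M3Achieves a b P r) :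
    r 0 + r 1 + r 2 ≤ 1 / 2 * Real.log (1 + receivedPower a b P) / Real.log 2 := by
  obtain ⟨-, c, h1, -, -⟩ := macRates_achievable h
  rw [le_div_iff₀ (Real.log_pos one_lt_two)]
  exact le_of_forall_one_sub_mul_le h1 fun n => plain_converse (c n)

/-- The code for the genie-aided channel that ignores the side information. -/
def Code.ignoreGenie {P : Fin 3 → ℝ≥0} {n : ℕ} {R : RateVector} (c : Code ℝ P n R) :
    Code (ℝ × ℝ) P n R where
  __ := c
  dec1 y := c.dec1 fun t => (y t).1
  measurable_dec1 := c.measurable_dec1.comp (by fun_prop)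

lemma Code.error1_ignoreGenie {P : Fin 3 → ℝ≥0} {n : ℕ} {R : RateVector} (c : Code ℝ P n R)
    (a b η ρ : ℝ) : c.ignoreGenie.error1 (genieReceiver a b η ρ) = c.error1 (plainReceiver a b) := by
  unfold Code.error1
  congr 1
  ext m
  have h := pi_real_preimage_eval (ι := Fin n) (μ := correlatedNoise ρ) measurable_fst
    (S := {z | c.dec1 (fun t => (plainReceiver a b).output (c.sent m t) (z t))
      ≠ (m w11, m w12, m w13)}) (by
      have : Measurable fun z : Fin n → ℝ =>
          c.dec1 (fun t => (plainReceiver a b).output (c.sent m t) (z t)) := by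
        refine c.measurable_dec1.comp ?_
        unfold plainReceiver
        fun_prop
      exact this (measurableSet_singleton (m w11, m w12, m w13)).compl)
  rw [map_fst_correlatedNoise] at h
  exact h

lemma capacityRegion_plain_subset_genie (a b η ρ : ℝ) (P : Fin 3 → ℝ≥0) :
    capacityRegion (plainReceiver a b) P ⊆ capacityRegion (genieReceiver a b η ρ) P := by
  refine closure_mono fun R hR => ?_
  obtain ⟨hR0, c, h1, h2, h3⟩ := hR
  refine ⟨hR0, fun n => (c n).ignoreGenie, ?_, h2, h3⟩
  simpa only [Code.error1_ignoreGenie] using h1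

lemma continuous_sumRate : Continuous sumRate := by
  unfold sumRate; fun_prop

lemma nonneg_of_mem_capacityRegion {N Y : Type} [MeasurableSpace N] [MeasurableSpace Y]
    {ch : ReceiverOne N Y} {P : Fin 3 → ℝ≥0} {R : RateVector} (hR : R ∈ capacityRegion ch P) :
    0 ≤ R :=
  closure_minimal (t := Set.Ici 0) (fun _ h => h.1) isClosed_Ici hR

lemma sumRate_le_of_mem_capacityRegion {N Y : Type} [MeasurableSpace N] [MeasurableSpace Y]
    {ch : ReceiverOne N Y} {P : Fin 3 → ℝ≥0} {B : ℝ} (h : ∀ R, Achievable ch P R → sumRate R ≤ B)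
    {R : RateVector} (hR : R ∈ capacityRegion ch P) : sumRate R ≤ B :=
  closure_minimal (t := {R | sumRate R ≤ B}) h
    (isClosed_le continuous_sumRate continuous_const) hR

lemma genie_sumRate_le {a b η ρ : ℝ} {P : Fin 3 → ℝ≥0} {R : RateVector} (hρ : ρ ^ 2 < 1)
    (hη : η * ρ = 1 + b ^ 2 * P 2) (ha : η ^ 2 ≤ a ^ 2) (hb : 1 ≤ b ^ 2) {τ v w : ℝ≥0}
    (hτ0 : τ ≠ 0) (hv0 : v ≠ 0) (hw0 : w ≠ 0) (hτ : (τ : ℝ) = η ^ 2 * (1 - ρ ^ 2))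
    (hv : (v : ℝ) = 1 + receivedPower a b P) (hw : (w : ℝ) = η ^ 2 - η * ρ)
    (hR : Achievable (genieReceiver a b η ρ) P R) :
    sumRate R ≤ 1 / 2 * Real.log (v * w / τ) / Real.log 2 := by
  obtain ⟨hR0, c, h1, h2, h3⟩ := hR
  have hs : 0 ≤ sumRate R := by
    unfold sumRate
    linarith [hR0 w11, hR0 w12, hR0 w13, hR0 w22, hR0 w33]
  rw [le_div_iff₀ (Real.log_pos one_lt_two)]
  have hε := (h1.add h2).add h3
  simp only [add_zero] at hε
  exact le_of_forall_one_sub_mul_le hε fun n =>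
    (c n).genie_converse hs hρ hη ha hb hτ0 hv0 hw0 hτ hv hw

/-- The sum-rate capacity is attained. -/
lemma exists_isGreatest_sumRate {N Y : Type} [MeasurableSpace N] [MeasurableSpace Y]
    {ch : ReceiverOne N Y} {P : Fin 3 → ℝ≥0} {B : ℝ}
    (hne : (capacityRegion ch P).Nonempty) (h : ∀ R ∈ capacityRegion ch P, sumRate R ≤ B) :
    ∃ C, IsGreatest (sumRate '' capacityRegion ch P) C := by
  -- Nonnegative rates with bounded sum lie in a box, so the closed region is compact and the
  -- continuous sum-rate attains its maximum.
  have hsub : capacityRegion ch P ⊆ Set.Icc 0 (fun _ => B) := by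
    intro R hR
    have h0 := nonneg_of_mem_capacityRegion hR
    have hB := h R hR
    refine ⟨h0, fun w => ?_⟩
    have h11 := h0 w11
    have h12 := h0 w12
    have h13 := h0 w13
    have h22 := h0 w22
    have h33 := h0 w33
    simp only [Pi.zero_apply] at h11 h12 h13 h22 h33
    unfold sumRate at hB
    cases w <;> linarith
  have hc : IsCompact (capacityRegion ch P) := isCompact_Icc.of_isClosed_subset isClosed_closure hsub
  exact (hc.image continuous_sumRate).exists_isGreatest (hne.image _)

end ManyToOneX

end

/-! ### Assembly of the bounds and the gap -/

theorem theorem3 (a b ρ η : ℝ) (P : Fin 3 → ℝ≥0)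
    (hρ0 : ρ ≠ 0) (hρ1 : ρ ^ 2 < 1)
    (ha : (1 + b ^ 2 * P 2) ^ 2 / ρ ^ 2 ≤ a ^ 2) (hb : 1 ≤ b ^ 2)
    (hη : η = (1 + b ^ 2 * P 2) / ρ) :
    ∃ rateM3 outerBound capacity : ℝ,
      -- `rateM3` is the sum-rate of strategy M3, and it is `I(x₁, x₂, x₃ ; y₁)`
      IsLUB {s | ∃ r, ManyToOneX.M3Achieves a b P r ∧ s = r 0 + r 1 + r 2} rateM3 ∧
      ManyToOneX.gaussianInputInfo (ManyToOneX.plainReceiver a b) P = ENNReal.ofReal rateM3 ∧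
      (∀ r, ManyToOneX.M3Achieves a b P r →
        ManyToOneX.macRates r ∈ ManyToOneX.capacityRegion (ManyToOneX.plainReceiver a b) P) ∧
      -- `outerBound` is `I(x₁, x₂, x₃ ; y₁, s₁)`, a bound for the genie-aided channel
      ManyToOneX.gaussianInputInfo (ManyToOneX.genieReceiver a b η ρ) P
        = ENNReal.ofReal outerBound ∧
      ManyToOneX.capacityRegion (ManyToOneX.plainReceiver a b) P
        ⊆ ManyToOneX.capacityRegion (ManyToOneX.genieReceiver a b η ρ) P ∧
      (∀ R ∈ ManyToOneX.capacityRegion (ManyToOneX.genieReceiver a b η ρ) P,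
        ManyToOneX.sumRate R ≤ outerBound) ∧
      -- `capacity` is the sum-rate capacity
      IsGreatest (ManyToOneX.sumRate ''
        ManyToOneX.capacityRegion (ManyToOneX.plainReceiver a b) P) capacity ∧
      rateM3 ≤ capacity ∧ capacity ≤ outerBound ∧
      -- the gap
      outerBound - rateM3
        = 1 / 2 * Real.logb 2 ((1 - (1 + b ^ 2 * P 2)⁻¹ * ρ ^ 2) / (1 - ρ ^ 2)) := by
  have hlog2 := Real.log_pos one_lt_two
  set A : ℝ := 1 + b ^ 2 * P 2 with hA
  have hA1 : 1 ≤ A := by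
    have : 0 ≤ b ^ 2 * (P 2 : ℝ) := by positivity
    linarith
  have hA0 : 0 < A := by linarith
  have hηρ : η * ρ = A := by rw [hη, div_mul_cancel₀ _ hρ0]
  have hη2 : η ^ 2 = A ^ 2 / ρ ^ 2 := by rw [hη, div_pow]
  have haη : η ^ 2 ≤ a ^ 2 := hη2 ▸ ha
  have hρ2 : 0 < ρ ^ 2 := by positivity
  have h1ρ : 0 < 1 - ρ ^ 2 := by linarith
  have hη0 : 0 < η ^ 2 := by rw [hη2]; positivity
  have hp0 := ManyToOneX.receivedPower_nonneg a b P
  have hτpos : 0 < η ^ 2 * (1 - ρ ^ 2) := mul_pos hη0 h1ρ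
  -- Positivity of the variance of s - y: ηρ = A ≤ A² = η²ρ² < η², using A ≥ 1 and ρ² < 1.
  have hwpos : 0 < η ^ 2 - η * ρ := by
    rw [hηρ, sub_pos]
    calc A ≤ A ^ 2 := by nlinarith
      _ = η ^ 2 * ρ ^ 2 := by rw [← mul_pow, hηρ]
      _ < η ^ 2 := mul_lt_of_lt_one_right hη0 hρ1
  have hvpos : 0 < 1 + ManyToOneX.receivedPower a b P := by linarith
  obtain ⟨τ, hτ⟩ : ∃ τ : ℝ≥0, (τ : ℝ) = η ^ 2 * (1 - ρ ^ 2) := ⟨⟨_, hτpos.le⟩, rfl⟩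
  obtain ⟨v, hv⟩ : ∃ v : ℝ≥0, (v : ℝ) = 1 + ManyToOneX.receivedPower a b P :=
    ⟨⟨_, hvpos.le⟩, rfl⟩
  obtain ⟨w, hw⟩ : ∃ w : ℝ≥0, (w : ℝ) = η ^ 2 - η * ρ := ⟨⟨_, hwpos.le⟩, rfl⟩
  have hτ0 : τ ≠ 0 := by rw [← NNReal.coe_ne_zero, hτ]; exact hτpos.ne'
  have hv0 : v ≠ 0 := by rw [← NNReal.coe_ne_zero, hv]; exact hvpos.ne'
  have hw0 : w ≠ 0 := by rw [← NNReal.coe_ne_zero, hw]; exact hwpos.ne'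
  have hlub : IsLUB {s | ∃ r, ManyToOneX.M3Achieves a b P r ∧ s = r 0 + r 1 + r 2}
      (1 / 2 * Real.log (1 + ManyToOneX.receivedPower a b P) / Real.log 2) := by
    refine ⟨?_, fun u hu => ?_⟩
    · rintro s ⟨r, hr, rfl⟩
      exact ManyToOneX.m3Achieves_sum_le hr
    · set C := 1 / 2 * Real.log (1 + ManyToOneX.receivedPower a b P) / Real.log 2
      -- The sum-rates θ²C are achieved for all θ < 1, so the supremum is C without C itself having
      -- to be achieved.
      have hcont : Tendsto (fun θ : ℝ => θ ^ 2 * C) (𝓝[<] 1) (𝓝 (1 ^ 2 * C)) :=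
        ((continuous_id.pow 2).mul continuous_const).continuousAt.mono_left nhdsWithin_le_nhds
      rw [one_pow, one_mul] at hcont
      refine le_of_tendsto hcont ?_
      filter_upwards [Ioo_mem_nhdsLT (zero_lt_one (α := ℝ))] with θ hθ
      obtain ⟨r, hr, hsum⟩ := ManyToOneX.exists_m3Achieves a b P hθ.1 hθ.2
      exact hu ⟨r, hr, hsum.symm⟩
  have hM3 : ∀ r, ManyToOneX.M3Achieves a b P r →
      ManyToOneX.macRates r ∈ ManyToOneX.capacityRegion (ManyToOneX.plainReceiver a b) P :=
    fun r hr => subset_closure (ManyToOneX.macRates_achievable hr)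
  have hsub := ManyToOneX.capacityRegion_plain_subset_genie a b η ρ P
  have hgenie : ∀ R ∈ ManyToOneX.capacityRegion (ManyToOneX.genieReceiver a b η ρ) P,
      ManyToOneX.sumRate R ≤ 1 / 2 * Real.log (v * w / τ) / Real.log 2 := fun R hR =>
    ManyToOneX.sumRate_le_of_mem_capacityRegion (fun R hR =>
      ManyToOneX.genie_sumRate_le hρ1 hηρ haη hb hτ0 hv0 hw0 hτ hv hw hR) hR
  -- Any θ in (0, 1) would do; this only shows that the capacity region is nonempty.
  obtain ⟨r₀, hr₀, -⟩ := ManyToOneX.exists_m3Achieves a b P one_half_pos one_half_lt_one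
  obtain ⟨C, hC⟩ := ManyToOneX.exists_isGreatest_sumRate ⟨_, hM3 r₀ hr₀⟩
    fun R hR => hgenie R (hsub hR)
  refine ⟨_, _, C, hlub, ManyToOneX.gaussianInputInfo_plainReceiver a b P, hM3,
    ManyToOneX.gaussianInputInfo_genieReceiver hρ1 hηρ hτ0 hv0 hw0 hτ hv hw, hsub, hgenie, hC,
    ?_, ?_, ?_⟩
  · refine hlub.2 ?_
    rintro s ⟨r, hr, rfl⟩
    exact hC.2 ⟨_, hM3 r hr, ManyToOneX.sumRate_macRates r⟩
  · obtain ⟨R, hR, rfl⟩ := hC.1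
    exact hgenie R (hsub hR)
  -- Both bounds share the term ½ log v, so the gap is ½ log(w / τ), where w / τ = (1 - A / η²) / (1
  -- - ρ²) and A / η² = ρ² / A.
  · have hratio : (w : ℝ) / τ = (1 - A⁻¹ * ρ ^ 2) / (1 - ρ ^ 2) := by
      rw [hw, hτ, hηρ, hη2]
      field_simp
    rw [← hratio, ← hv, mul_div_assoc (v : ℝ), Real.log_mul (NNReal.coe_ne_zero.2 hv0)
      (div_ne_zero (NNReal.coe_ne_zero.2 hw0) (NNReal.coe_ne_zero.2 hτ0)), Real.logb]
    ring
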